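/- Let $p\ge 2$ be an integer and let $a_1,\dots,a_{p+1},b_1,\dots,b_p\in\mathbb C\setminus\{0,-1,-2,\dots\}$ satisfy $s=\sum_{j=1}^p b_j-\sum_{j=1}^{p+1}a_j=0$. Write $(x)_n=x(x+1)\cdots(x+n-1)$, $\psi=\Gamma'/\Gamma$, and let $\log$ be the principal logarithm. Let $D=\{z:|1-z|<1,\ |\arg(1-z)|<\pi\}$ (so $z\ne1$ in $D$). The coefficients $A_k^{(p)}=A_k^{(p)}(a_3,\dots,a_{p+1};b_1,\dots,b_p)$, $k\ge0$, are defined recursively by $$A_k^{(2)}=\frac{(b_2-a_3)_k(b_1-a_3)_k}{k!},$$ $$A_k^{(p)}=\frac{(X)_k(b_1-a_3)_k}{k!}\sum_{l=0}^k\frac{(-k)_l}{(X)_l\,(1+a_3-b_1-k)_l}\,A_l^{(p-1)}(a_4,\dots,a_{p+1};b_2,\dots,b_p)\qquad(p\ge3),$$ $$X=\sum_{j=2}^{p}b_j-\sum_{j=3}^{p+1}a_j.$$ For $p=3$ one may equivalently take $$A_k^{(3)}=\frac{(P)_k(Q)_k}{k!}\;{}_3F_2\!\left(\begin{matrix}b_3-a_3,\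 b_3-a_4,\ -k\\ P,\ Q\end{matrix};1\right),\qquad P=b_1+b_3-a_3-a_4,\quad Q=b_2+b_3-a_3-a_4,$$ and for $p=4$, with $P=b_1+b_3+b_4-a_3-a_4-a_5$, $Q=b_2+b_3+b_4-a_3-a_4-a_5$, $U=b_3+b_4-a_3-a_5$, $V=b_3+b_4-a_4-a_5$, $$A_k^{(4)}=\frac{(P)_k(Q)_k}{k!}\sum_{l=0}^k\frac{(U)_l(V)_l(-k)_l}{(P)_l(Q)_l\,l!}\;{}_3F_2\!\left(\begin{matrix}b_3-a_5,\ b_4-a_5,\ -l\\ U,\ V\end{matrix};1\right).$$ (All these are polynomials in the parameters after cancelling $(x)_k/(x)_l=(x+l)_{k-l}$ for $x\in\{X,P,Q,U,V\}$ and $\frac{(-k)_l\,(y)_k}{k!\,(1-y-k)_l}=\frac{(y)_{k-l}}{(k-l)!}$ with $y=b_1-a_3$; they are understood in this cancelled form, so that no denominator can vanish.) Then the sum of the series ${}_{p+1}F_p(a_1,\dots,a_{p+1};b_1,\dots,b_p;z)$, $|z|<1$, extends (uniquely) to a holomorphic function, denoted in the same way, on $\{|z|<1\}\cup D$, and there is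 a sequence $(T_n)_{n\ge0}$ of complex numbers such that the following holds. (i) For each $n\ge 0$ with $\Re(a_3+n)>0,\dots,\Re(a_{p+1}+n)>0$, the series below converges absolutely and $$T_n=\sum_{k=n+1}^\infty\frac{(k-n-1)!}{(a_1)_k(a_2)_k}A_k^{(p)} .$$ (ii) For all $z\in D$, with an absolutely convergent series over $n$, $$\frac{\Gamma(a_1)\cdots\Gamma(a_{p+1})}{\Gamma(b_1)\cdots\Gamma(b_p)}\;{}_{p+1}F_p\!\left(\begin{matrix}a_1,\dots,a_{p+1}\\ b_1,\dots,b_p\end{matrix};z\right)=\sum_{n=0}^\infty\frac{(a_1)_n(a_2)_n}{n!\,n!}\Bigl\{\sum_{k=0}^n\frac{(-n)_k}{(a_1)_k(a_2)_k}A_k^{(p)}\bigl[\psi(1+n-k)+\psi(1+n)-\psi(a_1+n)-\psi(a_2+n)-\log(1-z)\bigr]+(-1)^n\,n!\,T_n\Bigr\}(1-z)^n .$$ (iii) As $z\to1$ in $D$, with $L(p)=2\psi(1)-\psi(a_1)-\psi(a_2)+B(p)$, $B(p)=T_0$, the left-hand side of (ii) equals $$L(p)\,[1+O(1-z)]-\log(1-z)\,[1+O(1-z)]$$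 and also $$L(p)-\log(1-z)+O\bigl((1-z)\log(1-z)\bigr).$$ If $\Re(a_j)>0$ for $j=3,\dots,p+1$, then $$B(p)=\sum_{k=1}^\infty\frac{(k-1)!}{(a_1)_k(a_2)_k}A_k^{(p)},$$ the series being absolutely convergent. -/

import Mathlib

/- Parameters are `a b : ℕ → ℂ` with the 1-based indexing of the mathematics: the numerator
parameters are `a 1, …, a (p+1)` and the denominator parameters `b 1, …, b p`; no other values
of `a` and `b` are ever used. -/

open Finset Filter Topology Asymptotics

open scoped Nat

namespace ZeroBalanced

/-- The Pochhammer symbol `(x)_n = x (x+1) ⋯ (x+n-1)`. -/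
noncomputable def poch (x : ℂ) (n : ℕ) : ℂ := (ascPochhammer ℂ n).eval x

theorem poch_add (x : ℂ) (l m : ℕ) : poch x (l + m) = poch x l * poch (x + l) m := by
  simp [poch, ← ascPochhammer_mul]

theorem poch_zero (x : ℂ) : poch x 0 = 1 := by simp [poch]

theorem poch_succ (x : ℂ) (n : ℕ) : poch x (n + 1) = poch x n * (x + n) := by
  simp [poch, ascPochhammer_succ_eval]

/-- The `n`-th term of the series `_{p+1}F_p(a_1, …, a_{p+1}; b_1, …, b_p; z)`. -/
noncomputable def hypTerm (p : ℕ) (a b : ℕ → ℂ) (z : ℂ) (n : ℕ) : ℂ :=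
  (∏ j ∈ Icc 1 (p + 1), poch (a j) n) / (∏ j ∈ Icc 1 p, poch (b j) n) * (z ^ n / (n ! : ℂ))

/-- The set `|1 - z| < 1`, `|arg (1 - z)| < π`, that is, the disc of radius 1 around 1 with the
cut `[1, 2)` removed. -/
def cutDisc : Set ℂ := {z | ‖1 - z‖ < 1 ∧ 1 - z ∈ Complex.slitPlane}

/-- `F` is the function `_{p+1}F_p(a; b; ·)` on the connected open set formed by the unit disc and
the cut disc around 1: it is the sum of the hypergeometric series in the unit disc, and it is
holomorphic on the union. -/
def IsHypFunction (p : ℕ) (a b : ℕ → ℂ) (F : ℂ → ℂ) : Prop :=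
  (∀ z : ℂ, ‖z‖ < 1 → HasSum (hypTerm p a b z) (F z)) ∧
    DifferentiableOn ℂ F (Metric.ball 0 1 ∪ cutDisc)

/-- `Γ(a_1) ⋯ Γ(a_{p+1}) / (Γ(b_1) ⋯ Γ(b_p))`. -/
noncomputable def gammaFactor (p : ℕ) (a b : ℕ → ℂ) : ℂ :=
  (∏ j ∈ Icc 1 (p + 1), Complex.Gamma (a j)) / ∏ j ∈ Icc 1 p, Complex.Gamma (b j)

/-- `b_p + ⋯ + b_2 - a_{p+1} - ⋯ - a_3`. -/
noncomputable def excess (p : ℕ) (a b : ℕ → ℂ) : ℂ :=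
  ∑ j ∈ Icc 2 p, b j - ∑ j ∈ Icc 3 (p + 1), a j

/-- The coefficients `A_k^{(p)}`, for `p ≥ 2` (the values for `p < 2` are not used), as iterated
finite sums. In each of the nested sums the quotients
`(x)_k / (x)_l = (x+l)_{k-l}` and `(-k)_l (y)_k / (k! (1-y-k)_l) = (y)_{k-l} / (k-l)!`
are written in the form that has no denominator which can vanish; see `coeff_eq`. -/
noncomputable def coeff : ℕ → (ℕ → ℂ) → (ℕ → ℂ) → ℕ → ℂ
  | 0, _, _, _ => 0
  | 1, _, _, _ => 0
  | 2, a, b, k => poch (b 2 - a 3) k * poch (b 1 - a 3) k / (k ! : ℂ)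
  | p + 3, a, b, k =>
      ∑ l ∈ range (k + 1),
        poch (excess (p + 3) a b + l) (k - l) * poch (b 1 - a 3) (k - l) / ((k - l)! : ℂ) *
          coeff (p + 2) (fun j => a (j + 1)) (fun j => b (j + 1)) l

/-- An alternative form of `A_k^{(3)}`, with `(x)_k / (x)_l` written as `(x+l)_{k-l}`. -/
noncomputable def coeffThree (a b : ℕ → ℂ) (k : ℕ) : ℂ :=
  1 / (k ! : ℂ) * ∑ l ∈ range (k + 1),
    poch (b 1 + b 3 - a 3 - a 4 + l) (k - l) * poch (b 2 + b 3 - a 3 - a 4 + l) (k - l) *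
      (poch (b 3 - a 3) l * poch (b 3 - a 4) l * poch (-(k : ℂ)) l / (l ! : ℂ))

/-- An alternative form of `A_k^{(4)}`, with `(x)_k / (x)_l` written as `(x+l)_{k-l}`. -/
noncomputable def coeffFour (a b : ℕ → ℂ) (k : ℕ) : ℂ :=
  1 / (k ! : ℂ) * ∑ l ∈ range (k + 1),
    poch (b 1 + b 3 + b 4 - a 3 - a 4 - a 5 + l) (k - l) *
      poch (b 2 + b 3 + b 4 - a 3 - a 4 - a 5 + l) (k - l) * (poch (-(k : ℂ)) l / (l ! : ℂ)) *
      ∑ m ∈ range (l + 1),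
        poch (b 3 + b 4 - a 3 - a 5 + m) (l - m) * poch (b 3 + b 4 - a 4 - a 5 + m) (l - m) *
          (poch (b 3 - a 5) m * poch (b 4 - a 5) m * poch (-(l : ℂ)) m / (m ! : ℂ))

/-- `A` is the sequence `A_k^{(p)}`, in any one of its representations. -/
def IsCoeff (p : ℕ) (a b : ℕ → ℂ) (A : ℕ → ℂ) : Prop :=
  A = coeff p a b ∨ (p = 3 ∧ A = coeffThree a b) ∨ (p = 4 ∧ A = coeffFour a b)

/-- The term of index `k = n + 1 + i` of the series
`∑_{k ≥ n+1} (k-n-1)! A_k / ((a_1)_k (a_2)_k)`. -/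
noncomputable def tailTerm (a A : ℕ → ℂ) (n i : ℕ) : ℂ :=
  (i ! : ℂ) / (poch (a 1) (n + 1 + i) * poch (a 2) (n + 1 + i)) * A (n + 1 + i)

/-- The `n`-th term of the expansion around `z = 1`, with `T` in the place of the infinite series
`∑_{k ≥ n+1} (k-n-1)! A_k / ((a_1)_k (a_2)_k)`. -/
noncomputable def expansionTerm (a A : ℕ → ℂ) (T z : ℂ) (n : ℕ) : ℂ :=
  poch (a 1) n * poch (a 2) n / ((n ! : ℂ) * (n ! : ℂ)) *
    ((∑ k ∈ range (n + 1), poch (-(n : ℂ)) k / (poch (a 1) k * poch (a 2) k) * A k *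
        (Complex.digamma (1 + n - k) + Complex.digamma (1 + n) - Complex.digamma (a 1 + n)
          - Complex.digamma (a 2 + n) - Complex.log (1 - z)))
      + (-1) ^ n * (n ! : ℂ) * T) * (1 - z) ^ n

/-- `B(p) = ∑_{k ≥ 1} (k-1)! A_k / ((a_1)_k (a_2)_k)`. -/
noncomputable def constB (a A : ℕ → ℂ) : ℂ := ∑' i : ℕ, tailTerm a A 0 i

/-- `L = 2 ψ(1) - ψ(a_1) - ψ(a_2) + B`. -/
noncomputable def constL (a : ℕ → ℂ) (B : ℂ) : ℂ :=
  2 * Complex.digamma 1 - Complex.digamma (a 1) - Complex.digamma (a 2) + B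

/-! ### The pole-free forms agree with the quotient forms -/

theorem poch_div {x : ℂ} {k l : ℕ} (hl : l ≤ k) (hx : poch x l ≠ 0) :
    poch x k / poch x l = poch (x + l) (k - l) := by
  obtain ⟨m, rfl⟩ := Nat.exists_eq_add_of_le hl
  rw [poch_add, Nat.add_sub_cancel_left]
  field_simp

theorem poch_reflect (y : ℂ) (l m : ℕ) :
    poch y (l + m) = (-1) ^ l * poch y m * poch (1 - y - (l + m : ℕ)) l := by
  induction l generalizing y with
  | zero => simp [poch_zero]
  | succ l ih =>
    have h1 : poch y (l + 1 + m) = y * poch (y + 1) (l + m) := by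
      rw [show l + 1 + m = 1 + (l + m) by ring, poch_add]
      simp [poch]
    have h2 : y * poch (y + 1) m = poch y m * (y + m) := by
      rw [← poch_succ, add_comm m 1, poch_add]
      simp [poch]
    rw [h1, ih, poch_succ]
    have e : (1 - y - ((l + 1 + m : ℕ) : ℂ)) = 1 - (y + 1) - ((l + m : ℕ) : ℂ) := by
      push_cast; ring
    rw [e]
    have e2 : 1 - (y + 1) - ((l + m : ℕ) : ℂ) + l = -(y + m) := by push_cast; ring
    rw [e2, pow_succ]
    linear_combination (-1) ^ l * poch (1 - (y + 1) - ((l + m : ℕ) : ℂ)) l * h2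

theorem poch_neg (l m : ℕ) :
    poch (-((l + m : ℕ) : ℂ)) l * (m ! : ℂ) = (-1) ^ l * ((l + m)! : ℂ) := by
  have h := poch_reflect 1 l m
  have hf : ∀ n : ℕ, poch 1 n = (n ! : ℂ) := fun n => by
    simp [poch, ascPochhammer_eval_one]
  rw [hf, hf] at h
  have e : (1 - 1 - ((l + m : ℕ) : ℂ)) = -((l + m : ℕ) : ℂ) := by ring
  rw [e] at h
  have h3 : ((-1 : ℂ) ^ l) * (-1) ^ l = 1 := by rw [← mul_pow]; simp
  rw [h]
  linear_combination -(poch (-((l + m : ℕ) : ℂ)) l * (m ! : ℂ)) * h3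

/-- The nested quotient form of `A_k^{(p)}`, wherever its denominators do not vanish. -/
theorem coeff_eq (p : ℕ) (a b : ℕ → ℂ) (k : ℕ)
    (hX : ∀ l ≤ k, poch (excess (p + 3) a b) l ≠ 0)
    (hY : ∀ l ≤ k, poch (1 + a 3 - b 1 - k) l ≠ 0) :
    coeff (p + 3) a b k =
      poch (excess (p + 3) a b) k * poch (b 1 - a 3) k / (k ! : ℂ) *
        ∑ l ∈ range (k + 1), poch (-(k : ℂ)) l /
          (poch (excess (p + 3) a b) l * poch (1 + a 3 - b 1 - k) l) *
          coeff (p + 2) (fun j => a (j + 1)) (fun j => b (j + 1)) l := by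
  rw [coeff, mul_sum]
  refine sum_congr rfl fun l hl => ?_
  have hl' : l ≤ k := by simpa [Nat.lt_succ_iff] using hl
  rw [← poch_div hl' (hX l hl')]
  have hXl := hX l hl'
  have hYl := hY l hl'
  obtain ⟨m, rfl⟩ := Nat.exists_eq_add_of_le hl'
  rw [Nat.add_sub_cancel_left]
  have hr := poch_reflect (b 1 - a 3) l m
  have e : 1 - (b 1 - a 3) - ((l + m : ℕ) : ℂ) = 1 + a 3 - b 1 - ((l + m : ℕ) : ℂ) := by ring
  rw [e] at hr
  have hn := poch_neg l m
  have hm : (m ! : ℂ) ≠ 0 := by exact_mod_cast m.factorial_ne_zero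
  have hk : ((l + m)! : ℂ) ≠ 0 := by exact_mod_cast (l + m).factorial_ne_zero
  have h3 : ((-1 : ℂ) ^ l) * (-1) ^ l = 1 := by rw [← mul_pow]; simp
  have key : poch (b 1 - a 3) m / (m ! : ℂ) =
      poch (b 1 - a 3) (l + m) / ((l + m)! : ℂ) * (poch (-((l + m : ℕ) : ℂ)) l /
        poch (1 + a 3 - b 1 - ((l + m : ℕ) : ℂ)) l) := by
    rw [hr]
    field_simp
    linear_combination (-(-1) ^ l) * poch (b 1 - a 3) m * hn
      - poch (b 1 - a 3) m * ((l + m)! : ℂ) * h3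
  rw [mul_div_assoc, key]
  field_simp

/-- The quotient form of `coeffThree`, wherever its denominators do not vanish. -/
theorem coeffThree_eq (a b : ℕ → ℂ) (k : ℕ)
    (hX : ∀ l ≤ k, poch (b 1 + b 3 - a 3 - a 4) l ≠ 0)
    (hY : ∀ l ≤ k, poch (b 2 + b 3 - a 3 - a 4) l ≠ 0) :
    coeffThree a b k =
      poch (b 1 + b 3 - a 3 - a 4) k * poch (b 2 + b 3 - a 3 - a 4) k / (k ! : ℂ) *
        ∑ l ∈ range (k + 1), poch (b 3 - a 3) l * poch (b 3 - a 4) l * poch (-(k : ℂ)) l /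
          (poch (b 1 + b 3 - a 3 - a 4) l * poch (b 2 + b 3 - a 3 - a 4) l * (l ! : ℂ)) := by
  rw [coeffThree, mul_sum, mul_sum]
  refine sum_congr rfl fun l hl => ?_
  have hl' : l ≤ k := by simpa [Nat.lt_succ_iff] using hl
  have h1 := hX l hl'
  have h2 := hY l hl'
  rw [← poch_div hl' h1, ← poch_div hl' h2]
  field_simp

theorem quot_aux (K X Y q1 q2 N lf U V q3 q4 P Q M mf : ℂ) :
    1 / K * (X / q1 * (Y / q2) * (N / lf) * (U / q3 * (V / q4) * (P * Q * M / mf))) =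
      X * Y / K * (U * V * N / (q1 * q2 * lf) * (P * Q * M / (q3 * q4 * mf))) := by
  simp only [div_eq_mul_inv, mul_inv]
  ring

/-- The quotient form of `coeffFour`, wherever its denominators do not vanish. -/
theorem coeffFour_eq (a b : ℕ → ℂ) (k : ℕ)
    (hX : ∀ l ≤ k, poch (b 1 + b 3 + b 4 - a 3 - a 4 - a 5) l ≠ 0)
    (hY : ∀ l ≤ k, poch (b 2 + b 3 + b 4 - a 3 - a 4 - a 5) l ≠ 0)
    (hU : ∀ l ≤ k, poch (b 3 + b 4 - a 3 - a 5) l ≠ 0)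
    (hV : ∀ l ≤ k, poch (b 3 + b 4 - a 4 - a 5) l ≠ 0) :
    coeffFour a b k =
      poch (b 1 + b 3 + b 4 - a 3 - a 4 - a 5) k * poch (b 2 + b 3 + b 4 - a 3 - a 4 - a 5) k /
        (k ! : ℂ) *
        ∑ l ∈ range (k + 1),
          poch (b 3 + b 4 - a 3 - a 5) l * poch (b 3 + b 4 - a 4 - a 5) l * poch (-(k : ℂ)) l /
          (poch (b 1 + b 3 + b 4 - a 3 - a 4 - a 5) l *
            poch (b 2 + b 3 + b 4 - a 3 - a 4 - a 5) l * (l ! : ℂ)) *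
          ∑ m ∈ range (l + 1), poch (b 3 - a 5) m * poch (b 4 - a 5) m * poch (-(l : ℂ)) m /
            (poch (b 3 + b 4 - a 3 - a 5) m * poch (b 3 + b 4 - a 4 - a 5) m * (m ! : ℂ)) := by
  rw [coeffFour, mul_sum, mul_sum]
  refine sum_congr rfl fun l hl => ?_
  have hl' : l ≤ k := by simpa [Nat.lt_succ_iff] using hl
  have h1 := hX l hl'
  have h2 := hY l hl'
  rw [← poch_div hl' h1, ← poch_div hl' h2]
  simp only [mul_sum]
  refine sum_congr rfl fun m hm => ?_
  have hm' : m ≤ l := by simpa [Nat.lt_succ_iff] using hm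
  have h3 := hU m (hm'.trans hl')
  have h4 := hV m (hm'.trans hl')
  rw [← poch_div hm' h3, ← poch_div hm' h4]
  exact quot_aux ..

end ZeroBalanced

/-! Write `γ` for the Gamma factor. The `n`-th Taylor coefficient of `γ F` is `∏ Γ(a_j+n) / (∏
Γ(b_j+n) n!)`, and the core of the proof is its expansion in inverse factorials, `∑_k A_k Γ(a_1+n)
Γ(a_2+n) / (n! Γ(a_1+a_2+n+k))`, valid when `Re(a_j+n) > 0` for `j ≥ 3`. It is built one pair of
parameters at a time: the operator `raise` sends `A^{(p-1)}` to `A^{(p)}`, and Gauss's summation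
theorem evaluates the effect on the series (`hasSum_raise`, `hasSum_levelCoeff`). The coefficients
depend only on differences of parameters, so the same `A_k` serve every `n`. Without positivity
assumptions on the other parameters absolute convergence is not available directly; cancellation is
controlled by requiring all differences of the sequences to decay as those of a power (`SymbolUpTo`,
`isBigO_binConv`).

Consequently `γ F` is formally `∑_k A_k G_k`, where `G_k` is a Gauss function with parameters `a_1,
a_2; a_1+a_2+k`. Each `G_k` has an explicit expansion at `z = 1` with a logarithm
(`powSum_gaussCoeff_eq`). For `k = 0` the difference of the two sides solves, together with the case
`k = 1`, a first-order linear system singular at `z = 1` and tends to `0` there, hence vanishes;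
larger `k` follow by integration.

Interchanging the sums over `k` and over powers is legitimate for indices `n ≥ N` once `N` is so
large that `Re(a_j+N) > 0` for `j ≥ 3`. The finitely many remaining powers contribute, after the
logarithms are separated, a pointwise limit of polynomials of degree below `N`, which is again such
a polynomial; it only changes the first `N` logarithm-free coefficients (`exists_expansion`). This
is why `T_n` exists for every `n` but equals its series only under the convergence condition.

The bounds used so far give convergence for `|1-z| < 1/2`. The hypergeometric equation, rewritten
for the operators `w^i ϑ^i` with `w = 1 - z` and `ϑ = z d/dz`, is a recurrence for the coefficients
in powers of `w`; it forces radius of convergence `1` (`conv_one_of_recurrence`). The identity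
theorem then carries the equality to the whole cut disc, and the asymptotics come from splitting off
the term `n = 0`.

The alternative forms of `A^{(3)}` and `A^{(4)}` agree with the recursion by a commutation rule for
terminating sums (`flip_raise`). -/

namespace ZeroBalanced

/-! ### Pochhammer symbols and finite sums -/

theorem poch_succ_left (x : ℂ) (n : ℕ) : poch x (n + 1) = x * poch (x + 1) n := by
  rw [add_comm, poch_add]
  simp [poch]

theorem factorial_ne_zero' (n : ℕ) : (n ! : ℂ) ≠ 0 := by exact_mod_cast n.factorial_ne_zero

theorem sum_antidiagonal_assoc {M : Type*} [AddCommMonoid M] (f : ℕ → ℕ → ℕ → M) (n : ℕ) :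
    ∑ p ∈ antidiagonal n, ∑ q ∈ antidiagonal p.1, f q.1 q.2 p.2 =
      ∑ p ∈ antidiagonal n, ∑ q ∈ antidiagonal p.2, f p.1 q.1 q.2 := by
  rw [sum_sigma', sum_sigma']
  refine sum_bij' (fun x _ => ⟨(x.2.1, x.2.2 + x.1.2), (x.2.2, x.1.2)⟩)
    (fun x _ => ⟨(x.1.1 + x.2.1, x.2.2), (x.1.1, x.2.1)⟩) ?_ ?_ ?_ ?_ ?_
  · rintro ⟨⟨a, b⟩, ⟨c, d⟩⟩ h
    simp only [mem_sigma, HasAntidiagonal.mem_antidiagonal] at h ⊢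
    refine ⟨?_, trivial⟩
    show c + (d + b) = n
    omega
  · rintro ⟨⟨a, b⟩, ⟨c, d⟩⟩ h
    simp only [mem_sigma, HasAntidiagonal.mem_antidiagonal] at h ⊢
    refine ⟨?_, trivial⟩
    show a + c + d = n
    omega
  · rintro ⟨⟨a, b⟩, ⟨c, d⟩⟩ h
    simp only [mem_sigma, HasAntidiagonal.mem_antidiagonal] at h
    obtain ⟨h1, h2⟩ := h
    subst h2
    rfl
  · rintro ⟨⟨a, b⟩, ⟨c, d⟩⟩ h
    simp only [mem_sigma, HasAntidiagonal.mem_antidiagonal] at h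
    obtain ⟨h1, h2⟩ := h
    subst h2
    rfl
  · rintro ⟨⟨a, b⟩, ⟨c, d⟩⟩ h
    rfl

/-- Vandermonde's convolution for rising factorials. -/
theorem poch_vandermonde (x y : ℂ) (n : ℕ) :
    ∑ p ∈ antidiagonal n, poch x p.1 / (p.1 ! : ℂ) * (poch y p.2 / (p.2 ! : ℂ)) =
      poch (x + y) n / (n ! : ℂ) := by
  induction n with
  | zero => simp [poch_zero]
  | succ n ih =>
    have hs : ∀ (u : ℂ) (i : ℕ), ((i : ℂ) + 1) * (poch u (i + 1) / ((i + 1)! : ℂ)) =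
        (u + i) * (poch u i / (i ! : ℂ)) := by
      intro u i
      have h1 : (i : ℂ) + 1 ≠ 0 := by exact_mod_cast i.succ_ne_zero
      rw [poch_succ, Nat.factorial_succ]
      push_cast
      field_simp [factorial_ne_zero' i]
    -- On the antidiagonal `n + 1 = p.1 + p.2`; each half lowers one index by one, and the two
    -- factors `x + i` and `y + j` add up to `x + y + n`.
    have h1 : ((n : ℂ) + 1) * ∑ p ∈ antidiagonal (n + 1),
          poch x p.1 / (p.1 ! : ℂ) * (poch y p.2 / (p.2 ! : ℂ)) =
        ∑ p ∈ antidiagonal (n + 1),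
          (p.1 * (poch x p.1 / (p.1 ! : ℂ))) * (poch y p.2 / (p.2 ! : ℂ)) +
        ∑ p ∈ antidiagonal (n + 1),
          poch x p.1 / (p.1 ! : ℂ) * (p.2 * (poch y p.2 / (p.2 ! : ℂ))) := by
      rw [← sum_add_distrib, mul_sum]
      refine sum_congr rfl fun p hp => ?_
      have : ((n : ℂ) + 1) = p.1 + p.2 := by
        rw [HasAntidiagonal.mem_antidiagonal] at hp
        exact_mod_cast hp.symm
      rw [this]
      ring
    have hn : (n : ℂ) + 1 ≠ 0 := by exact_mod_cast n.succ_ne_zero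
    refine mul_left_cancel₀ hn ?_
    rw [h1, Nat.sum_antidiagonal_succ, Nat.sum_antidiagonal_succ' (f := fun p =>
      poch x p.1 / (p.1 ! : ℂ) * (p.2 * (poch y p.2 / (p.2 ! : ℂ)))), hs, ← ih]
    simp only [Nat.cast_zero, zero_mul, mul_zero, zero_add, Nat.cast_add, Nat.cast_one, hs]
    rw [← sum_add_distrib, mul_sum]
    refine sum_congr rfl fun p hp => ?_
    have : (n : ℂ) = p.1 + p.2 := by
      rw [HasAntidiagonal.mem_antidiagonal] at hp
      exact_mod_cast hp.symm
    rw [this]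
    ring

/-- The operator which builds the coefficients `A_k^{(p)}` from `A_k^{(p-1)}`. -/
noncomputable def raise (X β : ℂ) (A : ℕ → ℂ) (k : ℕ) : ℂ :=
  ∑ q ∈ antidiagonal k, poch (X + q.1) q.2 * poch β q.2 / (q.2 ! : ℂ) * A q.1

/-- The alternating operator `A ↦ (x)_n (y)_n / n! ∑_k (-n)_k / ((x)_k (y)_k) A_k`. -/
noncomputable def flip (x y : ℂ) (A : ℕ → ℂ) (n : ℕ) : ℂ :=
  ∑ q ∈ antidiagonal n,
    (-1) ^ q.1 * (poch (x + q.1) q.2 * poch (y + q.1) q.2 / (q.2 ! : ℂ)) * A q.1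

/-- The sequence `1, 0, 0, …`. -/
def unitSeq (k : ℕ) : ℂ := if k = 0 then 1 else 0

theorem sum_mul_unitSeq (f : ℕ → ℕ → ℂ) (n : ℕ) :
    ∑ q ∈ antidiagonal n, f q.1 q.2 * unitSeq q.1 = f 0 n := by
  cases n with
  | zero => simp [unitSeq]
  | succ n => simp [unitSeq, Nat.sum_antidiagonal_succ]

theorem raise_unitSeq (X β : ℂ) (k : ℕ) :
    raise X β unitSeq k = poch X k * poch β k / (k ! : ℂ) := by
  have := sum_mul_unitSeq (fun l m => poch (X + l) m * poch β m / (m ! : ℂ)) k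
  simpa [raise] using this

/-- On the unit sequence the two parameters are interchangeable, which leaves free which of them
plays the role of `X` in `flip_raise`. -/
theorem raise_unitSeq_comm (X β : ℂ) : raise X β unitSeq = raise β X unitSeq := by
  funext k
  rw [raise_unitSeq, raise_unitSeq, mul_comm (poch X k)]

theorem flip_unitSeq (x y : ℂ) : flip x y unitSeq = raise x y unitSeq := by
  funext n
  have := sum_mul_unitSeq
    (fun l m => (-1) ^ l * (poch (x + l) m * poch (y + l) m / (m ! : ℂ))) n
  rw [raise_unitSeq]
  simpa [flip] using this

theorem flip_comm (x y : ℂ) (A : ℕ → ℂ) : flip x y A = flip y x A := by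
  funext n
  simp only [flip, mul_comm (poch (x + _) _)]

/-- Reading `(x+i)_j` backwards gives `(-1)^j (1-x-n)_j` for `i + j = n`, so this is Vandermonde's
convolution with parameters `β` and `1-x-n`. -/
theorem poch_vandermonde_alt (x β : ℂ) (n : ℕ) :
    ∑ p ∈ antidiagonal n, (-1) ^ p.1 * (poch β p.1 / (p.1 ! : ℂ)) *
        (poch (x + p.1) p.2 / (p.2 ! : ℂ)) = poch (x - β) n / (n ! : ℂ) := by
  have h := poch_vandermonde β (1 - x - n) n
  have hr : ∀ (y : ℂ) (m : ℕ), poch (1 - y - m) m = (-1) ^ m * poch y m := by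
    intro y m
    have := poch_reflect y m 0
    have h3 : ((-1 : ℂ) ^ m) * (-1) ^ m = 1 := by rw [← mul_pow]; simp
    simp only [add_zero, poch_zero, mul_one] at this
    rw [this, ← mul_assoc, h3, one_mul]
  have e : β + (1 - x - n) = 1 - (x - β) - n := by ring
  rw [e, hr] at h
  have h3 : ∀ m : ℕ, ((-1 : ℂ) ^ m) * (-1) ^ m = 1 := fun m => by rw [← mul_pow]; simp
  have : poch (x - β) n / (n ! : ℂ) = (-1) ^ n * ((-1) ^ n * poch (x - β) n / (n ! : ℂ)) := by
    linear_combination (-(poch (x - β) n / (n ! : ℂ))) * h3 n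
  rw [this, ← h, mul_sum]
  refine sum_congr rfl fun p hp => ?_
  rw [HasAntidiagonal.mem_antidiagonal] at hp
  have e2 : (1 - x - n : ℂ) = 1 - (x + p.1) - p.2 := by
    rw [← hp]; push_cast; ring
  rw [e2, hr, ← hp, pow_add]
  linear_combination (-((-1) ^ p.1 * (poch β p.1 / (p.1 ! : ℂ)) *
        (poch (x + p.1) p.2 / (p.2 ! : ℂ)))) * h3 p.2

/-- A terminating transformation of Sheppard type. -/
theorem sheppard (X β x y : ℂ) (N : ℕ) :
    ∑ q ∈ antidiagonal N, (-1) ^ q.1 * (poch X q.1 * poch β q.1 / (q.1 ! : ℂ)) *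
        (poch (x + q.1) q.2 * poch (y + q.1) q.2 / (q.2 ! : ℂ)) =
      ∑ q ∈ antidiagonal N, poch (x + q.1) q.2 * poch (y - X) q.2 / (q.2 ! : ℂ) *
        (poch X q.1 * poch (x - β) q.1 / (q.1 ! : ℂ)) := by
  -- Vandermonde for `y + l = (X + l) + (y - X)` splits the second factor; after regrouping the
  -- triple sum, the inner sum is the alternating Vandermonde sum.
  have h1 : ∀ q ∈ antidiagonal N, (-1) ^ q.1 * (poch X q.1 * poch β q.1 / (q.1 ! : ℂ)) *
        (poch (x + q.1) q.2 * poch (y + q.1) q.2 / (q.2 ! : ℂ)) =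
      ∑ r ∈ antidiagonal q.2, (-1) ^ q.1 * (poch β q.1 / (q.1 ! : ℂ)) *
        (poch (x + q.1) r.1 / (r.1 ! : ℂ)) * (poch X (q.1 + r.1) *
          poch (x + (q.1 + r.1 : ℕ)) r.2 * (poch (y - X) r.2 / (r.2 ! : ℂ))) := by
    intro q _
    have e : y + q.1 = (X + q.1) + (y - X) := by ring
    have := poch_vandermonde (X + q.1) (y - X) q.2
    rw [e, show (-1) ^ q.1 * (poch X q.1 * poch β q.1 / (q.1 ! : ℂ)) *
        (poch (x + q.1) q.2 * poch ((X + q.1) + (y - X)) q.2 / (q.2 ! : ℂ)) =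
        ((-1) ^ q.1 * (poch X q.1 * poch β q.1 / (q.1 ! : ℂ)) *
        (poch (x + q.1) q.2)) * (poch ((X + q.1) + (y - X)) q.2 / (q.2 ! : ℂ)) by ring,
      ← this, mul_sum]
    refine sum_congr rfl fun r hr => ?_
    rw [HasAntidiagonal.mem_antidiagonal] at hr
    rw [← hr, poch_add, poch_add]
    push_cast
    rw [add_assoc]
    ring
  rw [sum_congr rfl h1, ← sum_antidiagonal_assoc (fun l i m =>
    (-1) ^ l * (poch β l / (l ! : ℂ)) *
        (poch (x + l) i / (i ! : ℂ)) * (poch X (l + i) *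
          poch (x + (l + i : ℕ)) m * (poch (y - X) m / (m ! : ℂ))))]
  refine sum_congr rfl fun p _ => ?_
  have h2 : ∀ q ∈ antidiagonal p.1, (-1) ^ q.1 * (poch β q.1 / (q.1 ! : ℂ)) *
        (poch (x + q.1) q.2 / (q.2 ! : ℂ)) * (poch X (q.1 + q.2) *
          poch (x + (q.1 + q.2 : ℕ)) p.2 * (poch (y - X) p.2 / (p.2 ! : ℂ))) =
      ((-1) ^ q.1 * (poch β q.1 / (q.1 ! : ℂ)) *
        (poch (x + q.1) q.2 / (q.2 ! : ℂ))) * (poch X p.1 *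
          poch (x + p.1) p.2 * (poch (y - X) p.2 / (p.2 ! : ℂ))) := by
    intro q hq
    rw [HasAntidiagonal.mem_antidiagonal] at hq
    rw [hq]
  rw [sum_congr rfl h2, ← sum_mul, poch_vandermonde_alt]
  ring

/-- The coefficients of each `A l` on the two sides agree by `sheppard` with `X`, `x`, `y` all
shifted by `l`. Moving `flip` past `raise` in this way converts the alternating sums of the special
forms into the nested sums of the recursion. -/
theorem flip_raise (x y X β : ℂ) (A : ℕ → ℂ) :
    flip x y (raise X β A) = raise x (y - X) (flip X (x - β) A) := by
  funext n
  have h1 : flip x y (raise X β A) n = ∑ p ∈ antidiagonal n, ∑ q ∈ antidiagonal p.1,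
      (-1) ^ (q.1 + q.2) * (poch (x + (q.1 + q.2 : ℕ)) p.2 * poch (y + (q.1 + q.2 : ℕ)) p.2 /
        (p.2 ! : ℂ)) * (poch (X + q.1) q.2 * poch β q.2 / (q.2 ! : ℂ) * A q.1) := by
    refine sum_congr rfl fun p _ => ?_
    rw [raise, mul_sum]
    refine sum_congr rfl fun q hq => ?_
    rw [HasAntidiagonal.mem_antidiagonal] at hq
    rw [hq]
  have h2 : raise x (y - X) (flip X (x - β) A) n = ∑ p ∈ antidiagonal n, ∑ q ∈ antidiagonal p.1,
      poch (x + (q.1 + q.2 : ℕ)) p.2 * poch (y - X) p.2 / (p.2 ! : ℂ) * ((-1) ^ q.1 *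
        (poch (X + q.1) q.2 * poch (x - β + q.1) q.2 / (q.2 ! : ℂ)) * A q.1) := by
    refine sum_congr rfl fun p _ => ?_
    rw [flip, mul_sum]
    refine sum_congr rfl fun q hq => ?_
    rw [HasAntidiagonal.mem_antidiagonal] at hq
    rw [hq]
  rw [h1, h2, sum_antidiagonal_assoc (fun l i m =>
    (-1) ^ (l + i) * (poch (x + (l + i : ℕ)) m * poch (y + (l + i : ℕ)) m /
        (m ! : ℂ)) * (poch (X + l) i * poch β i / (i ! : ℂ) * A l)),
    sum_antidiagonal_assoc (fun l i m => poch (x + (l + i : ℕ)) m * poch (y - X) m / (m ! : ℂ) *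
      ((-1) ^ l * (poch (X + l) i * poch (x - β + l) i / (i ! : ℂ)) * A l))]
  refine sum_congr rfl fun p _ => ?_
  have h := sheppard (X + p.1) β (x + p.1) (y + p.1) p.2
  have h3 := congrArg (fun t => (-1) ^ p.1 * A p.1 * t) h
  simp only [mul_sum] at h3
  convert h3 using 1
  · refine sum_congr rfl fun q _ => ?_
    push_cast
    rw [pow_add, add_assoc, add_assoc]
    ring
  · refine sum_congr rfl fun q _ => ?_
    push_cast
    rw [show y + p.1 - (X + p.1) = y - X by ring, show x - β + (p.1 : ℂ) = x + p.1 - β by ring,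
      add_assoc]
    ring

theorem raise_eq_sum_range (X β : ℂ) (A : ℕ → ℂ) (k : ℕ) :
    raise X β A k = ∑ l ∈ range (k + 1),
      poch (X + l) (k - l) * poch β (k - l) / ((k - l)! : ℂ) * A l :=
  Nat.sum_antidiagonal_eq_sum_range_succ
    (fun l m => poch (X + l) m * poch β m / (m ! : ℂ) * A l) k

theorem poch_neg_div {k l : ℕ} (h : l ≤ k) :
    poch (-(k : ℂ)) l / (k ! : ℂ) = (-1) ^ l / ((k - l)! : ℂ) := by
  obtain ⟨m, rfl⟩ := Nat.exists_eq_add_of_le h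
  rw [Nat.add_sub_cancel_left, div_eq_div_iff (factorial_ne_zero' _) (factorial_ne_zero' _)]
  exact poch_neg l m

theorem flip_eq_sum_range (x y : ℂ) (A : ℕ → ℂ) (k : ℕ) :
    flip x y A k = 1 / (k ! : ℂ) * ∑ l ∈ range (k + 1),
      poch (x + l) (k - l) * poch (y + l) (k - l) * (poch (-(k : ℂ)) l * A l) := by
  have := Nat.sum_antidiagonal_eq_sum_range_succ
    (fun l m => (-1) ^ l * (poch (x + l) m * poch (y + l) m / (m ! : ℂ)) * A l) k
  rw [flip, this, mul_sum]
  refine sum_congr rfl fun l hl => ?_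
  have h := poch_neg_div (Nat.lt_succ_iff.1 (mem_range.1 hl))
  calc _ = (-1) ^ l / ((k - l)! : ℂ) * (poch (x + l) (k - l) * poch (y + l) (k - l) * A l) := by
        ring
    _ = _ := by rw [← h]; ring

/-- The coefficients of level `q + 1`, starting with the unit sequence. -/
noncomputable def levelCoeff : ℕ → (ℕ → ℂ) → (ℕ → ℂ) → ℕ → ℂ
  | 0, _, _ => unitSeq
  | q + 1, a, b => raise (excess (q + 2) a b) (b 1 - a 3)
      (levelCoeff q (fun j => a (j + 1)) (fun j => b (j + 1)))

theorem coeff_eq_levelCoeff (q : ℕ) (a b : ℕ → ℂ) : coeff (q + 2) a b = levelCoeff (q + 1) a b := by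
  induction q generalizing a b with
  | zero =>
    funext k
    rw [levelCoeff, levelCoeff, raise_unitSeq, coeff]
    simp [excess]
  | succ q ih =>
    funext k
    rw [levelCoeff, coeff, ← ih, raise_eq_sum_range]

/-! ### The alternative forms of the coefficients for `p = 3` and `p = 4`. -/

theorem coeffThree_eq_flip (a b : ℕ → ℂ) : coeffThree a b =
    flip (b 1 + b 3 - a 3 - a 4) (b 2 + b 3 - a 3 - a 4)
      (raise (b 3 - a 3) (b 3 - a 4) unitSeq) := by
  funext k
  rw [coeffThree, flip_eq_sum_range]
  simp only [raise_unitSeq]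
  congr 1
  refine sum_congr rfl fun l _ => ?_
  ring

theorem coeffFour_eq_flip (a b : ℕ → ℂ) : coeffFour a b =
    flip (b 1 + b 3 + b 4 - a 3 - a 4 - a 5) (b 2 + b 3 + b 4 - a 3 - a 4 - a 5)
      (flip (b 3 + b 4 - a 3 - a 5) (b 3 + b 4 - a 4 - a 5)
        (raise (b 3 - a 5) (b 4 - a 5) unitSeq)) := by
  funext k
  rw [coeffFour, flip_eq_sum_range]
  congr 1
  refine sum_congr rfl fun l _ => ?_
  rw [flip_eq_sum_range, mul_assoc, mul_assoc, mul_assoc]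
  congr 2
  rw [div_mul_eq_mul_div, mul_div_assoc, div_eq_inv_mul, one_div]
  congr 2
  refine sum_congr rfl fun m _ => ?_
  rw [raise_unitSeq]
  ring

/-- One application of `flip_raise` pushes the `flip` onto the unit sequence, where it is itself a
`raise`; the parameters left over are those of the recursion. -/
theorem coeffThree_eq_coeff (a b : ℕ → ℂ) : coeffThree a b = coeff 3 a b := by
  rw [coeff_eq_levelCoeff, coeffThree_eq_flip, raise_unitSeq_comm, flip_comm, flip_raise,
    flip_unitSeq, levelCoeff, levelCoeff, levelCoeff]
  have e1 : excess (1 + 2) a b = b 2 + b 3 - a 3 - a 4 := by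
    simp [excess, sum_Icc_succ_top]; ring
  have e2 : excess (0 + 2) (fun j => a (j + 1)) (fun j => b (j + 1)) = b 3 - a 4 := by
    simp [excess]
  rw [e1, e2]
  ring_nf

/-- Two nested `flip`s are pushed inward until they reach the unit sequence: the inner one passes
one `raise`, the outer one passes two. -/
theorem coeffFour_eq_coeff (a b : ℕ → ℂ) : coeffFour a b = coeff 4 a b := by
  rw [coeff_eq_levelCoeff, coeffFour_eq_flip, raise_unitSeq_comm,
    flip_comm (b 3 + b 4 - a 3 - a 5), flip_raise (b 3 + b 4 - a 4 - a 5), flip_unitSeq, flip_comm,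
    flip_raise, show b 3 + b 4 - a 4 - a 5 - (b 3 - a 5) = b 4 - a 4 by ring, flip_raise,
    flip_unitSeq, levelCoeff, levelCoeff, levelCoeff, levelCoeff]
  have e1 : excess (2 + 2) a b = b 2 + b 3 + b 4 - a 3 - a 4 - a 5 := by
    simp [excess, sum_Icc_succ_top]; ring
  have e2 : excess (1 + 2) (fun j => a (j + 1)) (fun j => b (j + 1)) =
      b 3 + b 4 - a 4 - a 5 := by
    simp [excess, sum_Icc_succ_top]; ring
  have e3 : excess (0 + 2) (fun j => a (j + 1 + 1)) (fun j => b (j + 1 + 1)) = b 4 - a 5 := by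
    simp [excess]
  rw [e1, e2, e3]
  ring_nf

/-! ### Growth of Gamma quotients -/

theorem tendsto_natCast_add_div (u : ℂ) :
    Tendsto (fun l : ℕ => (l : ℂ) / (u + l)) atTop (𝓝 1) := by
  have h : Tendsto (fun l : ℕ => (1 : ℂ) / (u * (l : ℂ)⁻¹ + 1)) atTop (𝓝 (1 / (u * 0 + 1))) := by
    refine Tendsto.div tendsto_const_nhds ?_ (by simp)
    exact (tendsto_const_nhds.mul tendsto_inv_atTop_nhds_zero_nat).add tendsto_const_nhds
  simp only [mul_zero, zero_add, div_one] at h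
  refine h.congr' ?_
  filter_upwards [eventually_ne_atTop 0] with l hl
  have : (l : ℂ) ≠ 0 := by exact_mod_cast hl
  field_simp

theorem eventually_add_ne_zero (u : ℂ) : ∀ᶠ l : ℕ in atTop, u + l ≠ 0 := by
  obtain ⟨m, hm⟩ := exists_nat_gt ‖u‖
  filter_upwards [eventually_ge_atTop m] with l hl h
  have h1 : u = -(l : ℂ) := by linear_combination h
  rw [h1, norm_neg, Complex.norm_natCast] at hm
  exact absurd hl (not_le.2 (by exact_mod_cast hm))

theorem eventually_not_pole (u : ℂ) : ∀ᶠ l : ℕ in atTop, ∀ m : ℕ, u + l ≠ -(m : ℂ) := by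
  obtain ⟨n, hn⟩ := exists_nat_gt ‖u‖
  filter_upwards [eventually_ge_atTop n] with l hl m h
  have h1 : u = -((l + m : ℕ) : ℂ) := by push_cast; linear_combination h
  rw [h1, norm_neg, Complex.norm_natCast] at hn
  have : l + m < n := by exact_mod_cast hn
  omega

/-- For `Re u > 1` this is Euler's limit formula at `u - 1`. The functional equation carries it from
`u + 1` to `u`, hence to all `u`; finitely many indices at poles do not matter. -/
theorem tendsto_Gamma_div (u : ℂ) :
    Tendsto (fun l : ℕ => Complex.Gamma (u + l) / ((l ! : ℂ) * (l : ℂ) ^ (u - 1))) atTop (𝓝 1) := by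
  have base : ∀ v : ℂ, 0 < v.re → Tendsto
      (fun l : ℕ => Complex.Gamma (v + 1 + l) / ((l ! : ℂ) * (l : ℂ) ^ (v + 1 - 1))) atTop (𝓝 1) := by
    intro v hv
    have hG := Complex.Gamma_ne_zero_of_re_pos hv
    have h := (Complex.GammaSeq_tendsto_Gamma v).inv₀ hG |>.mul_const (Complex.Gamma v)
    rw [inv_mul_cancel₀ hG] at h
    refine h.congr fun l => ?_
    have hp : ∀ k : ℕ, v ≠ -(k : ℂ) := by
      intro k hk
      rw [hk] at hv
      simp at hv
      linarith [(Nat.cast_nonneg k : (0 : ℝ) ≤ k)]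
    have h1 : ∀ n : ℕ, (∏ j ∈ range n, (v + j)) * Complex.Gamma v = Complex.Gamma (v + n) := by
      intro n
      induction n with
      | zero => simp
      | succ n ih =>
        have : v + n ≠ 0 := fun h => hp n (by linear_combination h)
        rw [prod_range_succ, mul_right_comm, ih]
        push_cast
        rw [← add_assoc, Complex.Gamma_add_one _ this, mul_comm]
    have h2 := h1 (l + 1)
    push_cast at h2
    rw [Complex.GammaSeq, show v + 1 + (l : ℂ) = v + (l + 1) by ring, ← h2, add_sub_cancel_right,
      inv_div]
    ring
  have step : ∀ (n : ℕ) (v : ℂ), 1 < v.re + n → Tendsto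
      (fun l : ℕ => Complex.Gamma (v + l) / ((l ! : ℂ) * (l : ℂ) ^ (v - 1))) atTop (𝓝 1) := by
    intro n
    induction n with
    | zero =>
      intro v hv
      have := base (v - 1) (by simp at hv ⊢; linarith)
      simpa using this
    | succ n ih =>
      intro v hv
      have h := (ih (v + 1) (by push_cast at hv; simp; linarith)).mul (tendsto_natCast_add_div v)
      rw [mul_one] at h
      refine h.congr' ?_
      filter_upwards [eventually_add_ne_zero v, eventually_ne_atTop 0] with l hl hl0
      have hl' : (l : ℂ) ≠ 0 := by exact_mod_cast hl0
      rw [show v + 1 + (l : ℂ) = v + l + 1 by ring, Complex.Gamma_add_one _ hl,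
        show v + 1 - 1 = (v - 1) + 1 by ring, Complex.cpow_add _ _ hl', Complex.cpow_one]
      have h3 := factorial_ne_zero' l
      have h4 : (l : ℂ) ^ (v - 1) ≠ 0 := by simp [Complex.cpow_eq_zero_iff, hl']
      field_simp
  obtain ⟨n, hn⟩ := exists_nat_gt (1 - u.re)
  exact step n u (by linarith)

theorem isTheta_Gamma (u : ℂ) :
    (fun l : ℕ => Complex.Gamma (u + l)) =Θ[atTop] fun l : ℕ => (l ! : ℝ) * (l : ℝ) ^ (u.re - 1) := by
  have h1 : (fun l : ℕ => Complex.Gamma (u + l)) =Θ[atTop]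
      fun l : ℕ => (l ! : ℂ) * (l : ℂ) ^ (u - 1) := by
    refine IsEquivalent.isTheta ?_
    refine (isEquivalent_iff_tendsto_one ?_).2 (tendsto_Gamma_div u)
    filter_upwards [eventually_ne_atTop 0] with l hl
    have hl' : (l : ℂ) ≠ 0 := by exact_mod_cast hl
    simp [Complex.cpow_eq_zero_iff, hl', Nat.factorial_ne_zero]
  refine h1.trans ?_
  rw [← isTheta_norm_left, ← isTheta_norm_right]
  refine EventuallyEq.isTheta ?_
  filter_upwards [eventually_gt_atTop 0] with l hl
  rw [norm_mul, norm_mul, Complex.norm_natCast, Complex.norm_natCast_cpow_of_pos hl,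
    Real.norm_of_nonneg (Nat.cast_nonneg _), Real.norm_of_nonneg (by positivity)]
  simp

theorem isTheta_Gamma_div (u v : ℂ) :
    (fun l : ℕ => Complex.Gamma (u + l) / Complex.Gamma (v + l)) =Θ[atTop]
      fun l : ℕ => (l : ℝ) ^ (u - v).re := by
  refine ((isTheta_Gamma u).div (isTheta_Gamma v)).trans (EventuallyEq.isTheta ?_)
  filter_upwards [eventually_gt_atTop 0] with l hl
  have hl' : (0 : ℝ) < l := by exact_mod_cast hl
  have : (l ! : ℝ) ≠ 0 := by exact_mod_cast l.factorial_ne_zero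
  rw [mul_div_mul_left _ _ this, ← Real.rpow_sub hl']
  simp

theorem poch_eq_Gamma {x : ℂ} (hx : ∀ m : ℕ, x ≠ -(m : ℂ)) (n : ℕ) :
    poch x n = Complex.Gamma (x + n) / Complex.Gamma x :=
  (Complex.Gamma_add_nat_div_Gamma_eq x hx).symm

theorem poch_ne_zero {x : ℂ} (hx : ∀ m : ℕ, x ≠ -(m : ℂ)) (n : ℕ) : poch x n ≠ 0 := by
  rw [poch_eq_Gamma hx]
  refine div_ne_zero (Complex.Gamma_ne_zero fun m h => hx (n + m) ?_) (Complex.Gamma_ne_zero hx)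
  push_cast
  linear_combination h

theorem Gamma_mul_poch {x : ℂ} (hx : ∀ m : ℕ, x ≠ -(m : ℂ)) (n : ℕ) :
    Complex.Gamma x * poch x n = Complex.Gamma (x + n) := by
  rw [poch_eq_Gamma hx, mul_div_cancel₀ _ (Complex.Gamma_ne_zero hx)]

theorem inv_Gamma (s : ℂ) : (Complex.Gamma s)⁻¹ = s * (Complex.Gamma (s + 1))⁻¹ :=
  Complex.one_div_Gamma_eq_self_mul_one_div_Gamma_add_one s

/-- The reciprocal Gamma function is entire, with value `0` at the poles by the convention for
inverses, so no exceptional `s` occur. Dividing by Gamma values throughout avoids hypotheses on sums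
of parameters such as `a_1 + a_2`. -/
theorem inv_Gamma_eq_poch_mul (s : ℂ) (n : ℕ) :
    (Complex.Gamma s)⁻¹ = poch s n * (Complex.Gamma (s + n))⁻¹ := by
  induction n with
  | zero => simp [poch_zero]
  | succ n ih =>
    rw [ih, poch_succ, inv_Gamma (s + n)]
    push_cast
    rw [add_assoc, mul_assoc]

theorem isTheta_poch {x : ℂ} (hx : ∀ m : ℕ, x ≠ -(m : ℂ)) :
    (fun l : ℕ => poch x l) =Θ[atTop] fun l : ℕ => (l ! : ℝ) * (l : ℝ) ^ (x.re - 1) := by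
  simp only [poch_eq_Gamma hx, div_eq_inv_mul]
  exact (isTheta_const_mul_left (inv_ne_zero (Complex.Gamma_ne_zero hx))).2 (isTheta_Gamma x)

/-- Only an upper bound, unlike `isTheta_poch`: at a nonpositive integer `x` the symbol is
eventually `0`. -/
theorem isBigO_poch (x : ℂ) :
    (fun l : ℕ => poch x l) =O[atTop] fun l : ℕ => (l ! : ℝ) * (l : ℝ) ^ (x.re - 1) := by
  by_cases hx : ∀ m : ℕ, x ≠ -(m : ℂ)
  · exact (isTheta_poch hx).1
  · push Not at hx
    obtain ⟨m, rfl⟩ := hx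
    have : (fun l : ℕ => poch (-(m : ℂ)) l) =ᶠ[atTop] fun _ => (0 : ℂ) := by
      filter_upwards [eventually_gt_atTop m] with l hl
      obtain ⟨k, rfl⟩ := Nat.exists_eq_add_of_lt hl
      rw [show m + k + 1 = m + 1 + k by ring, poch_add, poch_succ]
      simp
    exact this.trans_isBigO (isBigO_zero _ _)

/-! ### Polynomial bounds of sequences -/

theorem natCast_add_one_rpow_le (θ : ℝ) {k : ℕ} (hk : 0 < k) :
    ((k : ℝ) + 1) ^ θ ≤ 2 ^ |θ| * (k : ℝ) ^ θ := by
  have hk' : (1 : ℝ) ≤ k := by exact_mod_cast hk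
  rcases le_total 0 θ with h | h
  · rw [abs_of_nonneg h, ← Real.mul_rpow (by norm_num) (by linarith)]
    exact Real.rpow_le_rpow (by linarith) (by linarith) h
  · calc ((k : ℝ) + 1) ^ θ ≤ (k : ℝ) ^ θ :=
        Real.rpow_le_rpow_of_nonpos (by linarith) (by linarith) h
      _ ≤ 2 ^ |θ| * (k : ℝ) ^ θ := by
        refine le_mul_of_one_le_left (by positivity) ?_
        exact Real.one_le_rpow (by norm_num) (abs_nonneg θ)

theorem natCast_rpow_le (θ : ℝ) {k : ℕ} (hk : 0 < k) :
    (k : ℝ) ^ θ ≤ 2 ^ |θ| * ((k : ℝ) + 1) ^ θ := by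
  have hk' : (1 : ℝ) ≤ k := by exact_mod_cast hk
  rcases le_total θ 0 with h | h
  · have h2 : ((k : ℝ) + 1) / 2 ≤ k := by linarith
    calc (k : ℝ) ^ θ ≤ (((k : ℝ) + 1) / 2) ^ θ :=
          Real.rpow_le_rpow_of_nonpos (by linarith) h2 h
      _ = 2 ^ |θ| * ((k : ℝ) + 1) ^ θ := by
          rw [Real.div_rpow (by linarith) (by norm_num), abs_of_nonpos h,
            Real.rpow_neg (by norm_num)]
          field_simp
  · calc (k : ℝ) ^ θ ≤ ((k : ℝ) + 1) ^ θ := Real.rpow_le_rpow (by linarith) (by linarith) h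
      _ ≤ 2 ^ |θ| * ((k : ℝ) + 1) ^ θ := by
        refine le_mul_of_one_le_left (by positivity) ?_
        exact Real.one_le_rpow (by norm_num) (abs_nonneg θ)

theorem isTheta_succ_rpow (θ : ℝ) :
    (fun k : ℕ => ((k : ℝ) + 1) ^ θ) =Θ[atTop] fun k : ℕ => (k : ℝ) ^ θ := by
  constructor
  · refine IsBigO.of_bound (2 ^ |θ|) ?_
    filter_upwards [eventually_gt_atTop 0] with k hk
    rw [Real.norm_of_nonneg (by positivity), Real.norm_of_nonneg (by positivity)]
    exact natCast_add_one_rpow_le θ hk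
  · refine IsBigO.of_bound (2 ^ |θ|) ?_
    filter_upwards [eventually_gt_atTop 0] with k hk
    rw [Real.norm_of_nonneg (by positivity), Real.norm_of_nonneg (by positivity)]
    exact natCast_rpow_le θ hk

/-- With `k + 1` in place of `k` the comparison sequence never vanishes, so the asymptotic bound
holds at all indices after enlarging the constant. -/
theorem isBigO_rpow_iff {E : Type*} [NormedAddCommGroup E] {f : ℕ → E} {θ : ℝ} :
    f =O[atTop] (fun k : ℕ => (k : ℝ) ^ θ) ↔ ∃ C : ℝ, 0 ≤ C ∧ ∀ k, ‖f k‖ ≤ C * ((k : ℝ) + 1) ^ θ := by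
  rw [← (isTheta_succ_rpow θ).isBigO_congr_right, isBigO_nat_atTop_iff]
  · constructor
    · rintro ⟨C, hC⟩
      refine ⟨|C|, abs_nonneg C, fun k => (hC k).trans ?_⟩
      rw [Real.norm_of_nonneg (by positivity)]
      gcongr
      exact le_abs_self C
    · rintro ⟨C, -, hC⟩
      refine ⟨C, fun k => (hC k).trans_eq ?_⟩
      rw [Real.norm_of_nonneg (by positivity)]
  · intro k hk
    have : (0 : ℝ) < ((k : ℝ) + 1) ^ θ := by positivity
    exact absurd hk this.ne'

theorem IsBigO.rpow_shift {E : Type*} [NormedAddCommGroup E] {f : ℕ → E} {θ : ℝ}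
    (h : f =O[atTop] fun k : ℕ => (k : ℝ) ^ θ) :
    (fun k => f (k + 1)) =O[atTop] fun k : ℕ => (k : ℝ) ^ θ := by
  have h1 := h.comp_tendsto (tendsto_add_atTop_nat 1)
  refine h1.trans ?_
  simpa [Function.comp_def] using (isTheta_succ_rpow θ).1

theorem IsBigO.rpow_unshift {E : Type*} [NormedAddCommGroup E] {f : ℕ → E} {θ : ℝ}
    (h : (fun k => f (k + 1)) =O[atTop] fun k : ℕ => (k : ℝ) ^ θ) :
    f =O[atTop] fun k : ℕ => (k : ℝ) ^ θ := by
  obtain ⟨C, -, hC⟩ := isBigO_rpow_iff.1 h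
  refine IsBigO.of_bound C ?_
  filter_upwards [eventually_gt_atTop 0] with k hk
  obtain ⟨l, rfl⟩ := Nat.exists_eq_succ_of_ne_zero hk.ne'
  rw [Real.norm_of_nonneg (by positivity)]
  have := hC l
  push_cast
  exact this

theorem rpow_isBigO_of_le {θ θ' : ℝ} (h : θ ≤ θ') :
    (fun k : ℕ => (k : ℝ) ^ θ) =O[atTop] fun k : ℕ => (k : ℝ) ^ θ' := by
  refine IsBigO.of_bound 1 ?_
  filter_upwards [eventually_gt_atTop 0] with k hk
  rw [Real.norm_of_nonneg (by positivity), Real.norm_of_nonneg (by positivity), one_mul]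
  exact Real.rpow_le_rpow_of_exponent_le (by exact_mod_cast hk) h

theorem IsBigO.rpow_mul {f g : ℕ → ℂ} {θ θ' : ℝ} (hf : f =O[atTop] fun k : ℕ => (k : ℝ) ^ θ)
    (hg : g =O[atTop] fun k : ℕ => (k : ℝ) ^ θ') :
    (fun k => f k * g k) =O[atTop] fun k : ℕ => (k : ℝ) ^ (θ + θ') := by
  refine (hf.mul hg).trans (EventuallyEq.isBigO ?_)
  filter_upwards [eventually_gt_atTop 0] with k hk
  rw [Real.rpow_add (by exact_mod_cast hk)]

theorem summable_of_isBigO_rpow {E : Type*} [NormedAddCommGroup E] {f : ℕ → E}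
    {θ : ℝ} (hθ : θ < -1) (h : f =O[atTop] fun k : ℕ => (k : ℝ) ^ θ) : Summable fun k => ‖f k‖ :=
  summable_of_isBigO_nat (Real.summable_nat_rpow.2 hθ) h.norm_left

/-! ### Symbol classes -/

/-- `f` and its differences of order at most `N` decay like those of `k ^ θ`. -/
def SymbolUpTo : ℕ → ℝ → (ℕ → ℂ) → Prop
  | 0, θ, f => f =O[atTop] fun k : ℕ => (k : ℝ) ^ θ
  | N + 1, θ, f => (f =O[atTop] fun k : ℕ => (k : ℝ) ^ θ) ∧
      SymbolUpTo N (θ - 1) fun k => f (k + 1) - f k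

theorem SymbolUpTo.isBigO {N : ℕ} {θ : ℝ} {f : ℕ → ℂ} (h : SymbolUpTo N θ f) :
    f =O[atTop] fun k : ℕ => (k : ℝ) ^ θ := by
  cases N with
  | zero => exact h
  | succ N => exact h.1

theorem SymbolUpTo.of_succ {N : ℕ} {θ : ℝ} {f : ℕ → ℂ} (h : SymbolUpTo (N + 1) θ f) :
    SymbolUpTo N θ f := by
  induction N generalizing θ f with
  | zero => exact h.1
  | succ N ih => exact ⟨h.1, ih h.2⟩

theorem SymbolUpTo.shift {N : ℕ} {θ : ℝ} {f : ℕ → ℂ} (h : SymbolUpTo N θ f) :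
    SymbolUpTo N θ fun k => f (k + 1) := by
  induction N generalizing θ f with
  | zero => exact IsBigO.rpow_shift h
  | succ N ih => exact ⟨IsBigO.rpow_shift h.1, ih h.2⟩

theorem SymbolUpTo.congr {N : ℕ} {θ : ℝ} {f g : ℕ → ℂ} (h : SymbolUpTo N θ f)
    (hfg : f =ᶠ[atTop] g) : SymbolUpTo N θ g := by
  induction N generalizing θ f g with
  | zero => exact hfg.symm.trans_isBigO h
  | succ N ih =>
    refine ⟨hfg.symm.trans_isBigO h.1, ih h.2 ?_⟩
    filter_upwards [hfg, (tendsto_add_atTop_nat 1).eventually hfg] with k h1 h2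
    rw [h1, h2]

theorem SymbolUpTo.add {N : ℕ} {θ : ℝ} {f g : ℕ → ℂ} (hf : SymbolUpTo N θ f)
    (hg : SymbolUpTo N θ g) : SymbolUpTo N θ fun k => f k + g k := by
  induction N generalizing θ f g with
  | zero => exact IsBigO.add hf hg
  | succ N ih =>
    refine ⟨hf.1.add hg.1, ?_⟩
    have := ih hf.2 hg.2
    convert this using 2
    ring

/-- Discrete Leibniz rule: `Δ(fg)(k) = Δf(k) g(k+1) + f(k) Δg(k)`. -/
theorem SymbolUpTo.mul {N : ℕ} {θ θ' : ℝ} {f g : ℕ → ℂ} (hf : SymbolUpTo N θ f)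
    (hg : SymbolUpTo N θ' g) : SymbolUpTo N (θ + θ') fun k => f k * g k := by
  induction N generalizing θ θ' f g with
  | zero => exact IsBigO.rpow_mul hf hg
  | succ N ih =>
    refine ⟨IsBigO.rpow_mul hf.1 hg.1, ?_⟩
    have h1 := ih hf.2 hg.of_succ.shift
    have h2 := ih hf.of_succ hg.2
    rw [show θ - 1 + θ' = θ + θ' - 1 by ring] at h1
    rw [show θ + (θ' - 1) = θ + θ' - 1 by ring] at h2
    convert h1.add h2 using 2
    ring

theorem symbolUpTo_zero (N : ℕ) (θ : ℝ) : SymbolUpTo N θ fun _ => 0 := by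
  induction N generalizing θ with
  | zero => exact isBigO_zero _ _
  | succ N ih =>
    refine ⟨isBigO_zero _ _, ?_⟩
    simpa using ih (θ - 1)

theorem symbolUpTo_const (N : ℕ) (c : ℂ) : SymbolUpTo N 0 fun _ => c := by
  cases N with
  | zero => simpa [SymbolUpTo] using isBigO_const_const c (one_ne_zero (α := ℝ)) atTop
  | succ N =>
    refine ⟨by simpa using isBigO_const_const c (one_ne_zero (α := ℝ)) atTop, ?_⟩
    simpa using symbolUpTo_zero N (0 - 1)

theorem SymbolUpTo.const_mul {N : ℕ} {θ : ℝ} {f : ℕ → ℂ} (hf : SymbolUpTo N θ f) (c : ℂ) :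
    SymbolUpTo N θ fun k => c * f k := by
  simpa using (symbolUpTo_const N c).mul hf

theorem symbolUpTo_natCast (N : ℕ) : SymbolUpTo N 1 fun k => (k : ℂ) := by
  have h : (fun k : ℕ => (k : ℂ)) =O[atTop] fun k : ℕ => (k : ℝ) ^ (1 : ℝ) :=
    IsBigO.of_bound 1 (by simp)
  cases N with
  | zero => exact h
  | succ N =>
    refine ⟨h, ?_⟩
    simpa using symbolUpTo_const N 1

/-- The difference of `Γ(u+l)/Γ(v+l)` is `(u-v) Γ(u+l)/Γ(v+1+l)`, a quotient of the same kind with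
exponent smaller by one. -/
theorem symbolUpTo_Gamma_div (N : ℕ) (u v : ℂ) :
    SymbolUpTo N (u - v).re fun l => Complex.Gamma (u + l) / Complex.Gamma (v + l) := by
  induction N generalizing u v with
  | zero => exact (isTheta_Gamma_div u v).1
  | succ N ih =>
    refine ⟨(isTheta_Gamma_div u v).1, ?_⟩
    have h := (ih u (v + 1)).const_mul (u - v)
    rw [show (u - (v + 1)).re = (u - v).re - 1 by simp; ring] at h
    refine h.congr ?_
    filter_upwards [eventually_not_pole u, eventually_not_pole v] with l hu hv
    have hu0 : u + l ≠ 0 := by simpa using hu 0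
    have hv0 : v + l ≠ 0 := by simpa using hv 0
    have hG := Complex.Gamma_ne_zero hv
    push_cast
    rw [show v + 1 + (l : ℂ) = v + l + 1 by ring, ← add_assoc, ← add_assoc,
      Complex.Gamma_add_one _ hu0, Complex.Gamma_add_one _ hv0]
    field_simp
    ring

/-! ### Convolution with binomial coefficients -/

/-- The convolution of `g` with the coefficients of `(1 - x) ^ (-β)`. -/
noncomputable def binConv (β : ℂ) (g : ℕ → ℂ) (k : ℕ) : ℂ :=
  ∑ q ∈ antidiagonal k, g q.1 * (poch β q.2 / (q.2 ! : ℂ))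

theorem poch_div_factorial_succ (β : ℂ) (m : ℕ) :
    ((m : ℂ) + 1) * (poch β (m + 1) / ((m + 1)! : ℂ)) = β * (poch (β + 1) m / (m ! : ℂ)) := by
  have h1 : (m : ℂ) + 1 ≠ 0 := by exact_mod_cast m.succ_ne_zero
  rw [poch_succ_left, Nat.factorial_succ]
  push_cast
  field_simp [factorial_ne_zero' m]

theorem poch_div_factorial_sub (β : ℂ) (m : ℕ) :
    poch (β + 1) (m + 1) / ((m + 1)! : ℂ) - poch (β + 1) m / (m ! : ℂ) =
      poch β (m + 1) / ((m + 1)! : ℂ) := by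
  have h1 : (m : ℂ) + 1 ≠ 0 := by exact_mod_cast m.succ_ne_zero
  rw [poch_succ_left β, poch_succ, Nat.factorial_succ]
  push_cast
  field_simp [factorial_ne_zero' m]
  ring

/-- In generating functions: `(1-x) (1-x)^(-β-1) = (1-x)^(-β)`. -/
theorem binConv_sub (β : ℂ) (g : ℕ → ℂ) (k : ℕ) :
    binConv (β + 1) g (k + 1) - binConv (β + 1) g k = binConv β g (k + 1) := by
  rw [binConv, binConv, binConv, Nat.sum_antidiagonal_succ', Nat.sum_antidiagonal_succ',
    add_sub_assoc, ← sum_sub_distrib]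
  simp only [← mul_sub, poch_div_factorial_sub]
  simp [poch_zero]

/-- With `G` the generating function of `g`, the derivative of `G (1-x)^(-β)` is `((1-x) G' + β G)
(1-x)^(-β-1)`. Thus `β` is raised by one at the price of a factor `k + 1`. -/
theorem succ_mul_binConv (β : ℂ) (g : ℕ → ℂ) (k : ℕ) :
    ((k : ℂ) + 1) * binConv β g (k + 1) =
      binConv (β + 1) (fun l => ((l + 1 : ℕ) : ℂ) * g (l + 1) - (l : ℂ) * g l) k +
        β * binConv (β + 1) g k := by
  have h1 : ((k : ℂ) + 1) * binConv β g (k + 1) =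
      binConv β (fun l => (l : ℂ) * g l) (k + 1) +
      ∑ q ∈ antidiagonal (k + 1), g q.1 * (q.2 * (poch β q.2 / (q.2 ! : ℂ))) := by
    rw [binConv, binConv, mul_sum, ← sum_add_distrib]
    refine sum_congr rfl fun q hq => ?_
    rw [HasAntidiagonal.mem_antidiagonal] at hq
    have : (k : ℂ) + 1 = q.1 + q.2 := by exact_mod_cast hq.symm
    rw [this]
    ring
  rw [h1, ← binConv_sub, Nat.sum_antidiagonal_succ']
  have h2 : binConv (β + 1) (fun l => (l : ℂ) * g l) (k + 1) =
      binConv (β + 1) (fun l => ((l + 1 : ℕ) : ℂ) * g (l + 1)) k := by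
    rw [binConv, Nat.sum_antidiagonal_succ]
    simp [binConv]
  rw [h2]
  simp only [binConv, Nat.cast_zero, zero_mul, mul_zero, zero_add, Nat.cast_add, Nat.cast_one,
    poch_div_factorial_succ, sub_mul, sum_sub_distrib, mul_sum]
  congr 1
  refine sum_congr rfl fun q _ => ?_
  ring

theorem sum_rpow_le {θ : ℝ} (hθ : -1 < θ) :
    ∃ C : ℝ, 0 ≤ C ∧ ∀ k : ℕ, ∑ l ∈ range (k + 1), ((l : ℝ) + 1) ^ θ ≤ C * ((k : ℝ) + 1) ^ (θ + 1) := by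
  rcases le_total 0 θ with h | h
  · refine ⟨1, zero_le_one, fun k => ?_⟩
    have h1 : ∀ l ∈ range (k + 1), ((l : ℝ) + 1) ^ θ ≤ ((k : ℝ) + 1) ^ θ := by
      intro l hl
      have : (l : ℝ) ≤ k := by exact_mod_cast Nat.lt_succ_iff.1 (mem_range.1 hl)
      exact Real.rpow_le_rpow (by positivity) (by linarith) h
    refine (sum_le_sum h1).trans_eq ?_
    rw [Real.rpow_add_one (by positivity)]
    simp
    ring
  · have hs : 0 < θ + 1 := by linarith
    refine ⟨1 / (θ + 1), by positivity, fun k => ?_⟩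
    have h1 : ∀ l : ℕ, (θ + 1) * ((l : ℝ) + 1) ^ θ ≤
        ((l + 1 : ℕ) : ℝ) ^ (θ + 1) - (l : ℝ) ^ (θ + 1) := by
      intro l
      have hl : (0 : ℝ) < l + 1 := by positivity
      -- Bernoulli's inequality with exponent `θ + 1` in `(0, 1]` bounds the summand by a
      -- telescoping difference.
      have hb := rpow_one_add_le_one_add_mul_self (s := -1 / ((l : ℝ) + 1))
        (by rw [le_div_iff₀ hl]; linarith [(Nat.cast_nonneg l : (0 : ℝ) ≤ l)]) (p := θ + 1)
        hs.le (by linarith)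
      have e : 1 + -1 / ((l : ℝ) + 1) = l / (l + 1) := by field_simp; ring
      rw [e, Real.div_rpow (by positivity) hl.le, div_le_iff₀ (by positivity)] at hb
      have e2 : ((l : ℝ) + 1) ^ (θ + 1) = ((l : ℝ) + 1) ^ θ * (l + 1) := Real.rpow_add_one hl.ne' θ
      have e3 : (1 + (θ + 1) * (-1 / ((l : ℝ) + 1))) * ((l : ℝ) + 1) ^ (θ + 1) =
          ((l : ℝ) + 1) ^ (θ + 1) - (θ + 1) * ((l : ℝ) + 1) ^ θ := by
        rw [e2]
        field_simp
        ring
      rw [e3] at hb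
      push_cast
      linarith
    have h2 := sum_le_sum fun l (_ : l ∈ range (k + 1)) => h1 l
    rw [← mul_sum, sum_range_sub (fun l : ℕ => (l : ℝ) ^ (θ + 1)), Nat.cast_zero,
      Real.zero_rpow hs.ne', sub_zero] at h2
    rw [one_div, ← div_eq_inv_mul, le_div_iff₀ hs]
    push_cast at h2
    linarith

theorem isBigO_poch_div_factorial (β : ℂ) :
    (fun m : ℕ => poch β m / (m ! : ℂ)) =O[atTop] fun m : ℕ => (m : ℝ) ^ (β.re - 1) := by
  have h0 : (fun m : ℕ => ((m ! : ℂ))⁻¹) =O[atTop] fun m : ℕ => ((m ! : ℝ))⁻¹ :=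
    IsBigO.of_bound 1 (by simp)
  have h := (isBigO_poch β).mul h0
  refine h.trans (IsBigO.of_bound 1 (Eventually.of_forall fun m => ?_))
  have : (m ! : ℝ) ≠ 0 := by exact_mod_cast m.factorial_ne_zero
  simp only [norm_mul, norm_inv, one_mul, Real.norm_natCast]
  field_simp
  rfl

/-- When `Re β ≥ 1` the bound `(m+1)^(Re β - 1)` of the binomial coefficient increases with `m`, so
it can be taken out of the sum at `m = k`; no cancellation is needed. -/
theorem isBigO_sum_norm_binConv {β : ℂ} (hβ : 1 ≤ β.re) {θ : ℝ} (hθ : -1 < θ) {g : ℕ → ℂ}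
    (hg : g =O[atTop] fun k : ℕ => (k : ℝ) ^ θ) :
    (fun k => ∑ q ∈ antidiagonal k, ‖g q.1 * (poch β q.2 / (q.2 ! : ℂ))‖) =O[atTop]
      fun k : ℕ => (k : ℝ) ^ (θ + β.re) := by
  obtain ⟨C, hC, h1⟩ := isBigO_rpow_iff.1 hg
  obtain ⟨D, hD, h2⟩ := isBigO_rpow_iff.1 (isBigO_poch_div_factorial β)
  obtain ⟨E, hE, h3⟩ := sum_rpow_le hθ
  refine isBigO_rpow_iff.2 ⟨C * D * E, by positivity, fun k => ?_⟩
  rw [Real.norm_of_nonneg (sum_nonneg fun _ _ => norm_nonneg _)]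
  have h4 : ∀ q ∈ antidiagonal k, ‖g q.1 * (poch β q.2 / (q.2 ! : ℂ))‖ ≤
      C * D * ((k : ℝ) + 1) ^ (β.re - 1) * ((q.1 : ℝ) + 1) ^ θ := by
    intro q hq
    rw [HasAntidiagonal.mem_antidiagonal] at hq
    have hq2 : (q.2 : ℝ) ≤ k := by exact_mod_cast (by omega : q.2 ≤ k)
    rw [norm_mul]
    calc _ ≤ (C * ((q.1 : ℝ) + 1) ^ θ) * (D * ((k : ℝ) + 1) ^ (β.re - 1)) := by
          gcongr
          · exact h1 _
          · refine (h2 _).trans ?_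
            gcongr
      _ = _ := by ring
  refine (sum_le_sum h4).trans ?_
  rw [← mul_sum, Nat.sum_antidiagonal_eq_sum_range_succ_mk (fun q => ((q.1 : ℝ) + 1) ^ θ)]
  calc _ ≤ C * D * ((k : ℝ) + 1) ^ (β.re - 1) * (E * ((k : ℝ) + 1) ^ (θ + 1)) := by
        gcongr
        exact h3 k
    _ = C * D * E * (((k : ℝ) + 1) ^ (β.re - 1) * ((k : ℝ) + 1) ^ (θ + 1)) := by ring
    _ = _ := by
        rw [← Real.rpow_add (by positivity)]
        congr 2
        ring

/-- For small `Re β` the absolute values are too large and cancellation must be used.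
`succ_mul_binConv` expresses `(k+1)` times the convolution through convolutions with `β + 1`,
applied to `g` and to the difference of `l g(l)`; the latter has again order `θ`, because `g` is a
symbol. Dividing by `k + 1` gains the missing power, and the iteration ends at `Re β ≥ 1`. -/
theorem isBigO_binConv (β : ℂ) {θ : ℝ} (hθ : -1 < θ) {g : ℕ → ℂ} (hg : ∀ N, SymbolUpTo N θ g) :
    binConv β g =O[atTop] fun k : ℕ => (k : ℝ) ^ (θ + β.re) := by
  have key : ∀ (n : ℕ) (β : ℂ), 1 ≤ β.re + n → ∀ g : ℕ → ℂ, (∀ N, SymbolUpTo N θ g) →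
      binConv β g =O[atTop] fun k : ℕ => (k : ℝ) ^ (θ + β.re) := by
    intro n
    induction n with
    | zero =>
      intro β hβ g hg
      refine IsBigO.trans (IsBigO.of_bound 1 (Eventually.of_forall fun k => ?_))
        (isBigO_sum_norm_binConv (by simpa using hβ) hθ (hg 0).isBigO)
      rw [one_mul, Real.norm_of_nonneg (sum_nonneg fun _ _ => norm_nonneg _)]
      exact norm_sum_le _ _
    | succ n ih =>
      intro β hβ g hg
      have hβ' : 1 ≤ (β + 1).re + n := by push_cast at hβ; simp; linarith
      have hh : ∀ N, SymbolUpTo N θ fun l => ((l + 1 : ℕ) : ℂ) * g (l + 1) - (l : ℂ) * g l := by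
        intro N
        have := ((symbolUpTo_natCast (N + 1)).mul (hg (N + 1))).2
        simpa using this
      have h1 := ih (β + 1) hβ' _ hh
      have h2 := (ih (β + 1) hβ' g hg).const_mul_left β
      have h3 := h1.add h2
      have h4 : (fun k => binConv β g (k + 1)) =O[atTop] fun k : ℕ => (k : ℝ) ^ (θ + β.re) := by
        have h5 : (fun k : ℕ => ((k : ℂ) + 1)⁻¹) =O[atTop] fun k : ℕ => (k : ℝ) ^ (-1 : ℝ) := by
          refine IsBigO.of_bound 1 ?_
          filter_upwards [eventually_gt_atTop 0] with k hk
          have hk' : (0 : ℝ) < k := by exact_mod_cast hk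
          rw [norm_inv, one_mul, Real.rpow_neg_one, norm_inv, Real.norm_natCast,
            show (k : ℂ) + 1 = ((k + 1 : ℕ) : ℂ) by push_cast; ring, Complex.norm_natCast]
          push_cast
          gcongr
          linarith
        have h6 := IsBigO.rpow_mul h5 h3
        rw [show -1 + (θ + (β + 1).re) = θ + β.re by simp; ring] at h6
        refine h6.congr_left fun k => ?_
        have hk : (k : ℂ) + 1 ≠ 0 := by exact_mod_cast k.succ_ne_zero
        rw [← succ_mul_binConv, ← mul_assoc, inv_mul_cancel₀ hk, one_mul]
      exact IsBigO.rpow_unshift h4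
  obtain ⟨n, hn⟩ := exists_nat_ge (1 - β.re)
  exact key n β (by linarith) g hg

theorem symbolUpTo_binConv (N : ℕ) (β : ℂ) {θ : ℝ} (hθ : -1 < θ) {g : ℕ → ℂ}
    (hg : ∀ N, SymbolUpTo N θ g) : SymbolUpTo N (θ + β.re) (binConv β g) := by
  induction N generalizing β with
  | zero => exact isBigO_binConv β hθ hg
  | succ N ih =>
    refine ⟨isBigO_binConv β hθ hg, ?_⟩
    have h := (ih (β - 1)).shift
    rw [show θ + (β - 1).re = θ + β.re - 1 by simp; ring] at h
    convert h using 2 with k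
    have := binConv_sub (β - 1) g k
    rwa [sub_add_cancel] at this

/-! ### Growth of the coefficients -/

/-- Since `(X+l)_m / Γ(X+l+m) = 1/Γ(X+l)`, the normalisation by `Γ(X+k)` turns `raise` into a plain
convolution. -/
theorem raise_div_Gamma (X β : ℂ) (A : ℕ → ℂ) (k : ℕ) :
    raise X β A k / Complex.Gamma (X + k) = binConv β (fun l => A l / Complex.Gamma (X + l)) k := by
  rw [raise, binConv, sum_div]
  refine sum_congr rfl fun q hq => ?_
  rw [HasAntidiagonal.mem_antidiagonal] at hq
  have h := inv_Gamma_eq_poch_mul (X + q.1) q.2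
  rw [add_assoc, show (q.1 : ℂ) + q.2 = k by exact_mod_cast hq] at h
  rw [div_eq_mul_inv (A q.1), h]
  ring

theorem symbolUpTo_div_Gamma {A : ℕ → ℂ} {u v : ℂ} {θ : ℝ}
    (h : ∀ N, SymbolUpTo N θ fun l => A l / Complex.Gamma (u + l)) (N : ℕ) :
    SymbolUpTo N (θ + (u - v).re) fun l => A l / Complex.Gamma (v + l) := by
  refine ((h N).mul (symbolUpTo_Gamma_div N u v)).congr ?_
  filter_upwards [eventually_not_pole u] with l hl
  have := Complex.Gamma_ne_zero hl
  field_simp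

/-- Renormalising from `Γ(X+c+l)` to `Γ(X+l)` gives order `-1 - α + Re c`, which exceeds `-1`
exactly because `α < Re c`; then `symbolUpTo_binConv` applies. The order `-1 - α` is restored by the
final normalisation. -/
theorem symbolUpTo_raise {A : ℕ → ℂ} {X β c : ℂ} {α : ℝ} (hα : α < c.re)
    (h : ∀ N, SymbolUpTo N (-1 - α) fun l => A l / Complex.Gamma (X + c + l)) (N : ℕ) :
    SymbolUpTo N (-1 - α) fun l => raise X β A l / Complex.Gamma (X + β + c + l) := by
  have h1 := symbolUpTo_div_Gamma (v := X) h
  have h2 := fun N => symbolUpTo_binConv N β (by simp; linarith) h1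
  simp only [← funext (raise_div_Gamma X β A)] at h2
  have h3 := symbolUpTo_div_Gamma (v := X + β + c) h2 N
  rw [show -1 - α + (X + c - X).re + β.re + (X - (X + β + c)).re = -1 - α by simp; ring] at h3
  exact h3

/-- `b_1 + ⋯ + b_{q+1} - a_3 - ⋯ - a_{q+2}`. -/
noncomputable def total (q : ℕ) (a b : ℕ → ℂ) : ℂ :=
  ∑ j ∈ Icc 1 (q + 1), b j - ∑ j ∈ Icc 3 (q + 2), a j

theorem sum_Icc_shift {M : Type*} [AddCommMonoid M] (f : ℕ → M) (m n : ℕ) :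
    ∑ j ∈ Icc (m + 1) (n + 1), f j = ∑ j ∈ Icc m n, f (j + 1) := by
  rw [← Finset.map_add_right_Icc, sum_map]
  rfl

theorem prod_Icc_shift {M : Type*} [CommMonoid M] (f : ℕ → M) (m n : ℕ) :
    ∏ j ∈ Icc (m + 1) (n + 1), f j = ∏ j ∈ Icc m n, f (j + 1) := by
  rw [← Finset.map_add_right_Icc, prod_map]
  rfl

theorem total_succ (q : ℕ) (a b : ℕ → ℂ) :
    total (q + 1) a b = b 1 + excess (q + 2) a b := by
  rw [total, excess, ← add_sub_assoc]
  congr 1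

theorem total_shift (q : ℕ) (a b : ℕ → ℂ) :
    total q (fun j => a (j + 1)) (fun j => b (j + 1)) = excess (q + 2) a b + a 3 := by
  have h1 : ∑ j ∈ Icc 3 (q + 2 + 1), a j = a 3 + ∑ j ∈ Icc 4 (q + 2 + 1), a j :=
    (add_sum_Ioc_eq_sum_Icc (by omega)).symm
  have h2 := sum_Icc_shift a 3 (q + 2)
  have h3 := sum_Icc_shift b 1 (q + 1)
  rw [total, excess, h1, ← h2, ← h3]
  ring

theorem symbolUpTo_levelCoeff (q : ℕ) (a b : ℕ → ℂ) {α : ℝ}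
    (hα : ∀ j ∈ Icc 3 (q + 2), α < (a j).re) (N : ℕ) :
    SymbolUpTo N (-1 - α) fun k => levelCoeff q a b k / Complex.Gamma (total q a b + k) := by
  induction q generalizing a b N with
  | zero =>
    refine (symbolUpTo_zero N (-1 - α)).congr ?_
    filter_upwards [eventually_ne_atTop 0] with k hk
    simp [levelCoeff, unitSeq, hk]
  | succ q ih =>
    have h1 := ih (fun j => a (j + 1)) (fun j => b (j + 1)) fun j hj =>
      hα (j + 1) (by simp only [mem_Icc] at hj ⊢; omega)
    simp only [total_shift] at h1
    -- Here `c = a 3`: the sum of parameters of the shifted lists is `excess + a 3`, and adding `β =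
    -- b 1 - a 3` gives the sum `b 1 + excess` of the present lists.
    have h2 := symbolUpTo_raise (β := b 1 - a 3) (hα 3 (by simp)) h1 N
    rw [total_succ]
    rw [show excess (q + 2) a b + (b 1 - a 3) + a 3 = b 1 + excess (q + 2) a b by ring] at h2
    exact h2

/-! ### Gauss's summation theorem -/

theorem natCast_rpow_tendsto_zero {θ : ℝ} (hθ : θ < 0) :
    Tendsto (fun k : ℕ => (k : ℝ) ^ θ) atTop (𝓝 0) := by
  have h := (tendsto_rpow_neg_atTop (neg_pos.2 hθ)).comp (tendsto_natCast_atTop_atTop (R := ℝ))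
  simpa [Function.comp_def] using h

/-- The `m`-th term of Gauss's series at `1`, divided by `Γ(c)`. -/
noncomputable def gaussTerm (x y c : ℂ) (m : ℕ) : ℂ :=
  poch x m * poch y m / (m ! : ℂ) / Complex.Gamma (c + m)

theorem isBigO_gaussTerm (x y c : ℂ) :
    gaussTerm x y c =O[atTop] fun m : ℕ => (m : ℝ) ^ (-1 - (c - x - y).re) := by
  have h1 := ((isBigO_poch x).mul (isBigO_poch_div_factorial y)).mul (isTheta_Gamma c).inv.1
  have h2 : gaussTerm x y c = fun m => poch x m * (poch y m / (m ! : ℂ)) *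
      (Complex.Gamma (c + m))⁻¹ := by
    funext m
    rw [gaussTerm]
    ring
  rw [h2]
  refine h1.trans (EventuallyEq.isBigO ?_)
  filter_upwards [eventually_gt_atTop 0] with m hm
  have hm' : (0 : ℝ) < m := by exact_mod_cast hm
  have : (m ! : ℝ) ≠ 0 := by exact_mod_cast m.factorial_ne_zero
  have e : -1 - (c - x - y).re = (x.re - 1) + (y.re - 1) + -(c.re - 1) := by simp; ring
  rw [e, Real.rpow_add hm', Real.rpow_add hm', Real.rpow_neg hm'.le]
  field_simp

theorem summable_gaussTerm {x y c : ℂ} (h : 0 < (c - x - y).re) : Summable (gaussTerm x y c) :=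
  (summable_of_isBigO_rpow (by linarith) (isBigO_gaussTerm x y c)).of_norm

theorem gaussTerm_telescope (x y c : ℂ) (m : ℕ) :
    (c - x - y) * gaussTerm x y c m - (c - x) * (c - y) * gaussTerm x y (c + 1) m =
      m * gaussTerm x y c m - ((m + 1 : ℕ) : ℂ) * gaussTerm x y c (m + 1) := by
  have h1 : (m : ℂ) + 1 ≠ 0 := by exact_mod_cast m.succ_ne_zero
  have h2 := factorial_ne_zero' m
  simp only [gaussTerm, div_eq_mul_inv _ (Complex.Gamma _), poch_succ, Nat.factorial_succ]
  rw [inv_Gamma (c + m), show c + 1 + (m : ℂ) = c + m + 1 by ring]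
  push_cast
  rw [← add_assoc]
  field_simp
  ring

/-- The termwise difference of the two sides telescopes, with boundary term `m` times the `m`-th
Gauss term; this tends to `0` because `Re(c-x-y) > 0`. -/
theorem tsum_gaussTerm_succ {x y c : ℂ} (h : 0 < (c - x - y).re) :
    (c - x - y) * ∑' m, gaussTerm x y c m =
      (c - x) * (c - y) * ∑' m, gaussTerm x y (c + 1) m := by
  have h' : 0 < (c + 1 - x - y).re := by simp at h ⊢; linarith
  have s1 := (summable_gaussTerm h).hasSum.mul_left (c - x - y)
  have s2 := (summable_gaussTerm h').hasSum.mul_left ((c - x) * (c - y))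
  have s3 := (s1.sub s2).tendsto_sum_nat
  have hz : Tendsto (fun n : ℕ => (n : ℂ) * gaussTerm x y c n) atTop (𝓝 0) := by
    have h4 : (fun k : ℕ => (k : ℂ)) =O[atTop] fun k : ℕ => (k : ℝ) ^ (1 : ℝ) :=
      IsBigO.of_bound 1 (by simp)
    refine (IsBigO.rpow_mul h4 (isBigO_gaussTerm x y c)).trans_tendsto
      (natCast_rpow_tendsto_zero ?_)
    linarith
  have h5 : ∀ n : ℕ, ∑ m ∈ range n, ((c - x - y) * gaussTerm x y c m -
      (c - x) * (c - y) * gaussTerm x y (c + 1) m) = -(n * gaussTerm x y c n) := by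
    intro n
    simp only [gaussTerm_telescope]
    rw [sum_range_sub' (fun m : ℕ => (m : ℂ) * gaussTerm x y c m)]
    simp
  simp only [h5] at s3
  have := tendsto_nhds_unique s3 (by simpa using hz.neg)
  exact sub_eq_zero.1 this

theorem norm_poch_ge {c : ℂ} {ρ : ℝ} (hρ : 0 < ρ) (h : ρ ≤ c.re) (m : ℕ) :
    ‖poch (ρ : ℂ) m‖ ≤ ‖poch c m‖ := by
  induction m with
  | zero => simp [poch_zero]
  | succ m ih =>
    rw [poch_succ, poch_succ, norm_mul, norm_mul]
    gcongr
    have h1 : ‖(ρ : ℂ) + m‖ = ρ + m := by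
      rw [show (ρ : ℂ) + m = ((ρ + m : ℝ) : ℂ) by push_cast; ring, Complex.norm_real,
        Real.norm_of_nonneg (by positivity)]
    rw [h1]
    calc ρ + m ≤ (c + m).re := by simp; linarith
      _ ≤ ‖c + m‖ := Complex.re_le_norm _

/-- Dominated convergence: after multiplication by `Γ(c+N)` the denominators are `(c+N)_m`, so only
the term `m = 0` survives. -/
theorem tendsto_Gamma_mul_tsum_gaussTerm (x y c : ℂ) :
    Tendsto (fun N : ℕ => Complex.Gamma (c + N) * ∑' m, gaussTerm x y (c + N) m) atTop (𝓝 1) := by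
  -- The series with lower parameter `ρ = Re c + N₁` is the majorant: `ρ > 0` makes `|(c+N)_m| ≥
  -- (ρ)_m` for `N ≥ N₁`, and `ρ > Re(x+y)` makes the majorant converge.
  obtain ⟨N₁, hN₁⟩ := exists_nat_gt (max (-c.re) ((x + y).re - c.re))
  set ρ : ℝ := c.re + N₁ with hρ
  have hρ0 : 0 < ρ := by have := (le_max_left _ _).trans_lt hN₁; linarith
  have hρ1 : (x + y).re < ρ := by have := (le_max_right _ _).trans_lt hN₁; linarith
  have hρp : ∀ m : ℕ, (ρ : ℂ) ≠ -(m : ℂ) := by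
    intro m h
    have := congrArg Complex.re h
    simp at this
    linarith [(Nat.cast_nonneg m : (0 : ℝ) ≤ m)]
  have hbound : Summable fun m => ‖Complex.Gamma ρ * gaussTerm x y ρ m‖ :=
    ((summable_gaussTerm (by simp at hρ1 ⊢; linarith)).mul_left _).norm
  have hre : ∀ N : ℕ, N₁ ≤ N → ρ ≤ (c + N).re := by
    intro N hN
    have : (N₁ : ℝ) ≤ N := by exact_mod_cast hN
    simp only [Complex.add_re, Complex.natCast_re]
    linarith
  have hterm : ∀ s : ℂ, (∀ m : ℕ, s ≠ -(m : ℂ)) → ∀ m, Complex.Gamma s * gaussTerm x y s m =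
      poch x m * poch y m / (m ! : ℂ) / poch s m := by
    intro s hs m
    rw [gaussTerm, ← Gamma_mul_poch hs]
    have h1 := Complex.Gamma_ne_zero hs
    field_simp
  have hp : ∀ N : ℕ, N₁ ≤ N → ∀ m : ℕ, c + N ≠ -(m : ℂ) := by
    intro N hN m h
    have h1 := hre N hN
    rw [h] at h1
    simp at h1
    linarith [(Nat.cast_nonneg m : (0 : ℝ) ≤ m)]
  have hlim : ∀ m : ℕ, Tendsto (fun N : ℕ => Complex.Gamma (c + N) * gaussTerm x y (c + N) m) atTop
      (𝓝 (if m = 0 then 1 else 0)) := by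
    intro m
    cases m with
    | zero =>
      simp only [if_true]
      refine tendsto_const_nhds.congr' ?_
      filter_upwards [eventually_ge_atTop N₁] with N hN
      rw [hterm _ (hp N hN)]
      simp [poch_zero]
    | succ m =>
      simp only [Nat.succ_ne_zero, if_false]
      have h1 : Tendsto (fun N : ℕ => ‖poch x (m + 1) * poch y (m + 1) / ((m + 1)! : ℂ)‖ /
          (c.re + N)) atTop (𝓝 0) := by
        refine Tendsto.div_atTop tendsto_const_nhds ?_
        exact tendsto_atTop_add_const_left _ _ tendsto_natCast_atTop_atTop
      refine squeeze_zero_norm' ?_ h1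
      filter_upwards [eventually_ge_atTop (N₁ + 1)] with N hN
      have hN' : N₁ ≤ N := by omega
      rw [hterm _ (hp N hN'), norm_div]
      have h2 := hre N hN'
      have h4 : (1 : ℝ) ≤ ‖poch (c + N + 1) m‖ := by
        refine le_trans ?_ (norm_poch_ge one_pos (by simp at h2 ⊢; linarith) m)
        have : poch (1 : ℂ) m = (m ! : ℂ) := by simp [poch, ascPochhammer_eval_one]
        rw [Complex.ofReal_one, this, Complex.norm_natCast]
        exact_mod_cast m.factorial_pos
      have h6 : (0 : ℝ) < c.re + N := by simp at h2; linarith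
      refine div_le_div_of_nonneg_left (norm_nonneg _) h6 ?_
      rw [poch_succ_left, norm_mul]
      have h5 := Complex.re_le_norm (c + N)
      simp only [Complex.add_re, Complex.natCast_re] at h5
      nlinarith
  have h := tendsto_tsum_of_dominated_convergence hbound hlim ?_
  · simp only [tsum_ite_eq, tsum_mul_left] at h
    exact h
  · filter_upwards [eventually_ge_atTop N₁] with N hN m
    rw [hterm _ (hp N hN), hterm _ hρp, norm_div _ (poch (c + N) m), norm_div _ (poch (ρ : ℂ) m)]
    have h1 : 0 < ‖poch (ρ : ℂ) m‖ := norm_pos_iff.2 (poch_ne_zero hρp m)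
    exact div_le_div_of_nonneg_left (norm_nonneg _) h1 (norm_poch_ge hρ0 (hre N hN) m)

theorem tendsto_Gamma_mul_Gamma_div (x y c : ℂ) :
    Tendsto (fun N : ℕ => Complex.Gamma (c + N) * (Complex.Gamma (c - x - y + N) /
      (Complex.Gamma (c - x + N) * Complex.Gamma (c - y + N)))) atTop (𝓝 1) := by
  have h := ((tendsto_Gamma_div c).mul (tendsto_Gamma_div (c - x - y))).div
    ((tendsto_Gamma_div (c - x)).mul (tendsto_Gamma_div (c - y))) (by simp)
  simp only [mul_one, div_one] at h
  refine h.congr' ?_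
  filter_upwards [eventually_ne_atTop 0] with N hN
  have hN' : (N : ℂ) ≠ 0 := by exact_mod_cast hN
  have e : (N : ℂ) ^ (c - 1) * (N : ℂ) ^ (c - x - y - 1) =
      (N : ℂ) ^ (c - x - 1) * (N : ℂ) ^ (c - y - 1) := by
    rw [← Complex.cpow_add _ _ hN', ← Complex.cpow_add _ _ hN']
    congr 1
    ring
  have h0 : ∀ s : ℂ, (N : ℂ) ^ s ≠ 0 := fun s => by simp [Complex.cpow_eq_zero_iff, hN']
  have h1 := h0 (c - 1)
  have h2 := h0 (c - x - y - 1)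
  have h3 := h0 (c - x - 1)
  have h4 := h0 (c - y - 1)
  have h5 := factorial_ne_zero' N
  simp only [Pi.div_apply]
  rw [div_mul_div_comm, div_mul_div_comm, div_div_div_eq,
    show (N ! : ℂ) * (N : ℂ) ^ (c - 1) * ((N ! : ℂ) * (N : ℂ) ^ (c - x - y - 1)) =
      (N ! : ℂ) * (N ! : ℂ) * ((N : ℂ) ^ (c - 1) * (N : ℂ) ^ (c - x - y - 1)) by ring, e,
    show (N ! : ℂ) * (N : ℂ) ^ (c - x - 1) * ((N ! : ℂ) * (N : ℂ) ^ (c - y - 1)) =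
      (N ! : ℂ) * (N ! : ℂ) * ((N : ℂ) ^ (c - x - 1) * (N : ℂ) ^ (c - y - 1)) by ring,
    mul_comm (_ * (_ * _)) (Complex.Gamma (c - x + N) * Complex.Gamma (c - y + N)),
    mul_div_mul_right _ _ (by simp [h3, h4, Nat.factorial_ne_zero]), mul_div_assoc]

/-- The defect `d` between the two sides obeys the same recursion `c → c + 1` as each of them, and
`Γ(c+N) d(c+N)` tends to `0`. Iterating, `d(c)` is this null sequence times a bounded sequence,
hence `0`. -/
theorem gauss_sum {x y c : ℂ} (h : 0 < (c - x - y).re) :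
    HasSum (gaussTerm x y c)
      (Complex.Gamma (c - x - y) / (Complex.Gamma (c - x) * Complex.Gamma (c - y))) := by
  set d : ℂ → ℂ := fun c => ∑' m, gaussTerm x y c m -
    Complex.Gamma (c - x - y) / (Complex.Gamma (c - x) * Complex.Gamma (c - y)) with hd
  have hstep : ∀ c : ℂ, 0 < (c - x - y).re → (c - x - y) * d c = (c - x) * (c - y) * d (c + 1) := by
    intro c hc
    have h0 : c - x - y ≠ 0 := by
      intro h0
      simp [h0] at hc
    have e1 : c + 1 - x - y = c - x - y + 1 := by ring
    have e2 : c + 1 - x = c - x + 1 := by ring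
    have e3 : c + 1 - y = c - y + 1 := by ring
    rw [hd]
    simp only [mul_sub, tsum_gaussTerm_succ hc, div_eq_mul_inv, mul_inv]
    rw [e1, e2, e3, Complex.Gamma_add_one _ h0, inv_Gamma (c - x), inv_Gamma (c - y)]
    ring
  have hiter : ∀ N : ℕ, poch (c - x - y) N * d c = poch (c - x) N * poch (c - y) N * d (c + N) := by
    intro N
    induction N with
    | zero => simp [poch_zero]
    | succ N ih =>
      have hN : 0 < (c + N - x - y).re := by
        simp at h ⊢
        linarith [(Nat.cast_nonneg N : (0 : ℝ) ≤ N)]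
      have h1 := hstep (c + N) hN
      rw [poch_succ, poch_succ, poch_succ]
      push_cast
      rw [← add_assoc]
      linear_combination (c - x - y + N) * ih + poch (c - x) N * poch (c - y) N * h1
  have hlim : Tendsto (fun N : ℕ => Complex.Gamma (c + N) * d (c + N)) atTop (𝓝 0) := by
    have h1 := (tendsto_Gamma_mul_tsum_gaussTerm x y c).sub (tendsto_Gamma_mul_Gamma_div x y c)
    rw [sub_self] at h1
    refine h1.congr fun N => ?_
    rw [hd]
    simp only [mul_sub]
    rw [show c + (N : ℂ) - x - y = c - x - y + N by ring, show c + (N : ℂ) - x = c - x + N by ring,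
      show c + (N : ℂ) - y = c - y + N by ring]
  have hp : ∀ m : ℕ, c - x - y ≠ -(m : ℂ) := by
    intro m hm
    rw [hm] at h
    simp at h
    linarith [(Nat.cast_nonneg m : (0 : ℝ) ≤ m)]
  -- The real parts of the exponents and the factorials cancel: `(c-x) + (c-y) = (c-x-y) + c`.
  have hb : (fun N : ℕ => poch (c - x) N * poch (c - y) N * (poch (c - x - y) N)⁻¹ *
      (Complex.Gamma (c + N))⁻¹) =O[atTop] fun _ => (1 : ℝ) := by
    refine ((((isBigO_poch (c - x)).mul (isBigO_poch (c - y))).mul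
      (isTheta_poch hp).inv.1).mul (isTheta_Gamma c).inv.1).trans (EventuallyEq.isBigO ?_)
    filter_upwards [eventually_gt_atTop 0] with m hm
    have hm' : (0 : ℝ) < m := by exact_mod_cast hm
    have h1 : (m ! : ℝ) ≠ 0 := by exact_mod_cast m.factorial_ne_zero
    have e : (m : ℝ) ^ ((c - x).re - 1) * (m : ℝ) ^ ((c - y).re - 1) =
        (m : ℝ) ^ ((c - x - y).re - 1) * (m : ℝ) ^ (c.re - 1) := by
      rw [← Real.rpow_add hm', ← Real.rpow_add hm']
      congr 1
      simp
      ring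
    have h2 : (m : ℝ) ^ ((c - x - y).re - 1) ≠ 0 := by positivity
    have h3 : (m : ℝ) ^ (c.re - 1) ≠ 0 := by positivity
    field_simp
    linear_combination e
  have hz : d c = 0 := by
    have h1 := hb.mul_isLittleO ((isLittleO_one_iff ℝ).2 hlim)
    simp only [mul_one] at h1
    refine tendsto_nhds_unique (tendsto_const_nhds.congr' ?_) ((isLittleO_one_iff ℝ).1 h1)
    filter_upwards [eventually_not_pole c] with N hN
    have h2 := Complex.Gamma_ne_zero hN
    have h3 := poch_ne_zero hp N
    have h4 := hiter N
    field_simp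
    linear_combination h4
  have := (summable_gaussTerm h).hasSum
  rwa [sub_eq_zero.1 hz] at this

/-! ### Expansion of Gamma quotients in inverse factorial series -/

theorem hasSum_sum_antidiagonal {F : ℕ → ℕ → ℂ} {G : ℕ → ℂ} {S : ℂ}
    (h : Summable fun k => ∑ q ∈ antidiagonal k, ‖F q.1 q.2‖)
    (hF : ∀ l, HasSum (F l) (G l)) (hG : HasSum G S) :
    HasSum (fun k => ∑ q ∈ antidiagonal k, F q.1 q.2) S := by
  have h1 : Summable fun x : (Σ n : ℕ, antidiagonal n) => ‖F x.2.1.1 x.2.1.2‖ := by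
    refine (summable_sigma_of_nonneg fun _ => norm_nonneg _).2 ⟨fun k => ?_, ?_⟩
    · exact Summable.of_finite
    · refine h.congr fun k => ?_
      rw [tsum_fintype]
      exact (sum_coe_sort (antidiagonal k) fun q => ‖F q.1 q.2‖).symm
  have h2 : Summable fun p : ℕ × ℕ => F p.1 p.2 := by
    refine (HasAntidiagonal.sigmaAntidiagonalEquivProd.summable_iff (f := fun p : ℕ × ℕ => F p.1 p.2)).1 ?_
    exact h1.of_norm
  have h3 := h2.hasSum.prod_fiberwise hF
  have h4 := hG.unique h3
  have h5 := (HasAntidiagonal.sigmaAntidiagonalEquivProd.hasSum_iff).2 h2.hasSum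
  rw [← h4] at h5
  have h6 := h5.sigma (g := fun k => ∑ q ∈ antidiagonal k, F q.1 q.2) fun k => by
    have := hasSum_fintype (fun q : antidiagonal k => F q.1.1 q.1.2)
    rw [sum_coe_sort (antidiagonal k) fun q => F q.1 q.2] at this
    exact this
  exact h6

theorem raise_zero (X β : ℂ) (A : ℕ → ℂ) : raise X β A 0 = A 0 := by
  simp [raise, poch_zero]

/-- The counterpart of `binConv_sub` before division by `Γ(X+k)`. -/
theorem raise_succ_eq (X β : ℂ) (A : ℕ → ℂ) (k : ℕ) :
    raise X β A (k + 1) = raise X (β + 1) A (k + 1) - (X + k) * raise X (β + 1) A k := by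
  rw [raise, raise, raise, Nat.sum_antidiagonal_succ', Nat.sum_antidiagonal_succ', mul_sum,
    add_sub_assoc, ← sum_sub_distrib]
  simp only [poch_zero]
  congr 1
  refine sum_congr rfl fun q hq => ?_
  rw [HasAntidiagonal.mem_antidiagonal] at hq
  have h := poch_div_factorial_sub β q.2
  have e : poch (X + q.1) (q.2 + 1) = poch (X + q.1) q.2 * (X + k) := by
    rw [poch_succ, ← hq]
    push_cast
    ring
  rw [e]
  linear_combination (-(poch (X + q.1) q.2 * (X + k) * A q.1)) * h

/-- If `Re β ≥ 1`, the double series converges absolutely, and summing over the convolution index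
with `l` fixed is Gauss's theorem. Other `β` are reached by descending from `β + 1` to `β` through
an identity of partial sums. -/
theorem hasSum_raise {A : ℕ → ℂ} {X c : ℂ} {α : ℝ} {s : ℂ} (hα0 : 0 < α) (hα : α < c.re)
    (h : ∀ N, SymbolUpTo N (-1 - α) fun l => A l / Complex.Gamma (X + c + l))
    (hs : HasSum (fun l => A l / Complex.Gamma (X + c + l)) s) (β : ℂ) :
    HasSum (fun k => raise X β A k / Complex.Gamma (X + β + c + k))
      (Complex.Gamma c / Complex.Gamma (β + c) * s) := by
  have key : ∀ (n : ℕ) (β : ℂ), 1 ≤ β.re + n →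
      HasSum (fun k => raise X β A k / Complex.Gamma (X + β + c + k))
        (Complex.Gamma c / Complex.Gamma (β + c) * s) := by
    intro n
    induction n with
    | zero =>
      intro β hβ
      have h1 := symbolUpTo_div_Gamma (v := X) h
      rw [show -1 - α + (X + c - X).re = -1 - α + c.re by simp] at h1
      have h2 := isBigO_sum_norm_binConv (by simpa using hβ) (by linarith) (h1 0).isBigO
      have h3 := h2.norm_left.mul (isTheta_Gamma_div X (X + β + c)).1.norm_left
      have h4 : Summable fun k : ℕ => ∑ q ∈ antidiagonal k,
          ‖poch (X + q.1) q.2 * poch β q.2 / (q.2 ! : ℂ) * A q.1 /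
            Complex.Gamma (X + β + c + (q.1 + q.2 : ℕ))‖ := by
        refine summable_of_isBigO_nat (g := fun k : ℕ => (k : ℝ) ^ (-1 - α))
          (Real.summable_nat_rpow.2 (by linarith)) ?_
        refine IsBigO.trans (EventuallyEq.isBigO ?_) (h3.trans (EventuallyEq.isBigO ?_))
        · filter_upwards [eventually_not_pole X] with k hk
          have hG := Complex.Gamma_ne_zero hk
          rw [Real.norm_of_nonneg (sum_nonneg fun _ _ => norm_nonneg _), sum_mul]
          refine sum_congr rfl fun q hq => ?_
          rw [HasAntidiagonal.mem_antidiagonal] at hq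
          rw [← norm_mul, hq]
          have h5 := inv_Gamma_eq_poch_mul (X + q.1) q.2
          rw [add_assoc, show (q.1 : ℂ) + q.2 = k by exact_mod_cast hq] at h5
          rw [div_eq_mul_inv (A q.1), h5]
          congr 1
          field_simp
        · filter_upwards [eventually_gt_atTop 0] with k hk
          rw [← Real.rpow_add (by exact_mod_cast hk)]
          congr 1
          simp
          ring
      have h5 : HasSum (fun k : ℕ => ∑ q ∈ antidiagonal k,
          poch (X + q.1) q.2 * poch β q.2 / (q.2 ! : ℂ) * A q.1 /
            Complex.Gamma (X + β + c + (q.1 + q.2 : ℕ))) (Complex.Gamma c / Complex.Gamma (β + c) * s) := by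
        refine hasSum_sum_antidiagonal (F := fun l m => poch (X + l) m * poch β m / (m ! : ℂ) * A l /
            Complex.Gamma (X + β + c + (l + m : ℕ)))
          (G := fun l => Complex.Gamma c / Complex.Gamma (β + c) *
            (A l / Complex.Gamma (X + c + l))) h4 (fun l => ?_) (hs.mul_left _)
        -- The excess of these Gauss parameters is `c`, independent of `l`; the factor `Γ(c)/Γ(β+c)`
        -- therefore comes out of the sum over `l`.
        have h6 := (gauss_sum (x := X + l) (y := β) (c := X + β + c + l)
          (by simp; linarith)).mul_left (A l)
        rw [show X + β + c + l - (X + l) - β = c by ring,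
          show X + β + c + l - (X + l) = β + c by ring,
          show X + β + c + l - β = X + c + l by ring] at h6
        convert h6 using 1
        · rfl
        · funext m
          rw [gaussTerm]
          push_cast
          rw [← add_assoc]
          ring
        · rw [div_mul_eq_div_div]
          ring
      convert h5 using 1
      funext k
      rw [raise, sum_div]
      refine sum_congr rfl fun q hq => ?_
      rw [HasAntidiagonal.mem_antidiagonal] at hq
      rw [hq]
    | succ n ih =>
      intro β hβ
      have h1 := ih (β + 1) (by push_cast at hβ; simp; linarith)
      have h2 : Summable fun k => raise X β A k / Complex.Gamma (X + β + c + k) :=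
        (summable_of_isBigO_rpow (by linarith) (symbolUpTo_raise hα h 0).isBigO).of_norm
      -- Summation of `raise_succ_eq`. The boundary term is of order `K ^ (-α)`, so it vanishes in
      -- the limit by `α > 0`.
      have h3 : ∀ K : ℕ, ∑ k ∈ range (K + 1), raise X β A k / Complex.Gamma (X + β + c + k) =
          (β + c) * ∑ k ∈ range K, raise X (β + 1) A k / Complex.Gamma (X + (β + 1) + c + k) +
            (X + β + c + K) *
              (raise X (β + 1) A K / Complex.Gamma (X + (β + 1) + c + K)) := by
        intro K
        induction K with
        | zero =>
          simp only [raise_zero, zero_add, sum_range_one, range_zero, sum_empty, div_eq_mul_inv]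
          rw [inv_Gamma, show X + β + c + ((0 : ℕ) : ℂ) + 1 = X + (β + 1) + c + ((0 : ℕ) : ℂ) by ring]
          ring
        | succ K ihK =>
          rw [sum_range_succ, ihK, sum_range_succ _ K, raise_succ_eq]
          simp only [div_eq_mul_inv]
          rw [show X + β + c + ((K + 1 : ℕ) : ℂ) = X + (β + 1) + c + K by push_cast; ring,
            inv_Gamma (X + (β + 1) + c + K),
            show X + (β + 1) + c + ((K + 1 : ℕ) : ℂ) = X + (β + 1) + c + K + 1 by push_cast; ring]
          ring
      have h4 : Tendsto (fun K : ℕ => (X + β + c + K) *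
          (raise X (β + 1) A K / Complex.Gamma (X + (β + 1) + c + K))) atTop (𝓝 0) := by
        have h5 : (fun k : ℕ => X + β + c + k) =O[atTop] fun k : ℕ => (k : ℝ) ^ (1 : ℝ) := by
          refine IsBigO.add ?_ (IsBigO.of_bound 1 (by simp))
          have := isBigO_const_const (X + β + c) (one_ne_zero (α := ℝ)) (atTop : Filter ℕ)
          refine this.trans ?_
          simpa using rpow_isBigO_of_le (zero_le_one (α := ℝ))
        refine (IsBigO.rpow_mul h5 (symbolUpTo_raise (β := β + 1) hα h 0).isBigO).trans_tendsto
          (natCast_rpow_tendsto_zero (by linarith))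
      have h5 := (h1.tendsto_sum_nat.const_mul (β + c)).add h4
      have h6 := (tendsto_add_atTop_iff_nat 1).2 h2.hasSum.tendsto_sum_nat
      simp only [h3] at h6
      have h7 := tendsto_nhds_unique h6 h5
      have h8 := h2.hasSum
      rw [h7] at h8
      convert h8 using 1
      rw [div_eq_mul_inv, inv_Gamma (β + c), show β + 1 + c = β + c + 1 by ring]
      ring
  obtain ⟨n, hn⟩ := exists_nat_ge (1 - β.re)
  exact key n β (by linarith)

theorem exists_lt_of_forall_lt (q : ℕ) (a : ℕ → ℂ) {x : ℝ}
    (ha : ∀ j ∈ Icc 3 (q + 2), x < (a j).re) : ∃ α, x < α ∧ ∀ j ∈ Icc 3 (q + 2), α < (a j).re := by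
  have h : ∀ᶠ α in 𝓝[>] x, ∀ j ∈ Icc 3 (q + 2), α < (a j).re := by
    rw [Filter.eventually_all_finset]
    intro j hj
    exact eventually_nhdsWithin_of_eventually_nhds (gt_mem_nhds (ha j hj))
  obtain ⟨α, h1, h2⟩ := (h.and self_mem_nhdsWithin).exists
  exact ⟨α, h2, h1⟩

/-- Each level contributes the factor `Γ(a 3)/Γ(b 1)` supplied by `hasSum_raise` with `c = a 3`, `β
= b 1 - a 3`; the base is the one-term series `1/Γ(b 1)`. -/
theorem hasSum_levelCoeff (q : ℕ) (a b : ℕ → ℂ) (ha : ∀ j ∈ Icc 3 (q + 2), 0 < (a j).re) :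
    HasSum (fun k => levelCoeff q a b k / Complex.Gamma (total q a b + k))
      ((∏ j ∈ Icc 3 (q + 2), Complex.Gamma (a j)) / ∏ j ∈ Icc 1 (q + 1), Complex.Gamma (b j)) := by
  induction q generalizing a b with
  | zero =>
    convert hasSum_single 0 ?_ using 1
    · simp [levelCoeff, unitSeq, total]
    · intro k hk
      simp [levelCoeff, unitSeq, hk]
  | succ q ih =>
    obtain ⟨α, hα0, hα⟩ := exists_lt_of_forall_lt (q + 1) a ha
    have hα' : ∀ j ∈ Icc 3 (q + 2), α < (a (j + 1)).re := fun j hj =>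
      hα (j + 1) (by simp only [mem_Icc] at hj ⊢; omega)
    have h1 := ih (fun j => a (j + 1)) (fun j => b (j + 1)) fun j hj => hα0.trans (hα' j hj)
    have h2 := symbolUpTo_levelCoeff q (fun j => a (j + 1)) (fun j => b (j + 1)) hα'
    simp only [total_shift] at h1 h2
    have h3 := hasSum_raise hα0 (hα 3 (by simp)) h2 h1 (b 1 - a 3)
    rw [show excess (q + 2) a b + (b 1 - a 3) + a 3 = b 1 + excess (q + 2) a b by ring,
      ← total_succ, sub_add_cancel] at h3
    convert h3 using 1
    · rfl
    have e1 : ∏ j ∈ Icc 3 (q + 2 + 1), Complex.Gamma (a j) =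
        Complex.Gamma (a 3) * ∏ j ∈ Icc 4 (q + 2 + 1), Complex.Gamma (a j) :=
      (mul_prod_Ioc_eq_prod_Icc (by omega)).symm
    have e2 : ∏ j ∈ Icc 1 (q + 1 + 1), Complex.Gamma (b j) =
        Complex.Gamma (b 1) * ∏ j ∈ Icc 2 (q + 1 + 1), Complex.Gamma (b j) :=
      (mul_prod_Ioc_eq_prod_Icc (by omega)).symm
    rw [show q + 1 + 2 = q + 2 + 1 by ring, e1, e2,
      prod_Icc_shift (fun j => Complex.Gamma (a j)) 3, prod_Icc_shift (fun j => Complex.Gamma (b j)) 1,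
      mul_div_mul_comm]

/-- Only differences containing as many `b`'s as `a`'s enter the coefficients. Hence one sequence
`A_k` expands the Gamma quotients at `a + n`, `b + n` for every `n`. -/
theorem levelCoeff_add_nat (q : ℕ) (a b : ℕ → ℂ) (n : ℂ) :
    levelCoeff q (fun j => a j + n) (fun j => b j + n) = levelCoeff q a b := by
  induction q generalizing a b with
  | zero => rfl
  | succ q ih =>
    rw [levelCoeff, levelCoeff, ih (fun j => a (j + 1)) (fun j => b (j + 1))]
    congr 1
    · simp [excess, sum_add_distrib]
    · ring

theorem total_add_nat (q : ℕ) (a b : ℕ → ℂ) (n : ℂ) :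
    total q (fun j => a j + n) (fun j => b j + n) = total q a b + n := by
  simp [total, sum_add_distrib]
  ring

/-! ### Power series with a logarithm -/

/-- The power series with coefficients `p` converges absolutely in the disc of radius `R`. -/
def ConvBelow (R : ℝ) (p : ℕ → ℂ) : Prop :=
  ∀ r : ℝ, 0 ≤ r → r < R → Summable fun n => ‖p n‖ * r ^ n

/-- The sum of the power series with coefficients `p`. -/
noncomputable def powSum (p : ℕ → ℂ) (w : ℂ) : ℂ := ∑' n, p n * w ^ n

/-- The sequence `0, p 0, p 1, …`. -/
def delay (p : ℕ → ℂ) : ℕ → ℂ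
  | 0 => 0
  | n + 1 => p n

theorem ConvBelow.of_le {R : ℝ} {p q : ℕ → ℂ} (hp : ConvBelow R p) (h : ∀ n, ‖q n‖ ≤ ‖p n‖) :
    ConvBelow R q := fun r h0 h1 =>
  Summable.of_nonneg_of_le (fun n => by positivity)
    (fun n => mul_le_mul_of_nonneg_right (h n) (by positivity)) (hp r h0 h1)

theorem ConvBelow.add {R : ℝ} {p q : ℕ → ℂ} (hp : ConvBelow R p) (hq : ConvBelow R q) :
    ConvBelow R fun n => p n + q n := fun r h0 h1 =>
  Summable.of_nonneg_of_le (fun n => by positivity)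
    (fun n => by
      rw [← add_mul]
      exact mul_le_mul_of_nonneg_right (norm_add_le _ _) (by positivity))
    ((hp r h0 h1).add (hq r h0 h1))

theorem ConvBelow.const_mul {R : ℝ} {p : ℕ → ℂ} (hp : ConvBelow R p) (c : ℂ) :
    ConvBelow R fun n => c * p n := fun r h0 h1 => by
  simpa [mul_assoc] using (hp r h0 h1).mul_left ‖c‖

theorem ConvBelow.sub {R : ℝ} {p q : ℕ → ℂ} (hp : ConvBelow R p) (hq : ConvBelow R q) :
    ConvBelow R fun n => p n - q n := by
  simpa [sub_eq_add_neg] using hp.add (hq.const_mul (-1))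

theorem ConvBelow.natCast_mul {R : ℝ} {p : ℕ → ℂ} (hp : ConvBelow R p) :
    ConvBelow R fun n => (n : ℂ) * p n := fun r h0 h1 => by
  -- Convergence at the intermediate radius `s` leaves the factor `n (r/s)^n`, which is bounded.
  obtain ⟨s, hs1, hs2⟩ := exists_between h1
  have hs0 : 0 < s := h0.trans_lt hs1
  have hlt : r / s < 1 := (div_lt_one hs0).2 hs1
  have ht := tendsto_self_mul_const_pow_of_lt_one (by positivity) hlt
  have hb := (ht.isBigO_one ℝ)
  refine summable_of_isBigO_nat (hp s hs0.le hs2) ?_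
  have h2 := hb.mul (isBigO_refl (fun n => ‖p n‖ * s ^ n) atTop)
  simp only [one_mul] at h2
  refine h2.congr_left fun n => ?_
  rw [norm_mul, Complex.norm_natCast, div_pow]
  field_simp

theorem ConvBelow.delay {R : ℝ} {p : ℕ → ℂ} (hp : ConvBelow R p) :
    ConvBelow R (delay p) := fun r h0 h1 => by
  refine (summable_nat_add_iff 1).1 (((hp r h0 h1).mul_right r).congr fun n => ?_)
  simp [ZeroBalanced.delay, pow_succ, mul_assoc]

theorem ConvBelow.tail {R : ℝ} {p : ℕ → ℂ} (hp : ConvBelow R p) :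
    ConvBelow R fun n => p (n + 1) := fun r h0 h1 => by
  rcases h0.eq_or_lt with rfl | h0
  · refine summable_of_ne_finset_zero (s := {0}) fun n hn => ?_
    simp only [mem_singleton] at hn
    simp [hn]
  · have := ((summable_nat_add_iff 1).2 (hp r h0.le h1)).mul_right r⁻¹
    refine this.congr fun n => ?_
    rw [pow_succ]
    field_simp

theorem convBelow_of_isBigO {R : ℝ} {p q : ℕ → ℂ} (hp : ConvBelow R p) (h : q =O[atTop] p) :
    ConvBelow R q := fun r h0 h1 => by
  refine summable_of_isBigO_nat (hp r h0 h1) ?_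
  exact (h.norm_left.norm_right).mul (isBigO_refl _ _)

theorem convBelow_one_of_isBigO {q : ℕ → ℂ} {θ : ℝ} (h : q =O[atTop] fun n : ℕ => (n : ℝ) ^ θ) :
    ConvBelow 1 q := by
  have h1 : ∀ k : ℕ, ConvBelow 1 fun n => (n : ℂ) ^ k := by
    intro k r h0 h1
    have := summable_pow_mul_geometric_of_norm_lt_one k (r := r)
      (by rwa [Real.norm_of_nonneg h0])
    simpa using this
  obtain ⟨k, hk⟩ := exists_nat_ge θ
  refine convBelow_of_isBigO (h1 k) ((h.trans (rpow_isBigO_of_le hk)).trans ?_)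
  refine IsBigO.of_bound 1 (Eventually.of_forall fun n => ?_)
  simp

theorem ConvBelow.summable {R : ℝ} {p : ℕ → ℂ} (hp : ConvBelow R p) {w : ℂ} (hw : ‖w‖ < R) :
    Summable fun n => p n * w ^ n := by
  refine Summable.of_norm ?_
  simpa using hp ‖w‖ (norm_nonneg w) hw

theorem ConvBelow.hasSum {R : ℝ} {p : ℕ → ℂ} (hp : ConvBelow R p) {w : ℂ} (hw : ‖w‖ < R) :
    HasSum (fun n => p n * w ^ n) (powSum p w) := (hp.summable hw).hasSum

theorem powSum_add {R : ℝ} {p q : ℕ → ℂ} (hp : ConvBelow R p) (hq : ConvBelow R q) {w : ℂ}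
    (hw : ‖w‖ < R) : powSum (fun n => p n + q n) w = powSum p w + powSum q w := by
  refine HasSum.tsum_eq ?_
  simpa only [add_mul] using (hp.hasSum hw).add (hq.hasSum hw)

theorem powSum_sub {R : ℝ} {p q : ℕ → ℂ} (hp : ConvBelow R p) (hq : ConvBelow R q) {w : ℂ}
    (hw : ‖w‖ < R) : powSum (fun n => p n - q n) w = powSum p w - powSum q w := by
  refine HasSum.tsum_eq ?_
  simpa only [sub_mul] using (hp.hasSum hw).sub (hq.hasSum hw)

theorem powSum_const_mul (c : ℂ) (p : ℕ → ℂ) (w : ℂ) :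
    powSum (fun n => c * p n) w = c * powSum p w := by
  simp only [powSum, mul_assoc, tsum_mul_left]

theorem powSum_eq_zero_add {R : ℝ} {p : ℕ → ℂ} (hp : ConvBelow R p) {w : ℂ} (hw : ‖w‖ < R) :
    powSum p w = p 0 + w * powSum (fun n => p (n + 1)) w := by
  rw [powSum, (hp.summable hw).tsum_eq_zero_add, powSum, ← tsum_mul_left]
  simp only [pow_zero, mul_one, pow_succ]
  congr 2
  funext n
  ring

theorem powSum_delay {R : ℝ} {p : ℕ → ℂ} (hp : ConvBelow R p) {w : ℂ} (hw : ‖w‖ < R) :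
    powSum (delay p) w = w * powSum p w := by
  rw [powSum_eq_zero_add hp.delay hw]
  simp [delay]

theorem hasDerivAt_powSum {R : ℝ} {p : ℕ → ℂ} (hp : ConvBelow R p) {w : ℂ} (hw : ‖w‖ < R) :
    HasDerivAt (powSum p) (powSum (fun n => ((n + 1 : ℕ) : ℂ) * p (n + 1)) w) w := by
  obtain ⟨r, hr1, hr2⟩ := exists_between hw
  have hr0 : 0 ≤ r := (norm_nonneg w).trans hr1.le
  have hu := hp.natCast_mul.tail r hr0 hr2
  have hu' : Summable fun n => ‖p n‖ * (n * r ^ (n - 1)) := by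
    refine (summable_nat_add_iff 1).1 (hu.congr fun n => ?_)
    rw [norm_mul, Complex.norm_natCast, Nat.add_sub_cancel]
    ring
  have h := hasDerivAt_tsum_of_isPreconnected (g := fun n z => p n * z ^ n)
    (g' := fun n z => p n * (n * z ^ (n - 1))) hu' Metric.isOpen_ball
    (convex_ball (0 : ℂ) r).isPreconnected (fun n z _ => (hasDerivAt_pow n z).const_mul (p n))
    (fun n z hz => ?_) (y₀ := w) (by simpa using hr1) (hp.summable hw) (y := w)
    (by simpa using hr1)
  · refine h.congr_deriv ?_
    have hs : Summable fun n : ℕ => p n * (n * w ^ (n - 1)) := by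
      refine Summable.of_norm_bounded hu' fun n => ?_
      rw [norm_mul, norm_mul, norm_pow, Complex.norm_natCast]
      gcongr
    rw [hs.tsum_eq_zero_add, powSum]
    simp only [Nat.cast_zero, zero_mul, mul_zero, zero_add, Nat.add_sub_cancel]
    congr 1
    funext n
    ring
  · rw [norm_mul, norm_mul, norm_pow, Complex.norm_natCast]
    have : ‖z‖ ≤ r := by
      rw [mem_ball_zero_iff] at hz
      exact hz.le
    gcongr

theorem continuousAt_powSum {R : ℝ} {p : ℕ → ℂ} (hp : ConvBelow R p) {w : ℂ} (hw : ‖w‖ < R) :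
    ContinuousAt (powSum p) w := (hasDerivAt_powSum hp hw).continuousAt

theorem powSum_zero (p : ℕ → ℂ) : powSum p 0 = p 0 := by
  rw [powSum, tsum_eq_single 0]
  · simp
  · intro n hn
    simp [hn]

theorem powSum_natCast_mul {R : ℝ} {p : ℕ → ℂ} (hp : ConvBelow R p) {w : ℂ} (hw : ‖w‖ < R) :
    powSum (fun n => (n : ℂ) * p n) w =
      w * powSum (fun n => ((n + 1 : ℕ) : ℂ) * p (n + 1)) w := by
  rw [powSum_eq_zero_add hp.natCast_mul hw]
  simp

/-- Pairs of sequences, standing for the formal sums `∑ (p_n - q_n log w) w ^ n`. -/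
abbrev LogSeq := (ℕ → ℂ) × (ℕ → ℂ)

/-! ### Operations on power series with a logarithm, and uniqueness of their coefficients. -/

namespace LogSeq

/-- Both power series converge in the disc of radius `R`. -/
def Conv (R : ℝ) (y : LogSeq) : Prop := ConvBelow R y.1 ∧ ConvBelow R y.2

/-- The value at `z = 1 - w`. -/
noncomputable def val (y : LogSeq) (z : ℂ) : ℂ :=
  powSum y.1 (1 - z) - Complex.log (1 - z) * powSum y.2 (1 - z)

/-- Multiplication by `w`. -/
def mulW (y : LogSeq) : LogSeq := (delay y.1, delay y.2)

/-- The action of `w d/dw`. -/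
def euler (y : LogSeq) : LogSeq := (fun n => n * y.1 n - y.2 n, fun n => n * y.2 n)

variable {R : ℝ} {y x : LogSeq} {z : ℂ}

theorem Conv.mulW (h : Conv R y) : Conv R (mulW y) := ⟨h.1.delay, h.2.delay⟩

theorem Conv.euler (h : Conv R y) : Conv R (euler y) := ⟨h.1.natCast_mul.sub h.2, h.2.natCast_mul⟩

theorem Conv.add (h : Conv R y) (h' : Conv R x) : Conv R (y + x) := ⟨h.1.add h'.1, h.2.add h'.2⟩

theorem Conv.sub (h : Conv R y) (h' : Conv R x) : Conv R (y - x) := ⟨h.1.sub h'.1, h.2.sub h'.2⟩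

theorem Conv.smul (h : Conv R y) (c : ℂ) : Conv R (c • y) := ⟨h.1.const_mul c, h.2.const_mul c⟩

theorem conv_zero : Conv R 0 := by
  constructor <;> intro r _ _ <;> simp

theorem Conv.sum {ι : Type*} {s : Finset ι} {f : ι → LogSeq} (h : ∀ i ∈ s, Conv R (f i)) :
    Conv R (∑ i ∈ s, f i) := by
  classical
  induction s using Finset.induction_on with
  | empty => simpa using conv_zero
  | insert i s hi ih =>
    rw [sum_insert hi]
    exact (h i (by simp)).add (ih fun j hj => h j (by simp [hj]))

theorem val_add (h : Conv R y) (h' : Conv R x) (hz : ‖1 - z‖ < R) :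
    val (y + x) z = val y z + val x z := by
  have h1 := powSum_add h.1 h'.1 hz
  have h2 := powSum_add h.2 h'.2 hz
  simp only [val]
  erw [h1, h2]
  ring

theorem val_sub (h : Conv R y) (h' : Conv R x) (hz : ‖1 - z‖ < R) :
    val (y - x) z = val y z - val x z := by
  have h1 := powSum_sub h.1 h'.1 hz
  have h2 := powSum_sub h.2 h'.2 hz
  simp only [val]
  erw [h1, h2]
  ring

theorem val_smul (c : ℂ) (y : LogSeq) (z : ℂ) : val (c • y) z = c * val y z := by
  have h1 := powSum_const_mul c y.1 (1 - z)
  have h2 := powSum_const_mul c y.2 (1 - z)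
  simp only [val]
  erw [h1, h2]
  ring

theorem val_zero (z : ℂ) : val 0 z = 0 := by
  simp [val, powSum]

theorem val_sum {ι : Type*} {s : Finset ι} {f : ι → LogSeq} (h : ∀ i ∈ s, Conv R (f i))
    (hz : ‖1 - z‖ < R) : val (∑ i ∈ s, f i) z = ∑ i ∈ s, val (f i) z := by
  classical
  induction s using Finset.induction_on with
  | empty => simp [val_zero]
  | insert i s hi ih =>
    rw [sum_insert hi, sum_insert hi, val_add (h i (by simp))
      (Conv.sum fun j hj => h j (by simp [hj])) hz, ih fun j hj => h j (by simp [hj])]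

theorem val_mulW (h : Conv R y) (hz : ‖1 - z‖ < R) : val (mulW y) z = (1 - z) * val y z := by
  simp only [val, mulW, powSum_delay h.1 hz, powSum_delay h.2 hz]
  ring

theorem conv_iterate_mulW (h : Conv R y) (n : ℕ) : Conv R (LogSeq.mulW^[n] y) := by
  induction n with
  | zero => exact h
  | succ n ih =>
    rw [Function.iterate_succ_apply']
    exact ih.mulW

theorem val_iterate_mulW (h : Conv R y) (hz : ‖1 - z‖ < R) (n : ℕ) :
    val (LogSeq.mulW^[n] y) z = (1 - z) ^ n * val y z := by
  induction n with
  | zero => simp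
  | succ n ih =>
    rw [Function.iterate_succ_apply', val_mulW (conv_iterate_mulW h n) hz, ih, pow_succ]
    ring

/-- With `w = 1 - z` one has `d/dz = -(1/w) (w d/dw)`. -/
theorem hasDerivAt_val (h : Conv R y) (hz : ‖1 - z‖ < R) (hs : 1 - z ∈ Complex.slitPlane) :
    HasDerivAt (val y) (-(val (euler y) z / (1 - z))) z := by
  have hw : HasDerivAt (fun z : ℂ => 1 - z) (-1) z := by
    simpa using (hasDerivAt_id z).const_sub 1
  have h1 := (hasDerivAt_powSum h.1 hz).comp z hw
  have h2 := (hasDerivAt_powSum h.2 hz).comp z hw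
  have h3 := (Complex.hasDerivAt_log hs).comp z hw
  have h0 : 1 - z ≠ 0 := Complex.slitPlane_ne_zero hs
  refine (h1.sub (h3.mul h2)).congr_deriv ?_
  simp only [val, euler, Function.comp_def]
  rw [powSum_sub h.1.natCast_mul h.2 hz, powSum_natCast_mul h.1 hz, powSum_natCast_mul h.2 hz]
  field_simp
  ring

theorem val_eq_zero_add (h : Conv R y) (hz : ‖1 - z‖ < R) :
    val y z = y.1 0 - Complex.log (1 - z) * y.2 0 +
      (1 - z) * val (fun n => y.1 (n + 1), fun n => y.2 (n + 1)) z := by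
  simp only [val]
  rw [powSum_eq_zero_add h.1 hz, powSum_eq_zero_add h.2 hz]
  ring

theorem tendsto_ofReal_log :
    Tendsto (fun t : ℝ => ‖Complex.log t‖) (𝓝[>] 0) atTop := by
  have h := tendsto_abs_atBot_atTop.comp Real.tendsto_log_nhdsGT_zero
  refine h.congr' ?_
  filter_upwards [self_mem_nhdsWithin] with t ht
  rw [← Complex.ofReal_log (le_of_lt ht), Complex.norm_real, Function.comp_apply, Real.norm_eq_abs]

theorem tendsto_ofReal_mul_log :
    Tendsto (fun t : ℝ => (t : ℂ) * Complex.log t) (𝓝[>] 0) (𝓝 0) := by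
  have h := tendsto_log_mul_rpow_nhdsGT_zero one_pos
  have h1 := (Complex.continuous_ofReal.tendsto 0).comp h
  rw [Complex.ofReal_zero] at h1
  refine h1.congr' ?_
  filter_upwards [self_mem_nhdsWithin] with t ht
  rw [Function.comp_apply, Complex.ofReal_mul, Complex.ofReal_log (le_of_lt ht), Real.rpow_one,
    mul_comm]

theorem tendsto_powSum_ofReal {p : ℕ → ℂ} (hR : 0 < R) (h : ConvBelow R p) :
    Tendsto (fun t : ℝ => powSum p t) (𝓝[>] 0) (𝓝 (p 0)) := by
  have h1 : Tendsto (fun t : ℝ => (t : ℂ)) (𝓝[>] 0) (𝓝 0) :=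
    (Complex.continuous_ofReal.tendsto' 0 0 (by simp)).mono_left nhdsWithin_le_nhds
  have h2 := (continuousAt_powSum h (w := 0) (by simpa using hR)).tendsto
  rw [powSum_zero] at h2
  exact h2.comp h1

theorem eventually_norm_ofReal_lt (hR : 0 < R) : ∀ᶠ t : ℝ in 𝓝[>] 0, ‖(t : ℂ)‖ < R := by
  filter_upwards [Ioo_mem_nhdsGT hR] with t ht
  rw [Complex.norm_real, Real.norm_of_nonneg ht.1.le]
  exact ht.2

/-- Dividing by `log t` and letting `t → 0+` kills the logarithmic constant; then the logarithmic
part is `t log t` times a bounded function, so the other constant vanishes too. Dividing by `t` and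
repeating gives all coefficients. -/
theorem coeff_zero_of_val_eq_zero (hR : 0 < R) (h : Conv R y)
    (hv : ∀ᶠ t : ℝ in 𝓝[>] 0, val y (1 - t) = 0) : y.1 0 = 0 ∧ y.2 0 = 0 := by
  have hv' : ∀ᶠ t : ℝ in 𝓝[>] 0, powSum y.1 t = Complex.log t * powSum y.2 t := by
    filter_upwards [hv] with t ht
    rw [val, sub_sub_cancel] at ht
    exact sub_eq_zero.1 ht
  have hp := tendsto_powSum_ofReal hR h.1
  have hq := tendsto_powSum_ofReal hR h.2
  have h2 : y.2 0 = 0 := by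
    have h3 : Tendsto (fun t : ℝ => powSum y.1 t * (Complex.log t)⁻¹) (𝓝[>] 0) (𝓝 (y.1 0 * 0)) := by
      refine hp.mul ?_
      rw [tendsto_zero_iff_norm_tendsto_zero]
      simp only [norm_inv]
      exact tendsto_ofReal_log.inv_tendsto_atTop
    rw [mul_zero] at h3
    refine tendsto_nhds_unique (hq.congr' ?_) h3
    filter_upwards [hv', tendsto_ofReal_log.eventually_gt_atTop 0] with t ht h0
    rw [ht, mul_comm, ← mul_assoc, inv_mul_cancel₀ (norm_pos_iff.1 h0), one_mul]
  refine ⟨?_, h2⟩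
  have h3 := tendsto_ofReal_mul_log.mul (tendsto_powSum_ofReal hR h.2.tail)
  rw [zero_mul] at h3
  refine tendsto_nhds_unique (hp.congr' ?_) h3
  filter_upwards [hv', eventually_norm_ofReal_lt hR] with t ht htR
  rw [ht, powSum_eq_zero_add h.2 htR, h2]
  ring

theorem eq_zero_of_val_eq_zero (hR : 0 < R) (h : Conv R y)
    (hv : ∀ᶠ t : ℝ in 𝓝[>] 0, val y (1 - t) = 0) : y = 0 := by
  have key : ∀ (n : ℕ) (y : LogSeq), Conv R y → (∀ᶠ t : ℝ in 𝓝[>] 0, val y (1 - t) = 0) →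
      y.1 n = 0 ∧ y.2 n = 0 := by
    intro n
    induction n with
    | zero => exact fun y h hv => coeff_zero_of_val_eq_zero hR h hv
    | succ n ih =>
      intro y h hv
      refine ih (fun n => y.1 (n + 1), fun n => y.2 (n + 1)) ⟨h.1.tail, h.2.tail⟩ ?_
      obtain ⟨h1, h2⟩ := coeff_zero_of_val_eq_zero hR h hv
      filter_upwards [hv, eventually_norm_ofReal_lt hR, self_mem_nhdsWithin] with t ht htR ht0
      rw [val_eq_zero_add h (by simpa using htR), h1, h2, sub_sub_cancel] at ht
      have : (t : ℂ) ≠ 0 := by exact_mod_cast (ne_of_gt ht0)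
      simpa [this] using ht
  ext n
  · exact (key n y h hv).1
  · exact (key n y h hv).2

end LogSeq

/-- The successive ratios are at most `(n+1)/(n+1-C)` for large `n`, which tends to `1`; the ratio
test with some `s` between `r` and `1` applies once `(s-r) n > s C`. -/
theorem summable_of_quasi_monotone {M : ℕ → ℝ} {C : ℝ} (h0 : ∀ n, 0 ≤ M n)
    (h : ∀ n : ℕ, ((n : ℝ) + 1 - C) * M (n + 1) ≤ (n + 1) * M n) {r : ℝ} (hr0 : 0 ≤ r) (hr : r < 1) :
    Summable fun n => M n * r ^ n := by
  obtain ⟨s, hs1, hs2⟩ := exists_between hr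
  have hs0 : 0 < s := hr0.trans_lt hs1
  obtain ⟨N, hN⟩ := exists_nat_gt (s * C / (s - r))
  refine summable_of_ratio_norm_eventually_le hs2 ?_
  filter_upwards [eventually_ge_atTop N] with n hn
  have hn' : (N : ℝ) ≤ n := by exact_mod_cast hn
  rw [Real.norm_of_nonneg (mul_nonneg (h0 _) (by positivity)),
    Real.norm_of_nonneg (mul_nonneg (h0 _) (by positivity)), pow_succ]
  have h1 : s * C < (s - r) * n := by
    rw [div_lt_iff₀ (by linarith)] at hN
    nlinarith
  have hn0 : (0 : ℝ) ≤ n := Nat.cast_nonneg n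
  have h2 : r * (n + 1) ≤ s * (n + 1 - C) := by nlinarith
  have h3 : M (n + 1) * r ≤ s * M n := by
    rcases hr0.eq_or_lt with rfl | hr0
    · rw [mul_zero]
      exact mul_nonneg hs0.le (h0 n)
    · have h4 := mul_le_mul_of_nonneg_left (h n) hs0.le
      have h5 := mul_le_mul_of_nonneg_right h2 (h0 (n + 1))
      have h6 : r * M (n + 1) * (n + 1) ≤ s * M n * (n + 1) := by nlinarith
      have := le_of_mul_le_mul_right h6 (by positivity)
      linarith
  have h4 := mul_le_mul_of_nonneg_right h3 (pow_nonneg hr0 n)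
  linarith

theorem HasSum.congr_of_eq {f g : ℕ → ℂ} {s t : ℂ} (h : HasSum f s) (hf : ∀ n, g n = f n)
    (ht : t = s) : HasSum g t := by
  rw [ht, funext hf]
  exact h

/-! ### The constant in the zero-balanced Gauss function -/

/-- `Γ(a+n) Γ(b+n) / (n! Γ(a+b+n+k))`. -/
noncomputable def gaussCoeff (a b : ℂ) (k n : ℕ) : ℂ :=
  Complex.Gamma (a + n) * Complex.Gamma (b + n) / ((n ! : ℂ) * Complex.Gamma (a + b + n + k))

theorem isBigO_gaussCoeff (a b : ℂ) (k : ℕ) :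
    gaussCoeff a b k =O[atTop] fun n : ℕ => (n : ℝ) ^ (-1 - (k : ℝ)) := by
  have h1 : (fun n : ℕ => ((n ! : ℂ))⁻¹) =O[atTop] fun n : ℕ => ((n ! : ℝ))⁻¹ :=
    IsBigO.of_bound 1 (by simp)
  have h := (((isTheta_Gamma a).1.mul (isTheta_Gamma b).1).mul h1).mul
    (isTheta_Gamma (a + b + k)).inv.1
  refine IsBigO.trans (EventuallyEq.isBigO ?_) (h.trans (EventuallyEq.isBigO ?_))
  · refine Eventually.of_forall fun n => ?_
    simp only [gaussCoeff]
    rw [show a + b + n + k = a + b + k + (n : ℂ) by ring, div_eq_mul_inv, mul_inv]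
    ring
  · filter_upwards [eventually_gt_atTop 0] with m hm
    have hm' : (0 : ℝ) < m := by exact_mod_cast hm
    have : (m ! : ℝ) ≠ 0 := by exact_mod_cast m.factorial_ne_zero
    have e : -1 - (k : ℝ) = (a.re - 1) + (b.re - 1) + -((a + b + k).re - 1) := by simp; ring
    rw [e, Real.rpow_add hm', Real.rpow_add hm', Real.rpow_neg hm'.le]
    field_simp

theorem convBelow_gaussCoeff (a b : ℂ) (k : ℕ) : ConvBelow 1 (gaussCoeff a b k) :=
  convBelow_one_of_isBigO (isBigO_gaussCoeff a b k)

theorem not_pole_one (m : ℕ) : (1 : ℂ) ≠ -(m : ℂ) := by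
  intro h
  have := congrArg Complex.re h
  simp at this
  linarith [(Nat.cast_nonneg m : (0 : ℝ) ≤ m)]

theorem not_pole_add_nat {a : ℂ} (ha : ∀ m : ℕ, a ≠ -(m : ℂ)) (n m : ℕ) : a + n ≠ -(m : ℂ) := by
  intro h
  refine ha (n + m) ?_
  push_cast
  linear_combination h

theorem not_pole_succ {a : ℂ} (ha : ∀ m : ℕ, a ≠ -(m : ℂ)) (m : ℕ) : a + 1 ≠ -(m : ℂ) := by
  simpa using not_pole_add_nat ha 1 m

theorem add_nat_ne_zero {a : ℂ} (ha : ∀ m : ℕ, a ≠ -(m : ℂ)) (n : ℕ) : a + n ≠ 0 := by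
  simpa using not_pole_add_nat ha n 0

theorem gaussCoeff_one_right {a : ℂ} (ha : ∀ m : ℕ, a ≠ -(m : ℂ)) (n : ℕ) :
    gaussCoeff a 1 0 n = 1 / (a + n) := by
  have h1 := add_nat_ne_zero ha n
  have h2 := Complex.Gamma_ne_zero (not_pole_add_nat ha n)
  have h3 : Complex.Gamma (1 + n) = (n ! : ℂ) := by
    rw [add_comm, Complex.Gamma_nat_eq_factorial]
  have h4 := factorial_ne_zero' n
  rw [gaussCoeff, h3, show a + 1 + n + (0 : ℕ) = a + n + 1 by push_cast; ring,
    Complex.Gamma_add_one _ h1]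
  field_simp

/-- The increments are summed beyond `k`, where `∑ 1/i² ≤ 1/k`. -/
theorem norm_tendsto_sub_le {f : ℕ → ℂ} {L : ℂ} {C : ℝ} (hf : Tendsto f atTop (𝓝 L)) {k : ℕ}
    (hk : k ≠ 0) (hC : 0 ≤ C)
    (h : ∀ n, k ≤ n → ‖f (n + 1) - f n‖ ≤ C * (((n + 1 : ℕ) : ℝ) ^ 2)⁻¹) :
    ‖f k - L‖ ≤ C * (k : ℝ)⁻¹ := by
  have h1 : ∀ N, k ≤ N → ‖f k - f N‖ ≤ C * (k : ℝ)⁻¹ := by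
    intro N hN
    have h2 : ‖f N - f k‖ ≤ C * ∑ i ∈ Ioc k N, ((i : ℝ) ^ 2)⁻¹ := by
      induction N, hN using Nat.le_induction with
      | base => simp
      | succ N hN ih =>
        rw [← Order.succ_eq_add_one N, ← Finset.insert_Ioc_right_eq_Ioc_succ hN, sum_insert (by simp),
          mul_add, Order.succ_eq_add_one]
        calc ‖f (N + 1) - f k‖ = ‖(f (N + 1) - f N) + (f N - f k)‖ := by ring_nf
          _ ≤ _ := (norm_add_le _ _).trans (add_le_add (h N hN) ih)
    rw [norm_sub_rev]
    refine h2.trans ?_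
    gcongr
    refine (sum_Ioc_inv_sq_le_sub hk hN).trans ?_
    have : (0 : ℝ) ≤ (N : ℝ)⁻¹ := by positivity
    linarith
  refine le_of_tendsto (tendsto_const_nhds.sub hf).norm ?_
  filter_upwards [eventually_ge_atTop k] with N hN using h1 N hN

/-- Both coefficients are `1/n` to leading order. The product `(a+n) gaussCoeff a b 0 n` tends to
`1` with increments `O(n⁻²)`, so it is `1 + O(1/n)`; division by `a + n` gives the claim. -/
theorem isBigO_gaussCoeff_sub {a b : ℂ} (ha : ∀ m : ℕ, a ≠ -(m : ℂ)) (hb : ∀ m : ℕ, b ≠ -(m : ℂ)) :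
    (fun n => gaussCoeff a b 0 n - gaussCoeff a 1 0 n) =O[atTop] fun n : ℕ => (n : ℝ) ^ (-2 : ℝ) := by
  set f : ℕ → ℂ := fun n => (a + n) * gaussCoeff a b 0 n with hf
  have hlim : Tendsto f atTop (𝓝 1) := by
    have h := (((tendsto_Gamma_div (a + 1)).mul (tendsto_Gamma_div b)).div
      (tendsto_Gamma_div (a + b)) one_ne_zero)
    simp only [mul_one, div_one] at h
    refine h.congr' ?_
    filter_upwards [eventually_ne_atTop 0] with N hN
    have hN' : (N : ℂ) ≠ 0 := by exact_mod_cast hN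
    have h0 : ∀ s : ℂ, (N : ℂ) ^ s ≠ 0 := fun s => by simp [Complex.cpow_eq_zero_iff, hN']
    have h1 := h0 (a + 1 - 1)
    have h2 := h0 (b - 1)
    have e : (N : ℂ) ^ (a + b - 1) = (N : ℂ) ^ (a + 1 - 1) * (N : ℂ) ^ (b - 1) := by
      rw [← Complex.cpow_add _ _ hN']
      congr 1
      ring
    have h5 := factorial_ne_zero' N
    simp only [Pi.div_apply, hf, gaussCoeff]
    rw [e, show a + 1 + (N : ℂ) = a + N + 1 by ring, Complex.Gamma_add_one _ (add_nat_ne_zero ha N)]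
    push_cast
    rw [add_zero, div_mul_div_comm, div_div_eq_mul_div,
      show (N ! : ℂ) * (N : ℂ) ^ (a + 1 - 1) * ((N ! : ℂ) * (N : ℂ) ^ (b - 1)) =
        (N ! : ℂ) * ((N ! : ℂ) * ((N : ℂ) ^ (a + 1 - 1) * (N : ℂ) ^ (b - 1))) by ring]
    generalize hK : (N ! : ℂ) * ((N : ℂ) ^ (a + 1 - 1) * (N : ℂ) ^ (b - 1)) = K
    have hK0 : K ≠ 0 := by
      rw [← hK]
      exact mul_ne_zero h5 (mul_ne_zero h1 h2)
    field_simp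
  have hb1 : f =O[atTop] fun _ : ℕ => (1 : ℝ) := hlim.isBigO_one ℝ
  have hdiff : (fun n => f (n + 1) - f n) =O[atTop] fun n : ℕ => (n : ℝ) ^ (-2 : ℝ) := by
    have h1 : (fun n : ℕ => (1 + (n : ℂ))⁻¹) =O[atTop] fun n : ℕ => (n : ℝ) ^ (-1 : ℝ) := by
      refine IsBigO.of_bound 1 ?_
      filter_upwards [eventually_gt_atTop 0] with k hk
      have hk' : (0 : ℝ) < k := by exact_mod_cast hk
      rw [norm_inv, one_mul, Real.rpow_neg_one, norm_inv, Real.norm_natCast,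
        show 1 + (k : ℂ) = ((k + 1 : ℕ) : ℂ) by push_cast; ring, Complex.norm_natCast]
      push_cast
      gcongr
      linarith
    have h2 : (fun n : ℕ => (a + b + (n : ℂ))⁻¹) =O[atTop] fun n : ℕ => (n : ℝ) ^ (-1 : ℝ) := by
      have := (isTheta_Gamma_div (a + b) (a + b + 1)).1
      rw [show (a + b - (a + b + 1)).re = -1 by simp] at this
      refine IsBigO.congr' this ?_ EventuallyEq.rfl
      filter_upwards [eventually_not_pole (a + b)] with n hn
      have hn0 : a + b + n ≠ 0 := by simpa using hn 0
      have hG := Complex.Gamma_ne_zero hn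
      rw [show a + b + 1 + (n : ℂ) = a + b + n + 1 by ring, Complex.Gamma_add_one _ hn0]
      field_simp
    -- The increment is exactly `(ab - a) f n / ((1+n)(a+b+n))`.
    have h3 := (hb1.const_mul_left (a * b - a)).mul (h1.mul h2)
    refine IsBigO.trans (EventuallyEq.isBigO ?_) (h3.trans (EventuallyEq.isBigO ?_))
    · filter_upwards [eventually_not_pole (a + b)] with n hn
      have hn0 : a + b + n ≠ 0 := by simpa using hn 0
      have hG := Complex.Gamma_ne_zero hn
      have ha0 := add_nat_ne_zero ha n
      have hb0 := add_nat_ne_zero hb n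
      have hn1 : 1 + (n : ℂ) ≠ 0 := add_nat_ne_zero not_pole_one n
      have h5 := factorial_ne_zero' n
      simp only [hf, gaussCoeff, Nat.factorial_succ]
      push_cast
      rw [show a + ((n : ℂ) + 1) = a + n + 1 by ring, show b + ((n : ℂ) + 1) = b + n + 1 by ring,
        show a + b + ((n : ℂ) + 1) + 0 = a + b + n + 1 by ring, add_zero, Complex.Gamma_add_one _ ha0,
        Complex.Gamma_add_one _ hb0, Complex.Gamma_add_one _ hn0]
      rw [add_comm (n : ℂ) 1]
      field_simp
      ring
    · filter_upwards [eventually_gt_atTop 0] with k hk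
      rw [← Real.rpow_add (by exact_mod_cast hk)]
      norm_num
  obtain ⟨C, hC0, hC⟩ := isBigO_rpow_iff.1 hdiff
  have h1 : (fun n => f n - 1) =O[atTop] fun n : ℕ => (n : ℝ) ^ (-1 : ℝ) := by
    refine IsBigO.of_bound C ?_
    filter_upwards [eventually_ne_atTop 0] with k hk
    rw [Real.rpow_neg_one, norm_inv, Real.norm_natCast]
    refine norm_tendsto_sub_le hlim hk hC0 fun n _ => (hC n).trans_eq ?_
    rw [Real.rpow_neg (by positivity)]
    push_cast
    norm_num
  have h2 : (fun n : ℕ => (a + (n : ℂ))⁻¹) =O[atTop] fun n : ℕ => (n : ℝ) ^ (-1 : ℝ) := by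
    have := isBigO_gaussCoeff a 1 0
    simpa [funext (gaussCoeff_one_right ha)] using this
  refine IsBigO.trans (EventuallyEq.isBigO ?_) ((h2.mul h1).trans (EventuallyEq.isBigO ?_))
  · refine Eventually.of_forall fun n => ?_
    have ha0 := add_nat_ne_zero ha n
    simp only [hf, gaussCoeff_one_right ha]
    field_simp
  · filter_upwards [eventually_gt_atTop 0] with k hk
    rw [← Real.rpow_add (by exact_mod_cast hk)]
    norm_num

/-- Factors with `Re(a+j) > 1` have modulus at most `1`, since subtracting `s` from `a + j` then
decreases the modulus; the finitely many others are bounded by `1 + 1/|a+j|`. The bound is uniform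
in `s`, as dominated convergence for `s → 0` requires. -/
theorem norm_poch_sub_div_le {a : ℂ} (ha : ∀ m : ℕ, a ≠ -(m : ℂ)) :
    ∃ C : ℝ, ∀ s : ℝ, 0 < s → s < 1 → ∀ n, ‖poch (a - s) n / poch a n‖ ≤ C := by
  obtain ⟨j₀, hj₀⟩ := exists_nat_gt (1 - a.re)
  set c : ℕ → ℝ := fun j => if j < j₀ then 1 + 1 / ‖a + j‖ else 1 with hc
  have hc1 : ∀ j, 1 ≤ c j := by
    intro j
    simp only [hc]
    split_ifs
    · have : 0 ≤ 1 / ‖a + j‖ := by positivity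
      linarith
    · exact le_rfl
  have hmono : Monotone fun n => ∏ j ∈ range n, c j := by
    refine monotone_nat_of_le_succ fun n => ?_
    rw [prod_range_succ]
    exact le_mul_of_one_le_right (prod_nonneg fun j _ => zero_le_one.trans (hc1 j)) (hc1 n)
  have hstab : ∀ n, j₀ ≤ n → ∏ j ∈ range n, c j = ∏ j ∈ range j₀, c j := by
    intro n hn
    induction n, hn using Nat.le_induction with
    | base => rfl
    | succ n hn ih =>
      rw [prod_range_succ, ih]
      simp [hc, not_lt.2 hn]
  refine ⟨∏ j ∈ range j₀, c j, fun s hs0 hs1 n => ?_⟩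
  refine le_trans ?_ ((hmono (le_max_left n j₀)).trans_eq (hstab _ (le_max_right n j₀)))
  induction n with
  | zero => simp [poch_zero]
  | succ n ih =>
    have h0 := add_nat_ne_zero ha n
    have hpos : 0 < ‖a + n‖ := norm_pos_iff.2 h0
    show _ ≤ ∏ j ∈ range (n + 1), c j
    rw [poch_succ, poch_succ, prod_range_succ, mul_div_mul_comm, norm_mul]
    refine mul_le_mul ih ?_ (norm_nonneg _) (prod_nonneg fun j _ => zero_le_one.trans (hc1 j))
    rw [norm_div, div_le_iff₀ hpos]
    simp only [hc]
    split_ifs with hn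
    · rw [add_mul, one_div_mul_cancel hpos.ne', one_mul, show a - s + n = (a + n) - s by ring]
      refine (norm_sub_le _ _).trans ?_
      rw [Complex.norm_real, Real.norm_of_nonneg hs0.le]
      linarith
    · have hn' : (j₀ : ℝ) ≤ n := by exact_mod_cast not_lt.1 hn
      rw [one_mul, ← sq_le_sq₀ (norm_nonneg _) (norm_nonneg _), Complex.sq_norm, Complex.sq_norm,
        Complex.normSq_apply, Complex.normSq_apply]
      simp only [Complex.add_re, Complex.sub_re, Complex.ofReal_re, Complex.natCast_re,
        Complex.add_im, Complex.sub_im, Complex.ofReal_im, Complex.natCast_im]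
      nlinarith

theorem continuous_poch (n : ℕ) : Continuous fun x : ℂ => poch x n := by
  unfold poch
  exact Polynomial.continuous _

/-- Replacing `a` by `a - s` in one numerator gives excess `s > 0`: the divergent zero-balanced
series is regularised and Gauss's theorem sums it. -/
theorem hasSum_poch_mul_gaussCoeff {a b : ℂ} (ha : ∀ m : ℕ, a ≠ -(m : ℂ))
    (hb : ∀ m : ℕ, b ≠ -(m : ℂ)) {s : ℝ} (hs : 0 < s) :
    HasSum (fun n => poch (a - s) n / poch a n * gaussCoeff a b 0 n)
      (Complex.Gamma b * Complex.Gamma s / Complex.Gamma (b + s)) := by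
  have h := (gauss_sum (x := a - s) (y := b) (c := a + b) (by simpa using hs)).mul_left
    (Complex.Gamma a * Complex.Gamma b)
  rw [show a + b - (a - s) - b = s by ring, show a + b - (a - s) = b + s by ring,
    add_sub_cancel_right] at h
  have hGa := Complex.Gamma_ne_zero ha
  refine HasSum.congr_of_eq h (fun n => ?_) ?_
  · have h1 := poch_ne_zero ha n
    simp only [gaussCoeff, gaussTerm]
    rw [← Gamma_mul_poch ha, ← Gamma_mul_poch hb]
    push_cast
    rw [add_zero]
    field_simp
  · field_simp

/-- Since `s Γ(s) → 1`, the limit is the derivative at `0` of `Γ(b)/Γ(b+s) - Γ(1)/Γ(1+s)`, whose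
value at `0` is `0`. -/
theorem tendsto_Gamma_mul_sub {b : ℂ} (hb : ∀ m : ℕ, b ≠ -(m : ℂ)) :
    Tendsto (fun s : ℝ => Complex.Gamma b * Complex.Gamma s / Complex.Gamma (b + s)
      - Complex.Gamma 1 * Complex.Gamma s / Complex.Gamma (1 + s)) (𝓝[>] 0)
      (𝓝 (Complex.digamma 1 - Complex.digamma b)) := by
  have hinv : ∀ {c : ℂ}, (∀ m : ℕ, c ≠ -(m : ℂ)) →
      HasDerivAt (fun s : ℂ => Complex.Gamma c / Complex.Gamma (c + s)) (-Complex.digamma c) 0 := by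
    intro c hc
    have hG := Complex.Gamma_ne_zero hc
    have h1 : HasDerivAt (fun s : ℂ => Complex.Gamma (c + s)) (deriv Complex.Gamma c) 0 := by
      have := (Complex.differentiableAt_Gamma c hc).hasDerivAt
      rw [← add_zero c] at this
      simpa using this.comp_const_add c 0
    have h2 := (hasDerivAt_const (0 : ℂ) (Complex.Gamma c)).div h1 (by simpa using hG)
    refine h2.congr_deriv ?_
    rw [Complex.digamma, logDeriv_apply, add_zero]
    field_simp
    ring
  have hd := (hinv hb).sub (hinv not_pole_one)
  have hsl := hd.tendsto_slope
  have hre : Tendsto (fun s : ℝ => (s : ℂ)) (𝓝[>] 0) (𝓝[≠] 0) := by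
    refine tendsto_nhdsWithin_iff.2 ⟨(Complex.continuous_ofReal.tendsto' 0 0 (by simp)).mono_left
      nhdsWithin_le_nhds, ?_⟩
    filter_upwards [self_mem_nhdsWithin] with s hs
    simpa using (ne_of_gt hs)
  have h1 := hsl.comp hre
  have h2 : Tendsto (fun s : ℝ => Complex.Gamma (s + 1)) (𝓝[>] 0) (𝓝 1) := by
    have hc : ContinuousAt Complex.Gamma (0 + 1) := by
      rw [zero_add]
      exact (Complex.differentiableAt_Gamma 1 not_pole_one).continuousAt
    have h3 : ContinuousAt (fun s : ℂ => Complex.Gamma (s + 1)) 0 :=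
      ContinuousAt.comp (g := Complex.Gamma) (f := fun s : ℂ => s + 1) hc (by fun_prop)
    have := h3.tendsto.comp (hre.mono_right nhdsWithin_le_nhds)
    simpa [Function.comp_def] using this
  have h3 := h2.mul h1
  rw [one_mul, show -Complex.digamma b - -Complex.digamma 1 =
    Complex.digamma 1 - Complex.digamma b by ring] at h3
  refine h3.congr' ?_
  filter_upwards [self_mem_nhdsWithin] with s hs
  have hs0 : (s : ℂ) ≠ 0 := by simpa using (ne_of_gt hs)
  have e : (slope ((fun s : ℂ => Complex.Gamma b / Complex.Gamma (b + s)) -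
      fun s : ℂ => Complex.Gamma 1 / Complex.Gamma (1 + s)) 0 (s : ℂ)) =
      (s : ℂ)⁻¹ * (Complex.Gamma b / Complex.Gamma (b + s) - Complex.Gamma 1 / Complex.Gamma (1 + s)) := by
    rw [slope_def_field]
    simp only [Pi.sub_apply, add_zero]
    rw [div_self (Complex.Gamma_ne_zero hb), div_self (Complex.Gamma_ne_zero not_pole_one)]
    ring
  rw [Function.comp_apply, e, Complex.Gamma_add_one _ hs0]
  field_simp

/-- Both regularised series diverge as `s → 0+`, with the same leading singularity; their difference
is dominated and converges to the unregularised difference. -/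
theorem hasSum_gaussCoeff_sub {a b : ℂ} (ha : ∀ m : ℕ, a ≠ -(m : ℂ)) (hb : ∀ m : ℕ, b ≠ -(m : ℂ)) :
    HasSum (fun n => gaussCoeff a b 0 n - gaussCoeff a 1 0 n)
      (Complex.digamma 1 - Complex.digamma b) := by
  have hsum := summable_of_isBigO_rpow (by norm_num) (isBigO_gaussCoeff_sub ha hb)
  obtain ⟨C, hC⟩ := norm_poch_sub_div_le ha
  have hlim : Tendsto (fun s : ℝ => ∑' n, poch (a - s) n / poch a n *
      (gaussCoeff a b 0 n - gaussCoeff a 1 0 n)) (𝓝[>] 0)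
      (𝓝 (∑' n, (gaussCoeff a b 0 n - gaussCoeff a 1 0 n))) := by
    refine tendsto_tsum_of_dominated_convergence (hsum.mul_left C) (fun n => ?_) ?_
    · have h1 : Tendsto (fun s : ℝ => poch (a - s) n / poch a n) (𝓝[>] 0) (𝓝 1) := by
        have h2 : Continuous fun s : ℝ => poch (a - s) n / poch a n :=
          ((continuous_poch n).comp (continuous_const.sub Complex.continuous_ofReal)).div_const _
        refine (h2.tendsto' 0 1 ?_).mono_left nhdsWithin_le_nhds
        simp [div_self (poch_ne_zero ha n)]
      simpa using h1.mul_const (gaussCoeff a b 0 n - gaussCoeff a 1 0 n)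
    · filter_upwards [Ioo_mem_nhdsGT one_pos] with s hs n
      rw [norm_mul]
      exact mul_le_mul_of_nonneg_right (hC s hs.1 hs.2 n) (norm_nonneg _)
  have h2 := tendsto_nhds_unique (hlim.congr' ?_) (tendsto_Gamma_mul_sub hb)
  · rw [← h2]
    exact hsum.of_norm.hasSum
  · filter_upwards [self_mem_nhdsWithin] with s hs
    have := (hasSum_poch_mul_gaussCoeff ha hb hs).sub (hasSum_poch_mul_gaussCoeff ha not_pole_one hs)
    simp only [← mul_sub] at this
    exact this.tsum_eq

theorem gaussCoeff_comm (a b : ℂ) (k n : ℕ) : gaussCoeff a b k n = gaussCoeff b a k n := by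
  rw [gaussCoeff, gaussCoeff, add_comm a b, mul_comm (Complex.Gamma _)]

/-- The parameters pass from `(a, b)` through `(a, 1)` to `(1, 1)`, changing one at a time. -/
theorem hasSum_gaussCoeff_sub_inv {a b : ℂ} (ha : ∀ m : ℕ, a ≠ -(m : ℂ))
    (hb : ∀ m : ℕ, b ≠ -(m : ℂ)) :
    HasSum (fun n : ℕ => gaussCoeff a b 0 n - 1 / (1 + (n : ℂ)))
      (2 * Complex.digamma 1 - Complex.digamma a - Complex.digamma b) := by
  have h := (hasSum_gaussCoeff_sub ha hb).add (hasSum_gaussCoeff_sub not_pole_one ha)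
  refine HasSum.congr_of_eq h (fun n => ?_) ?_
  · rw [gaussCoeff_comm 1 a, gaussCoeff_one_right not_pole_one]
    ring
  · ring

section

/-! ### The logarithmic expansion of the zero-balanced Gauss function -/

/-- The coefficients of `-log w` in `gaussLog`. -/
noncomputable def gaussLead (a b : ℂ) (k n : ℕ) : ℂ :=
  if n < k then 0
  else (-1) ^ k * (poch a n * poch b n) / (poch a k * poch b k * ((n ! : ℂ) * ((n - k)! : ℂ)))

/-- The sum of digamma values in `gaussLog`. -/
noncomputable def digammaSum (a b : ℂ) (k n : ℕ) : ℂ :=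
  Complex.digamma (1 + n - k) + Complex.digamma (1 + n) - Complex.digamma (a + n)
    - Complex.digamma (b + n)

/-- The expansion at `z = 1` of the function with Taylor coefficients `gaussCoeff a b k`. -/
noncomputable def gaussLog (a b : ℂ) (k : ℕ) : LogSeq :=
  (fun n => if n < k then
      (-1) ^ n * (poch a n * poch b n) * ((k - n - 1)! : ℂ) / ((n ! : ℂ) * (poch a k * poch b k))
    else gaussLead a b k n * digammaSum a b k n, gaussLead a b k)

theorem digamma_add_one_add {c : ℂ} (hc : ∀ m : ℕ, c ≠ -(m : ℂ)) (n : ℕ) :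
    Complex.digamma (c + (n + 1 : ℕ)) = Complex.digamma (c + n) + (c + n)⁻¹ := by
  rw [← Complex.digamma_apply_add_one _ (not_pole_add_nat hc n)]
  push_cast
  ring_nf

/-- A crude bound from the recurrence, whose increments `1/(c+n)` are bounded; any polynomial bound
would do for the radius of convergence. -/
theorem isBigO_digamma {c : ℂ} (hc : ∀ m : ℕ, c ≠ -(m : ℂ)) :
    (fun n : ℕ => Complex.digamma (c + n)) =O[atTop] fun n : ℕ => (n : ℂ) := by
  have h1 : Tendsto (fun n : ℕ => (c + (n : ℂ))⁻¹) atTop (𝓝 0) := by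
    have h2 : Tendsto (fun n : ℕ => ‖c + n‖) atTop atTop := by
      refine tendsto_atTop_mono (f := fun n : ℕ => (n : ℝ) - ‖c‖) (fun n => ?_)
        (tendsto_atTop_add_const_right _ _ tendsto_natCast_atTop_atTop)
      have := norm_sub_le (c + n) c
      rw [add_sub_cancel_left, Complex.norm_natCast] at this
      linarith
    rw [tendsto_zero_iff_norm_tendsto_zero]
    simp only [norm_inv]
    exact h2.inv_tendsto_atTop
  obtain ⟨C, hC⟩ := h1.norm.bddAbove_range
  have hC' : ∀ n : ℕ, ‖(c + (n : ℂ))⁻¹‖ ≤ C := fun n => hC ⟨n, rfl⟩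
  have h3 : ∀ n : ℕ, ‖Complex.digamma (c + n)‖ ≤ ‖Complex.digamma c‖ + n * C := by
    intro n
    induction n with
    | zero => simp
    | succ n ih =>
      rw [digamma_add_one_add hc]
      refine (norm_add_le _ _).trans ?_
      push_cast
      linarith [hC' n]
  refine IsBigO.of_bound (‖Complex.digamma c‖ + C) ?_
  filter_upwards [eventually_ge_atTop 1] with n hn
  have hn' : (1 : ℝ) ≤ n := by exact_mod_cast hn
  rw [Complex.norm_natCast]
  refine (h3 n).trans ?_
  nlinarith [norm_nonneg (Complex.digamma c)]

theorem ConvBelow.mul_digamma {R : ℝ} {p : ℕ → ℂ} (hp : ConvBelow R p) {c : ℂ}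
    (hc : ∀ m : ℕ, c ≠ -(m : ℂ)) : ConvBelow R fun n => p n * Complex.digamma (c + n) := by
  refine convBelow_of_isBigO hp.natCast_mul ?_
  simpa only [mul_comm] using (isBigO_refl p atTop).mul (isBigO_digamma hc)

/-- Multiplication by `n ≥ 1` does not decrease moduli; the second component, once known to
converge, is added back to the first. -/
theorem LogSeq.Conv.of_euler {R : ℝ} {y : LogSeq} (h : LogSeq.Conv R (LogSeq.euler y)) :
    LogSeq.Conv R y := by
  have key : ∀ p : ℕ → ℂ, ConvBelow R (fun n => (n : ℂ) * p n) → ConvBelow R p := by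
    intro p hp
    refine convBelow_of_isBigO hp (IsBigO.of_bound 1 ?_)
    filter_upwards [eventually_ge_atTop 1] with n hn
    have hn' : (1 : ℝ) ≤ n := by exact_mod_cast hn
    rw [norm_mul, Complex.norm_natCast, one_mul]
    exact le_mul_of_one_le_left (norm_nonneg _) hn'
  have h2 := key _ h.2
  refine ⟨key _ ?_, h2⟩
  simpa [LogSeq.euler] using h.1.add h2

variable {a b : ℂ}

theorem gaussLead_zero (a b : ℂ) (n : ℕ) :
    gaussLead a b 0 n = poch a n * poch b n / ((n ! : ℂ) * (n ! : ℂ)) := by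
  simp [gaussLead, poch_zero]

theorem gaussLead_succ (ha : ∀ m : ℕ, a ≠ -(m : ℂ)) (hb : ∀ m : ℕ, b ≠ -(m : ℂ)) (k n : ℕ) :
    ((n : ℂ) + 1) * gaussLead a b (k + 1) (n + 1) = -gaussLead (a + 1) (b + 1) k n := by
  have ha0 : a ≠ 0 := by simpa using ha 0
  have hb0 : b ≠ 0 := by simpa using hb 0
  have h1 := poch_ne_zero (not_pole_succ ha) k
  have h2 := poch_ne_zero (not_pole_succ hb) k
  have h3 := factorial_ne_zero' n
  have h4 := factorial_ne_zero' (n - k)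
  have h5 : (n : ℂ) + 1 ≠ 0 := by exact_mod_cast n.succ_ne_zero
  simp only [gaussLead, Nat.add_lt_add_iff_right, Nat.add_sub_add_right, poch_succ_left,
    Nat.factorial_succ]
  push_cast
  split_ifs
  · simp
  · field_simp
    ring

theorem digammaSum_succ (a b : ℂ) (k n : ℕ) :
    digammaSum a b (k + 1) (n + 1) = digammaSum (a + 1) (b + 1) k n + ((n : ℂ) + 1)⁻¹ := by
  have h := digamma_add_one_add not_pole_one n
  simp only [digammaSum]
  rw [h]
  push_cast
  rw [show (1 : ℂ) + (n + 1) - (k + 1) = 1 + n - k by ring, show a + ((n : ℂ) + 1) = a + 1 + n by ring,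
    show b + ((n : ℂ) + 1) = b + 1 + n by ring, add_comm (n : ℂ) 1]
  ring

/-- This mirrors `G_{k+1}(a,b)' = G_k(a+1,b+1)`, where `G_k(a,b)` has Taylor coefficients
`gaussCoeff a b k`; the two following relations mirror `(1-z) G_0' = a b G_1` and `z G_0(a+1,b+1) =
G_0 - (a+b) G_1`. The expansions at `1` satisfy the same differential system as the series at `0`.
-/
theorem euler_gaussLog_succ (ha : ∀ m : ℕ, a ≠ -(m : ℂ)) (hb : ∀ m : ℕ, b ≠ -(m : ℂ)) (k : ℕ) :
    LogSeq.euler (gaussLog a b (k + 1)) = -LogSeq.mulW (gaussLog (a + 1) (b + 1) k) := by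
  have hl := gaussLead_succ ha hb k
  have ha0 : a ≠ 0 := by simpa using ha 0
  have hb0 : b ≠ 0 := by simpa using hb 0
  have h1 := poch_ne_zero (not_pole_succ ha) k
  have h2 := poch_ne_zero (not_pole_succ hb) k
  refine Prod.ext (funext fun n => ?_) (funext fun n => ?_)
  · cases n with
    | zero => simp [LogSeq.euler, LogSeq.mulW, delay, gaussLog, gaussLead]
    | succ n =>
      have h3 := factorial_ne_zero' n
      have h5 : (n : ℂ) + 1 ≠ 0 := by exact_mod_cast n.succ_ne_zero
      simp only [LogSeq.euler, LogSeq.mulW, delay, gaussLog, Prod.fst_neg, Pi.neg_apply,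
        Nat.add_lt_add_iff_right]
      split_ifs with h
      · simp only [gaussLead, Nat.add_lt_add_iff_right, h, if_true, sub_zero, poch_succ_left,
          Nat.factorial_succ, show k + 1 - (n + 1) - 1 = k - n - 1 by omega]
        push_cast
        field_simp
        ring
      · rw [digammaSum_succ]
        push_cast
        have h6 : gaussLead a b (k + 1) (n + 1) = -gaussLead (a + 1) (b + 1) k n / (n + 1) := by
          rw [← hl]
          field_simp
        rw [h6]
        field_simp
        ring
  · cases n with
    | zero => simp [LogSeq.euler, LogSeq.mulW, delay, gaussLog]
    | succ n =>
      simp only [LogSeq.euler, LogSeq.mulW, delay, gaussLog, Prod.snd_neg, Pi.neg_apply]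
      push_cast
      exact hl n

theorem euler_gaussLog_zero (ha : ∀ m : ℕ, a ≠ -(m : ℂ)) (hb : ∀ m : ℕ, b ≠ -(m : ℂ)) :
    LogSeq.euler (gaussLog a b 0) = (-(a * b)) • gaussLog a b 1 := by
  have ha0 : a ≠ 0 := by simpa using ha 0
  have hb0 : b ≠ 0 := by simpa using hb 0
  have hq : ∀ n : ℕ, ((n : ℂ) + 1) * gaussLead a b 0 (n + 1) = -(a * b) * gaussLead a b 1 (n + 1) := by
    intro n
    have h3 := factorial_ne_zero' n
    have h5 : (n : ℂ) + 1 ≠ 0 := by exact_mod_cast n.succ_ne_zero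
    simp [gaussLead, poch_succ_left, poch_zero, Nat.factorial_succ]
    field_simp
  refine Prod.ext (funext fun n => ?_) (funext fun n => ?_)
  · cases n with
    | zero =>
      simp [LogSeq.euler, gaussLog, gaussLead, poch_zero, poch_succ_left]
      field_simp
    | succ n =>
      have h5 : (n : ℂ) + 1 ≠ 0 := by exact_mod_cast n.succ_ne_zero
      have hd : digammaSum a b 0 (n + 1) = digammaSum a b 1 (n + 1) + ((n : ℂ) + 1)⁻¹ := by
        have h := digamma_add_one_add not_pole_one n
        simp only [digammaSum]
        rw [Nat.cast_zero, sub_zero, h, Nat.cast_one,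
          show (1 : ℂ) + (n + 1 : ℕ) - 1 = 1 + n by push_cast; ring, add_comm (n : ℂ) 1]
        ring
      simp only [LogSeq.euler, gaussLog, Prod.smul_fst, Pi.smul_apply, smul_eq_mul, not_lt_zero,
        if_false, show ¬ (n + 1 < 1) by omega, hd]
      rw [← mul_assoc (-(a * b)), ← hq]
      push_cast
      field_simp
      ring
  · cases n with
    | zero => simp [LogSeq.euler, gaussLog, gaussLead]
    | succ n =>
      simp only [LogSeq.euler, gaussLog, Prod.smul_snd, Pi.smul_apply, smul_eq_mul]
      push_cast
      exact hq n

theorem gaussLog_contiguous (ha : ∀ m : ℕ, a ≠ -(m : ℂ)) (hb : ∀ m : ℕ, b ≠ -(m : ℂ)) :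
    gaussLog (a + 1) (b + 1) 0 - LogSeq.mulW (gaussLog (a + 1) (b + 1) 0) =
      gaussLog a b 0 - (a + b) • gaussLog a b 1 := by
  have ha0 : a ≠ 0 := by simpa using ha 0
  have hb0 : b ≠ 0 := by simpa using hb 0
  have e1 : ∀ n, gaussLead (a + 1) (b + 1) 0 n = gaussLead a b 0 n * ((a + n) * (b + n)) / (a * b) := by
    intro n
    have ea : poch (a + 1) n = poch a n * (a + n) / a := by
      rw [← poch_succ, poch_succ_left]
      field_simp
    have eb : poch (b + 1) n = poch b n * (b + n) / b := by
      rw [← poch_succ, poch_succ_left]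
      field_simp
    rw [gaussLead_zero, gaussLead_zero, ea, eb]
    field_simp
  have e2 : ∀ n : ℕ, gaussLead (a + 1) (b + 1) 0 n =
      gaussLead a b 0 (n + 1) * ((n : ℂ) + 1) ^ 2 / (a * b) := by
    intro n
    have h5 : (n : ℂ) + 1 ≠ 0 := by exact_mod_cast n.succ_ne_zero
    rw [gaussLead_zero, gaussLead_zero, poch_succ_left, poch_succ_left, Nat.factorial_succ]
    push_cast
    field_simp
  have e3 : ∀ n : ℕ, gaussLead a b 1 (n + 1) = -(gaussLead a b 0 (n + 1) * ((n : ℂ) + 1) / (a * b)) := by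
    intro n
    have h3 := factorial_ne_zero' n
    have h5 : (n : ℂ) + 1 ≠ 0 := by exact_mod_cast n.succ_ne_zero
    simp [gaussLead, poch_succ_left, poch_zero, Nat.factorial_succ]
    field_simp
  have ed : ∀ n : ℕ, digammaSum (a + 1) (b + 1) 0 n = digammaSum a b 0 n - (a + n)⁻¹ - (b + n)⁻¹ := by
    intro n
    have h1 := digamma_add_one_add ha n
    have h2 := digamma_add_one_add hb n
    simp only [digammaSum]
    rw [show a + 1 + (n : ℂ) = a + (n + 1 : ℕ) by push_cast; ring,
      show b + 1 + (n : ℂ) = b + (n + 1 : ℕ) by push_cast; ring, h1, h2]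
    ring
  have h0 : ∀ n : ℕ, (gaussLog a b 0).1 n = gaussLead a b 0 n * digammaSum a b 0 n := fun n => by
    simp [gaussLog]
  have h0' : ∀ n : ℕ, (gaussLog (a + 1) (b + 1) 0).1 n =
      gaussLead (a + 1) (b + 1) 0 n * digammaSum (a + 1) (b + 1) 0 n := fun n => by
    simp [gaussLog]
  refine Prod.ext (funext fun n => ?_) (funext fun n => ?_)
  · have h3 := add_nat_ne_zero ha n
    have h4 := add_nat_ne_zero hb n
    cases n with
    | zero =>
      simp only [LogSeq.mulW, delay, Prod.fst_sub, Pi.sub_apply, Prod.smul_fst, Pi.smul_apply, h0, h0',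
        ed]
      simp [gaussLead_zero, poch_zero, gaussLog, poch_succ_left]
      field_simp
      ring
    | succ n =>
      have h5 : (n : ℂ) + 1 ≠ 0 := by exact_mod_cast n.succ_ne_zero
      have hd : digammaSum a b 0 (n + 1) = digammaSum a b 1 (n + 1) + ((n : ℂ) + 1)⁻¹ := by
        have h := digamma_add_one_add not_pole_one n
        simp only [digammaSum]
        rw [Nat.cast_zero, sub_zero, h, Nat.cast_one,
          show (1 : ℂ) + (n + 1 : ℕ) - 1 = 1 + n by push_cast; ring, add_comm (n : ℂ) 1]
        ring
      have hd2 := digammaSum_succ a b 0 n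
      have h1 : (gaussLog a b 1).1 (n + 1) = gaussLead a b 1 (n + 1) * digammaSum a b 1 (n + 1) := by
        simp [gaussLog]
      simp only [LogSeq.mulW, delay, Prod.fst_sub, Pi.sub_apply, Prod.smul_fst, Pi.smul_apply, h0, h0',
        h1, smul_eq_mul]
      rw [show digammaSum (a + 1) (b + 1) 0 n = digammaSum a b 1 (n + 1) - ((n : ℂ) + 1)⁻¹ by
        rw [hd2]; ring, ed, hd, e3, e1 (n + 1), e2]
      push_cast at h3 h4 ⊢
      field_simp
      ring
  · cases n with
    | zero => simp [LogSeq.mulW, delay, gaussLog, gaussLead, poch_zero]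
    | succ n =>
      simp only [LogSeq.mulW, delay, Prod.snd_sub, Pi.sub_apply, Prod.smul_snd, Pi.smul_apply, gaussLog,
        smul_eq_mul]
      rw [e3, e1 (n + 1), e2]
      push_cast
      field_simp
      ring

theorem conv_gaussLog_zero (ha : ∀ m : ℕ, a ≠ -(m : ℂ)) (hb : ∀ m : ℕ, b ≠ -(m : ℂ)) :
    LogSeq.Conv 1 (gaussLog a b 0) := by
  have hq : ConvBelow 1 (gaussLead a b 0) := by
    have hf : (fun n : ℕ => ((n ! : ℂ))⁻¹) =O[atTop] fun n : ℕ => ((n ! : ℝ))⁻¹ :=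
      IsBigO.of_bound 1 (by simp)
    refine convBelow_one_of_isBigO (θ := (a.re - 1) + (b.re - 1)) ?_
    refine IsBigO.trans (EventuallyEq.isBigO ?_)
      (((((isBigO_poch a).mul (isBigO_poch b)).mul hf).mul hf).trans (EventuallyEq.isBigO ?_))
    · refine Eventually.of_forall fun n => ?_
      have := factorial_ne_zero' n
      simp only [gaussLead_zero]
      field_simp
    · filter_upwards [eventually_gt_atTop 0] with n hn
      have : (n ! : ℝ) ≠ 0 := by exact_mod_cast n.factorial_ne_zero
      rw [Real.rpow_add (by exact_mod_cast hn)]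
      field_simp
  refine ⟨?_, hq⟩
  have h1 := hq.mul_digamma not_pole_one
  have h2 := ((h1.add h1).sub (hq.mul_digamma ha)).sub (hq.mul_digamma hb)
  refine h2.of_le fun n => le_of_eq ?_
  simp only [gaussLog, not_lt_zero, if_false, digammaSum, Nat.cast_zero, sub_zero]
  congr 1
  ring

theorem LogSeq.Conv.neg {R : ℝ} {y : LogSeq} (h : LogSeq.Conv R y) : LogSeq.Conv R (-y) := by
  rw [← zero_sub]
  exact LogSeq.conv_zero.sub h

theorem LogSeq.val_neg {R : ℝ} {y : LogSeq} (h : LogSeq.Conv R y) {z : ℂ} (hz : ‖1 - z‖ < R) :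
    LogSeq.val (-y) z = -LogSeq.val y z := by
  rw [← zero_sub, LogSeq.val_sub LogSeq.conv_zero h hz, LogSeq.val_zero, zero_sub]

/-- The Euler operator lowers `k`, so convergence reduces to `k = 0`, where the coefficients are
explicit. -/
theorem conv_gaussLog (k : ℕ) {a b : ℂ} (ha : ∀ m : ℕ, a ≠ -(m : ℂ)) (hb : ∀ m : ℕ, b ≠ -(m : ℂ)) :
    LogSeq.Conv 1 (gaussLog a b k) := by
  induction k generalizing a b with
  | zero => exact conv_gaussLog_zero ha hb
  | succ k ih =>
    refine LogSeq.Conv.of_euler ?_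
    rw [euler_gaussLog_succ ha hb]
    exact (ih (not_pole_succ ha) (not_pole_succ hb)).mulW.neg

end

section

/-! ### Uniqueness for the system of differential equations -/

theorem norm_le_mul_of_deriv_le {f f' : ℝ → ℂ} {C δ : ℝ} (hC : 0 ≤ C)
    (hf : ∀ t ∈ Set.Ioo 0 δ, HasDerivAt f (f' t) t) (hb : ∀ t ∈ Set.Ioo 0 δ, ‖f' t‖ ≤ C)
    (h0 : Tendsto f (𝓝[>] 0) (𝓝 0)) {t : ℝ} (ht : t ∈ Set.Ioo 0 δ) : ‖f t‖ ≤ C * t := by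
  have h1 : Tendsto (fun ε => ‖f t - f ε‖) (𝓝[>] 0) (𝓝 ‖f t - 0‖) :=
    (tendsto_const_nhds.sub h0).norm
  rw [sub_zero] at h1
  refine le_of_tendsto h1 ?_
  filter_upwards [Ioo_mem_nhdsGT ht.1] with ε hε
  have h2 := Convex.norm_image_sub_le_of_norm_hasDerivWithin_le (f := f) (f' := f') (C := C)
    (s := Set.Ioo 0 δ) (x := ε) (y := t) (fun x hx => (hf x hx).hasDerivWithinAt) hb (convex_Ioo 0 δ)
    ⟨hε.1, hε.2.trans ht.2⟩ ht
  refine h2.trans ?_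
  rw [Real.norm_of_nonneg (by linarith [hε.2])]
  have := hε.1
  gcongr
  linarith

/-- If both functions are at most `M`, integrating the second inequality gives `|v₁| ≤ 2KMt`. This
factor `t` absorbs the singular `1/t` in the first, so `|v₀| ≤ 2K²Mt`. On a small fixed interval
both are then at most `M/2`, and iteration gives `0`. -/
theorem eventually_eq_zero_of_system {v₀ v₁ d₀ d₁ : ℝ → ℂ} {K δ : ℝ} (hK : 0 ≤ K) (hδ : 0 < δ)
    (h₀ : ∀ t ∈ Set.Ioo 0 δ, HasDerivAt v₀ (d₀ t) t) (h₁ : ∀ t ∈ Set.Ioo 0 δ, HasDerivAt v₁ (d₁ t) t)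
    (hd₀ : ∀ t ∈ Set.Ioo 0 δ, ‖d₀ t‖ ≤ K * ‖v₁ t‖ / t)
    (hd₁ : ∀ t ∈ Set.Ioo 0 δ, ‖d₁ t‖ ≤ K * (‖v₀ t‖ + ‖v₁ t‖))
    (hv₀ : Tendsto v₀ (𝓝[>] 0) (𝓝 0)) (hv₁ : Tendsto v₁ (𝓝[>] 0) (𝓝 0)) :
    ∀ᶠ t in 𝓝[>] 0, v₀ t = 0 ∧ v₁ t = 0 := by
  have hn₀ : ∀ᶠ t in 𝓝[>] 0, ‖v₀ t‖ ≤ 1 := by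
    have h := hv₀.norm
    rw [norm_zero] at h
    exact h.eventually_le_const one_pos
  have hn₁ : ∀ᶠ t in 𝓝[>] 0, ‖v₁ t‖ ≤ 1 := by
    have h := hv₁.norm
    rw [norm_zero] at h
    exact h.eventually_le_const one_pos
  obtain ⟨ε, hε0, hε⟩ := mem_nhdsGT_iff_exists_Ioo_subset.1 (hn₀.and hn₁)
  have hε0 : 0 < ε := hε0
  -- Chosen so that `t ≤ 1/L` makes both `2Kt` and `2K²t` at most `1/2`.
  set L : ℝ := 4 * K + 4 * K * K + 1 with hL
  have hL0 : 0 < L := by positivity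
  set η := min (min ε δ) (1 / L) with hη
  have hη0 : 0 < η := by positivity
  have hηL : L * η ≤ 1 := by
    calc L * η ≤ L * (1 / L) := by gcongr; exact min_le_right _ _
      _ = 1 := by field_simp
  have hηε : η ≤ ε := (min_le_left _ _).trans (min_le_left _ _)
  have hηδ : η ≤ δ := (min_le_left _ _).trans (min_le_right _ _)
  have key : ∀ n : ℕ, ∀ t ∈ Set.Ioo 0 η, ‖v₀ t‖ ≤ (1 / 2) ^ n ∧ ‖v₁ t‖ ≤ (1 / 2) ^ n := by
    intro n
    induction n with
    | zero =>
      intro t ht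
      simpa using hε ⟨ht.1, ht.2.trans_le hηε⟩
    | succ n ih =>
      set M : ℝ := (1 / 2) ^ n with hM
      have hM0 : 0 ≤ M := by positivity
      have hsub : ∀ t ∈ Set.Ioo 0 η, t ∈ Set.Ioo 0 δ := fun t ht => ⟨ht.1, ht.2.trans_le hηδ⟩
      have k₁ : ∀ t ∈ Set.Ioo 0 η, ‖v₁ t‖ ≤ 2 * K * M * t := fun t ht => by
        refine norm_le_mul_of_deriv_le (by positivity) (fun t ht => h₁ t (hsub t ht))
          (fun t ht => (hd₁ t (hsub t ht)).trans ?_) hv₁ ht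
        have := ih t ht
        calc K * (‖v₀ t‖ + ‖v₁ t‖) ≤ K * (M + M) := by gcongr <;> [exact this.1; exact this.2]
          _ = _ := by ring
      have k₀ : ∀ t ∈ Set.Ioo 0 η, ‖v₀ t‖ ≤ 2 * K * K * M * t := fun t ht => by
        refine norm_le_mul_of_deriv_le (by positivity) (fun t ht => h₀ t (hsub t ht))
          (fun t ht => (hd₀ t (hsub t ht)).trans ?_) hv₀ ht
        rw [div_le_iff₀ ht.1]
        calc K * ‖v₁ t‖ ≤ K * (2 * K * M * t) := by gcongr; exact k₁ t ht
          _ = _ := by ring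
      intro t ht
      have ht0 := ht.1
      have htL : L * t ≤ 1 := le_trans (by gcongr; exact ht.2.le) hηL
      have h4 : M * (L * t) ≤ M * 1 := by gcongr
      have p1 : 0 ≤ M * (K * t) := by positivity
      have p2 : 0 ≤ M * (K * K * t) := by positivity
      have p3 : 0 ≤ M * t := by positivity
      rw [pow_succ, ← hM]
      constructor
      · refine (k₀ t ht).trans ?_
        rw [hL] at h4
        nlinarith
      · refine (k₁ t ht).trans ?_
        rw [hL] at h4
        nlinarith
  filter_upwards [Ioo_mem_nhdsGT hη0] with t ht
  have hz := tendsto_pow_atTop_nhds_zero_of_lt_one (r := (1 / 2 : ℝ)) (by norm_num) (by norm_num)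
  constructor
  · exact norm_le_zero_iff.1 (ge_of_tendsto' hz fun n => (key n t ht).1)
  · exact norm_le_zero_iff.1 (ge_of_tendsto' hz fun n => (key n t ht).2)

/-! ### Limits at `z = 1` along the real axis -/

theorem tendsto_powSum_one_sub {p : ℕ → ℂ} (hp : Summable fun n => ‖p n‖) :
    Tendsto (fun t : ℝ => powSum p (1 - t)) (𝓝[>] 0) (𝓝 (∑' n, p n)) := by
  refine tendsto_tsum_of_dominated_convergence hp (fun n => ?_) ?_
  · have h : Continuous fun t : ℝ => p n * (1 - (t : ℂ)) ^ n := by fun_prop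
    exact (h.tendsto' 0 (p n) (by simp)).mono_left nhdsWithin_le_nhds
  · filter_upwards [Ioo_mem_nhdsGT one_pos] with t ht n
    rw [norm_mul, norm_pow]
    refine mul_le_of_le_one_right (norm_nonneg _) (pow_le_one₀ (norm_nonneg _) ?_)
    rw [← Complex.ofReal_one, ← Complex.ofReal_sub, Complex.norm_real,
      Real.norm_of_nonneg (by linarith [ht.2])]
    linarith [ht.1]

theorem LogSeq.tendsto_mul_val {R : ℝ} (hR : 0 < R) {y : LogSeq} (h : LogSeq.Conv R y) :
    Tendsto (fun t : ℝ => (t : ℂ) * LogSeq.val y (1 - t)) (𝓝[>] 0) (𝓝 0) := by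
  have h0 : Tendsto (fun t : ℝ => (t : ℂ)) (𝓝[>] 0) (𝓝 0) :=
    (Complex.continuous_ofReal.tendsto' 0 0 (by simp)).mono_left nhdsWithin_le_nhds
  have h1 := (h0.mul (LogSeq.tendsto_powSum_ofReal hR h.1)).sub
    (LogSeq.tendsto_ofReal_mul_log.mul (LogSeq.tendsto_powSum_ofReal hR h.2))
  rw [zero_mul, zero_mul, sub_zero] at h1
  refine h1.congr fun t => ?_
  simp only [LogSeq.val, sub_sub_cancel]
  ring

theorem LogSeq.tendsto_val_add_log {R : ℝ} (hR : 0 < R) {y : LogSeq} (h : LogSeq.Conv R y) :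
    Tendsto (fun t : ℝ => LogSeq.val y (1 - t) + Complex.log t * y.2 0) (𝓝[>] 0) (𝓝 (y.1 0)) := by
  have hc : LogSeq.Conv R (fun n => y.1 (n + 1), fun n => y.2 (n + 1)) := ⟨h.1.tail, h.2.tail⟩
  have h1 := (tendsto_const_nhds (x := y.1 0)).add (LogSeq.tendsto_mul_val hR hc)
  rw [add_zero] at h1
  refine h1.congr' ?_
  filter_upwards [LogSeq.eventually_norm_ofReal_lt hR] with t ht
  rw [LogSeq.val_eq_zero_add h (by simpa using ht), sub_sub_cancel]
  ring

/-- The intersection of the unit discs around `0` and `1`. -/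
def lens : Set ℂ := Metric.ball 0 1 ∩ Metric.ball 1 1

theorem mem_lens {z : ℂ} : z ∈ lens ↔ ‖z‖ < 1 ∧ ‖1 - z‖ < 1 := by
  simp [lens, dist_eq_norm, norm_sub_rev]

theorem isOpen_lens : IsOpen lens := Metric.isOpen_ball.inter Metric.isOpen_ball

theorem isPreconnected_lens : IsPreconnected lens :=
  ((convex_ball 0 1).inter (convex_ball 1 1)).isPreconnected

theorem one_sub_mem_slitPlane {z : ℂ} (hz : ‖z‖ < 1) : 1 - z ∈ Complex.slitPlane := by
  left
  have := (Complex.re_le_norm z).trans_lt hz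
  simp
  linarith

theorem one_sub_ofReal_mem_lens {t : ℝ} (ht : t ∈ Set.Ioo 0 1) : 1 - (t : ℂ) ∈ lens := by
  rw [mem_lens, sub_sub_cancel, Complex.norm_real, Real.norm_of_nonneg ht.1.le, ← Complex.ofReal_one,
    ← Complex.ofReal_sub, Complex.norm_real, Real.norm_of_nonneg (by linarith [ht.2])]
  exact ⟨by linarith [ht.1], ht.2⟩

/-- Identity theorem: equality on a real segment ending at `1` accumulates at the midpoint of that
segment, which lies inside `U`. -/
theorem eqOn_of_eventually_eq_one_sub {f g : ℂ → ℂ} {U : Set ℂ} (hU : IsOpen U)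
    (hU' : IsPreconnected U) (hf : DifferentiableOn ℂ f U) (hg : DifferentiableOn ℂ g U)
    (hmem : ∀ᶠ t : ℝ in 𝓝[>] 0, 1 - (t : ℂ) ∈ U)
    (h : ∀ᶠ t : ℝ in 𝓝[>] 0, f (1 - t) = g (1 - t)) : Set.EqOn f g U := by
  obtain ⟨ε, hε0, hε⟩ := mem_nhdsGT_iff_exists_Ioo_subset.1 (hmem.and h)
  have hε0 : 0 < ε := hε0
  have hmid : ε / 2 ∈ Set.Ioo 0 ε := ⟨by linarith, by linarith⟩
  refine (hf.analyticOnNhd hU).eqOn_of_preconnected_of_frequently_eq (hg.analyticOnNhd hU) hU'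
    (hε hmid).1 ?_
  have ht : Tendsto (fun t : ℝ => 1 - (t : ℂ)) (𝓝[≠] (ε / 2)) (𝓝[≠] (1 - ((ε / 2 : ℝ) : ℂ))) := by
    refine tendsto_nhdsWithin_iff.2 ⟨?_, ?_⟩
    · have : Continuous fun t : ℝ => 1 - (t : ℂ) := by fun_prop
      exact this.continuousAt.tendsto.mono_left nhdsWithin_le_nhds
    · filter_upwards [self_mem_nhdsWithin] with t ht
      simp only [Set.mem_compl_iff, Set.mem_singleton_iff] at ht ⊢
      intro h
      rw [sub_right_inj] at h
      exact ht (by exact_mod_cast h)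
  refine ht.frequently (Eventually.frequently ?_)
  filter_upwards [nhdsWithin_le_nhds (Ioo_mem_nhds hmid.1 hmid.2)] with t ht
  exact (hε ht).2

theorem differentiableOn_powSum_lens {p : ℕ → ℂ} (hp : ConvBelow 1 p) :
    DifferentiableOn ℂ (powSum p) lens := fun _ hz =>
  (hasDerivAt_powSum hp (mem_lens.1 hz).1).differentiableAt.differentiableWithinAt

theorem differentiableOn_val_lens {y : LogSeq} (hy : LogSeq.Conv 1 y) :
    DifferentiableOn ℂ (LogSeq.val y) lens := fun _ hz =>
  (LogSeq.hasDerivAt_val hy (mem_lens.1 hz).2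
    (one_sub_mem_slitPlane (mem_lens.1 hz).1)).differentiableAt.differentiableWithinAt

/-! ### The Gauss functions near `z = 1` -/

variable {a b : ℂ}

theorem succ_mul_gaussCoeff (a b : ℂ) (k n : ℕ) :
    ((n + 1 : ℕ) : ℂ) * gaussCoeff a b (k + 1) (n + 1) = gaussCoeff (a + 1) (b + 1) k n := by
  have h5 : (n : ℂ) + 1 ≠ 0 := by exact_mod_cast n.succ_ne_zero
  have h3 := factorial_ne_zero' n
  simp only [gaussCoeff, Nat.factorial_succ]
  push_cast
  rw [show a + ((n : ℂ) + 1) = a + 1 + n by ring, show b + ((n : ℂ) + 1) = b + 1 + n by ring,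
    show a + b + ((n : ℂ) + 1) + (k + 1) = a + 1 + (b + 1) + n + k by ring]
  rw [mul_assoc, ← mul_div_assoc, mul_div_mul_left _ _ h5]

theorem hasDerivAt_powSum_gaussCoeff_succ (a b : ℂ) (k : ℕ) {z : ℂ} (hz : ‖z‖ < 1) :
    HasDerivAt (powSum (gaussCoeff a b (k + 1))) (powSum (gaussCoeff (a + 1) (b + 1) k) z) z := by
  have h := hasDerivAt_powSum (convBelow_gaussCoeff a b (k + 1)) hz
  rwa [funext (succ_mul_gaussCoeff a b k)] at h

theorem gaussCoeff_sub_natCast_mul (ha : ∀ m : ℕ, a ≠ -(m : ℂ)) (hb : ∀ m : ℕ, b ≠ -(m : ℂ)) (n : ℕ) :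
    ((n + 1 : ℕ) : ℂ) * gaussCoeff a b 0 (n + 1) - n * gaussCoeff a b 0 n =
      a * b * gaussCoeff a b 1 n := by
  have h5 : (n : ℂ) + 1 ≠ 0 := by exact_mod_cast n.succ_ne_zero
  have h3 := factorial_ne_zero' n
  have hG := inv_Gamma (a + b + n)
  simp only [gaussCoeff, Nat.factorial_succ]
  push_cast
  rw [show a + ((n : ℂ) + 1) = a + n + 1 by ring, show b + ((n : ℂ) + 1) = b + n + 1 by ring,
    show a + b + ((n : ℂ) + 1) + 0 = a + b + n + 1 by ring, add_zero,
    Complex.Gamma_add_one _ (add_nat_ne_zero ha n), Complex.Gamma_add_one _ (add_nat_ne_zero hb n)]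
  simp only [div_eq_mul_inv, mul_inv, hG]
  field_simp
  ring

theorem hasDerivAt_powSum_gaussCoeff_zero (ha : ∀ m : ℕ, a ≠ -(m : ℂ)) (hb : ∀ m : ℕ, b ≠ -(m : ℂ))
    {z : ℂ} (hz : ‖z‖ < 1) (hz1 : 1 - z ≠ 0) :
    HasDerivAt (powSum (gaussCoeff a b 0)) (a * b * powSum (gaussCoeff a b 1) z / (1 - z)) z := by
  have hc := convBelow_gaussCoeff a b 0
  refine (hasDerivAt_powSum hc hz).congr_deriv ?_
  rw [eq_div_iff hz1, ← powSum_const_mul, ← funext (gaussCoeff_sub_natCast_mul ha hb),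
    powSum_sub hc.natCast_mul.tail hc.natCast_mul hz, powSum_natCast_mul hc hz]
  ring

theorem powSum_gaussCoeff_contiguous {z : ℂ} (hz : ‖z‖ < 1) :
    z * powSum (gaussCoeff (a + 1) (b + 1) 0) z =
      powSum (gaussCoeff a b 0) z - (a + b) * powSum (gaussCoeff a b 1) z := by
  rw [← powSum_delay (convBelow_gaussCoeff _ _ _) hz, ← powSum_const_mul,
    ← powSum_sub (convBelow_gaussCoeff _ _ _) ((convBelow_gaussCoeff _ _ _).const_mul _) hz]
  congr 1
  funext n
  cases n with
  | zero =>
    have hG := inv_Gamma (a + b)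
    simp [delay, gaussCoeff, div_eq_mul_inv, hG]
    ring
  | succ n =>
    have h5 : (n : ℂ) + 1 ≠ 0 := by exact_mod_cast n.succ_ne_zero
    have h3 := factorial_ne_zero' n
    have hG := inv_Gamma (a + b + n + 1)
    simp only [delay, gaussCoeff, Nat.factorial_succ]
    push_cast
    rw [show a + ((n : ℂ) + 1) = a + 1 + n by ring, show b + ((n : ℂ) + 1) = b + 1 + n by ring,
      show a + b + ((n : ℂ) + 1) + 0 = a + b + n + 1 by ring,
      show a + 1 + (b + 1) + (n : ℂ) + 0 = a + b + n + 1 + 1 by ring,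
      show a + b + ((n : ℂ) + 1) + 1 = a + b + n + 1 + 1 by ring]
    simp only [div_eq_mul_inv, mul_inv, hG]
    field_simp
    ring

/-- For positive third index the excess is a positive integer, so Gauss's theorem gives the value at
`z = 1`: it is the constant term of the expansion. -/
theorem hasSum_gaussCoeff_succ (ha : ∀ m : ℕ, a ≠ -(m : ℂ)) (hb : ∀ m : ℕ, b ≠ -(m : ℂ)) (k : ℕ) :
    HasSum (gaussCoeff a b (k + 1)) ((gaussLog a b (k + 1)).1 0) := by
  have hre : (0 : ℝ) < (a + b + (k + 1 : ℕ) - a - b).re := by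
    rw [show a + b + ((k + 1 : ℕ) : ℂ) - a - b = ((k + 1 : ℕ) : ℂ) by ring, Complex.natCast_re]
    positivity
  have h := (gauss_sum hre).mul_left (Complex.Gamma a * Complex.Gamma b)
  refine HasSum.congr_of_eq h (fun n => ?_) ?_
  · simp only [gaussCoeff, gaussTerm, ← Gamma_mul_poch ha, ← Gamma_mul_poch hb]
    rw [show a + b + (n : ℂ) + (k + 1 : ℕ) = a + b + (k + 1 : ℕ) + n by ring, div_div, ← mul_div_assoc]
    congr 1
    ring
  · rw [show a + b + ((k + 1 : ℕ) : ℂ) - a - b = (k : ℂ) + 1 by push_cast; ring,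
      show a + b + ((k + 1 : ℕ) : ℂ) - a = b + (k + 1 : ℕ) by ring,
      show a + b + ((k + 1 : ℕ) : ℂ) - b = a + (k + 1 : ℕ) by ring, Complex.Gamma_nat_eq_factorial,
      ← Gamma_mul_poch ha, ← Gamma_mul_poch hb]
    have h1 := Complex.Gamma_ne_zero ha
    have h2 := Complex.Gamma_ne_zero hb
    have h3 := poch_ne_zero ha (k + 1)
    have h4 := poch_ne_zero hb (k + 1)
    simp [gaussLog, poch_zero]
    field_simp

theorem tendsto_gauss_succ_sub (ha : ∀ m : ℕ, a ≠ -(m : ℂ)) (hb : ∀ m : ℕ, b ≠ -(m : ℂ)) (k : ℕ) :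
    Tendsto (fun t : ℝ => powSum (gaussCoeff a b (k + 1)) (1 - t)
      - LogSeq.val (gaussLog a b (k + 1)) (1 - t)) (𝓝[>] 0) (𝓝 0) := by
  have hs : Summable fun n => ‖gaussCoeff a b (k + 1) n‖ := by
    refine summable_of_isBigO_rpow ?_ (isBigO_gaussCoeff a b (k + 1))
    push_cast
    linarith [(Nat.cast_nonneg k : (0 : ℝ) ≤ k)]
  have h1 := tendsto_powSum_one_sub hs
  rw [(hasSum_gaussCoeff_succ ha hb k).tsum_eq] at h1
  have h2 := LogSeq.tendsto_val_add_log one_pos (conv_gaussLog (k + 1) ha hb)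
  have h3 := h1.sub h2
  rw [sub_self] at h3
  refine h3.congr fun t => ?_
  simp [gaussLog, gaussLead]

theorem mul_powSum_inv {z : ℂ} (hz : ‖z‖ < 1) :
    z * powSum (fun n : ℕ => 1 / (1 + (n : ℂ))) z = -Complex.log (1 - z) := by
  have h := (Complex.hasSum_taylorSeries_neg_log hz)
  have h2 := (hasSum_nat_add_iff' 1).2 h
  simp only [range_one, sum_singleton, pow_zero, Nat.cast_zero, div_zero, sub_zero] at h2
  rw [powSum, ← tsum_mul_left, ← h2.tsum_eq]
  congr 1
  funext n
  push_cast
  rw [pow_succ, add_comm (1 : ℂ)]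
  ring

theorem tendsto_gauss_zero_sub (ha : ∀ m : ℕ, a ≠ -(m : ℂ)) (hb : ∀ m : ℕ, b ≠ -(m : ℂ)) :
    Tendsto (fun t : ℝ => powSum (gaussCoeff a b 0) (1 - t)
      - LogSeq.val (gaussLog a b 0) (1 - t)) (𝓝[>] 0) (𝓝 0) := by
  have hO : (fun n : ℕ => gaussCoeff a b 0 n - 1 / (1 + (n : ℂ))) =O[atTop]
      fun n : ℕ => (n : ℝ) ^ (-2 : ℝ) := by
    have h := (isBigO_gaussCoeff_sub ha hb).add (isBigO_gaussCoeff_sub not_pole_one ha)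
    refine h.congr_left fun n => ?_
    rw [gaussCoeff_comm 1 a, gaussCoeff_one_right not_pole_one]
    ring
  have h1 := tendsto_powSum_one_sub (summable_of_isBigO_rpow (by norm_num) hO)
  rw [(hasSum_gaussCoeff_sub_inv ha hb).tsum_eq] at h1
  have h2 := LogSeq.tendsto_val_add_log one_pos (conv_gaussLog 0 ha hb)
  have e1 : (gaussLog a b 0).1 0 = 2 * Complex.digamma 1 - Complex.digamma a - Complex.digamma b := by
    simp [gaussLog, gaussLead_zero, poch_zero, digammaSum]
    ring
  have e2 : (gaussLog a b 0).2 0 = 1 := by simp [gaussLog, gaussLead_zero, poch_zero]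
  rw [e1, e2] at h2
  -- The comparison series `∑ z^n/(1+n)` equals `-log(1-z)/z` rather than `-log(1-z)`; the
  -- discrepancy at `z = 1 - t` is this null function up to sign.
  have h4 : Tendsto (fun t : ℝ => (t : ℂ) * Complex.log t / (1 - t)) (𝓝[>] 0) (𝓝 (0 / (1 - 0))) := by
    have h0 : Tendsto (fun t : ℝ => (t : ℂ)) (𝓝[>] 0) (𝓝 0) :=
      (Complex.continuous_ofReal.tendsto' 0 0 (by simp)).mono_left nhdsWithin_le_nhds
    exact LogSeq.tendsto_ofReal_mul_log.div (tendsto_const_nhds.sub h0) (by simp)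
  have h3 := (h1.sub h2).sub h4
  rw [sub_self, zero_div, sub_zero] at h3
  have hinv : ConvBelow 1 fun n : ℕ => 1 / (1 + (n : ℂ)) := by
    rw [← funext (gaussCoeff_one_right not_pole_one)]
    exact convBelow_gaussCoeff 1 1 0
  refine h3.congr' ?_
  filter_upwards [Ioo_mem_nhdsGT one_pos] with t ht
  have hz := (mem_lens.1 (one_sub_ofReal_mem_lens ht)).1
  have hz0 : 1 - (t : ℂ) ≠ 0 := by
    have := ht.2
    rw [sub_ne_zero]
    exact_mod_cast this.ne'
  have h5 := mul_powSum_inv hz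
  rw [sub_sub_cancel] at h5
  rw [powSum_sub (convBelow_gaussCoeff a b 0) hinv hz,
    show powSum (fun n : ℕ => 1 / (1 + (n : ℂ))) (1 - t) = -Complex.log t / (1 - t) by
      rw [eq_div_iff hz0, mul_comm, h5]]
  field_simp
  ring

theorem hasDerivAt_val_gaussLog_succ (ha : ∀ m : ℕ, a ≠ -(m : ℂ)) (hb : ∀ m : ℕ, b ≠ -(m : ℂ)) (k : ℕ)
    {z : ℂ} (hz : z ∈ lens) : HasDerivAt (LogSeq.val (gaussLog a b (k + 1)))
      (LogSeq.val (gaussLog (a + 1) (b + 1) k) z) z := by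
  obtain ⟨h1, h2⟩ := mem_lens.1 hz
  have hs := one_sub_mem_slitPlane h1
  refine (LogSeq.hasDerivAt_val (conv_gaussLog (k + 1) ha hb) h2 hs).congr_deriv ?_
  have hc := conv_gaussLog k (not_pole_succ ha) (not_pole_succ hb)
  rw [euler_gaussLog_succ ha hb, LogSeq.val_neg hc.mulW h2, LogSeq.val_mulW hc h2]
  have := Complex.slitPlane_ne_zero hs
  field_simp

theorem hasDerivAt_val_gaussLog_zero (ha : ∀ m : ℕ, a ≠ -(m : ℂ)) (hb : ∀ m : ℕ, b ≠ -(m : ℂ))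
    {z : ℂ} (hz : z ∈ lens) : HasDerivAt (LogSeq.val (gaussLog a b 0))
      (a * b * LogSeq.val (gaussLog a b 1) z / (1 - z)) z := by
  obtain ⟨h1, h2⟩ := mem_lens.1 hz
  have hs := one_sub_mem_slitPlane h1
  refine (LogSeq.hasDerivAt_val (conv_gaussLog 0 ha hb) h2 hs).congr_deriv ?_
  rw [euler_gaussLog_zero ha hb, LogSeq.val_smul]
  ring

theorem val_gaussLog_contiguous (ha : ∀ m : ℕ, a ≠ -(m : ℂ)) (hb : ∀ m : ℕ, b ≠ -(m : ℂ))
    {z : ℂ} (hz : ‖1 - z‖ < 1) : z * LogSeq.val (gaussLog (a + 1) (b + 1) 0) z =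
      LogSeq.val (gaussLog a b 0) z - (a + b) * LogSeq.val (gaussLog a b 1) z := by
  have hc := conv_gaussLog 0 (not_pole_succ ha) (not_pole_succ hb)
  have h := congrArg (fun y => LogSeq.val y z) (gaussLog_contiguous ha hb)
  rw [LogSeq.val_sub hc hc.mulW hz, LogSeq.val_mulW hc hz, LogSeq.val_sub (conv_gaussLog 0 ha hb)
    ((conv_gaussLog 1 ha hb).smul _) hz, LogSeq.val_smul] at h
  rw [← h]
  ring

/-- The differences `V₀`, `V₁` of both sides for `k = 0, 1` satisfy `V₀' = a b V₁/(1-z)` and `z V₁'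
= V₀ - (a+b) V₁`, and tend to `0` at `z = 1`. The uniqueness result for the singular system applies
along `z = 1 - t`. -/
theorem powSum_gaussCoeff_zero_eq (ha : ∀ m : ℕ, a ≠ -(m : ℂ)) (hb : ∀ m : ℕ, b ≠ -(m : ℂ)) :
    Set.EqOn (powSum (gaussCoeff a b 0)) (LogSeq.val (gaussLog a b 0)) lens := by
  refine eqOn_of_eventually_eq_one_sub isOpen_lens isPreconnected_lens
    (differentiableOn_powSum_lens (convBelow_gaussCoeff a b 0))
    (differentiableOn_val_lens (conv_gaussLog 0 ha hb)) ?_ ?_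
  · filter_upwards [Ioo_mem_nhdsGT one_pos] with t ht using one_sub_ofReal_mem_lens ht
  set V₀ : ℂ → ℂ := fun z => powSum (gaussCoeff a b 0) z - LogSeq.val (gaussLog a b 0) z with hV₀
  set V₁ : ℂ → ℂ := fun z => powSum (gaussCoeff a b 1) z - LogSeq.val (gaussLog a b 1) z with hV₁
  set W : ℂ → ℂ := fun z => powSum (gaussCoeff (a + 1) (b + 1) 0) z
    - LogSeq.val (gaussLog (a + 1) (b + 1) 0) z with hW
  have hw : ∀ t : ℝ, HasDerivAt (fun t : ℝ => 1 - (t : ℂ)) (-1) t := fun t => by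
    simpa using (Complex.ofRealCLM.hasDerivAt (x := t)).const_sub 1
  have hlens : ∀ t ∈ Set.Ioo (0 : ℝ) (1 / 2), 1 - (t : ℂ) ∈ lens := fun t ht =>
    one_sub_ofReal_mem_lens ⟨ht.1, ht.2.trans (by norm_num)⟩
  have key := eventually_eq_zero_of_system (v₀ := fun t => V₀ (1 - t)) (v₁ := fun t => V₁ (1 - t))
    (d₀ := fun t => -(a * b * V₁ (1 - t) / t)) (d₁ := fun t => -W (1 - t))
    -- The factor `2` bounds `1/|z|`, because `z = 1 - t ≥ 1/2`.
    (K := ‖a * b‖ + 2 * (1 + ‖a + b‖)) (δ := 1 / 2) (by positivity) (by norm_num) (fun t ht => ?_)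
    (fun t ht => ?_) (fun t ht => ?_) (fun t ht => ?_) (tendsto_gauss_zero_sub ha hb)
    (tendsto_gauss_succ_sub ha hb 0)
  · filter_upwards [key] with t ht
    exact sub_eq_zero.1 ht.1
  · have hl := hlens t ht
    have ht0 : (t : ℂ) ≠ 0 := by exact_mod_cast ht.1.ne'
    have h1 := hasDerivAt_powSum_gaussCoeff_zero ha hb (mem_lens.1 hl).1 (by simpa using ht0)
    have h2 := (h1.sub (hasDerivAt_val_gaussLog_zero ha hb hl)).comp t (hw t)
    refine h2.congr_deriv ?_
    simp only [sub_sub_cancel, hV₁]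
    ring
  · have hl := hlens t ht
    have h1 := hasDerivAt_powSum_gaussCoeff_succ a b 0 (mem_lens.1 hl).1
    have h2 := (h1.sub (hasDerivAt_val_gaussLog_succ ha hb 0 hl)).comp t (hw t)
    refine h2.congr_deriv ?_
    simp only [hW]
    ring
  · have ht0 := ht.1
    rw [norm_neg, norm_div, norm_mul, Complex.norm_real, Real.norm_of_nonneg ht0.le]
    gcongr
    have : 0 ≤ 2 * (1 + ‖a + b‖) := by positivity
    linarith
  · have hl := mem_lens.1 (hlens t ht)
    have h1 : (1 - (t : ℂ)) * W (1 - t) = V₀ (1 - t) - (a + b) * V₁ (1 - t) := by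
      simp only [hW, hV₀, hV₁, mul_sub, powSum_gaussCoeff_contiguous hl.1,
        val_gaussLog_contiguous ha hb hl.2]
      ring
    have h2 : (1 / 2 : ℝ) ≤ ‖1 - (t : ℂ)‖ := by
      rw [← Complex.ofReal_one, ← Complex.ofReal_sub, Complex.norm_real]
      refine le_trans ?_ (le_abs_self _)
      linarith [ht.2]
    have h3 : ‖1 - (t : ℂ)‖ * ‖W (1 - t)‖ ≤ ‖V₀ (1 - t)‖ + ‖a + b‖ * ‖V₁ (1 - t)‖ := by
      rw [← norm_mul, h1, ← norm_mul]
      exact norm_sub_le _ _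
    have h4 := mul_le_mul_of_nonneg_right h2 (norm_nonneg (W (1 - t)))
    rw [norm_neg]
    have n1 := norm_nonneg (a * b)
    have n2 := norm_nonneg (a + b)
    have n3 := norm_nonneg (V₀ (1 - t))
    have n4 := norm_nonneg (V₁ (1 - t))
    have n5 := mul_nonneg n1 n3
    have n6 := mul_nonneg n1 n4
    have n7 := mul_nonneg n2 n3
    nlinarith

/-- The derivative of the difference is the difference for `k` with parameters `a+1`, `b+1`, which
vanishes by induction; the constant is fixed by the limit at `z = 1`. -/
theorem powSum_gaussCoeff_eq (k : ℕ) {a b : ℂ} (ha : ∀ m : ℕ, a ≠ -(m : ℂ))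
    (hb : ∀ m : ℕ, b ≠ -(m : ℂ)) :
    Set.EqOn (powSum (gaussCoeff a b k)) (LogSeq.val (gaussLog a b k)) lens := by
  induction k generalizing a b with
  | zero => exact powSum_gaussCoeff_zero_eq ha hb
  | succ k ih =>
    have hd : ∀ z ∈ lens, HasDerivAt (fun z => powSum (gaussCoeff a b (k + 1)) z -
        LogSeq.val (gaussLog a b (k + 1)) z) 0 z := by
      intro z hz
      have := (hasDerivAt_powSum_gaussCoeff_succ a b k (mem_lens.1 hz).1).sub
        (hasDerivAt_val_gaussLog_succ ha hb k hz)
      rwa [ih (not_pole_succ ha) (not_pole_succ hb) hz, sub_self] at this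
    intro z hz
    refine sub_eq_zero.1 ?_
    refine tendsto_nhds_unique (tendsto_const_nhds.congr' ?_) (tendsto_gauss_succ_sub ha hb k)
    filter_upwards [Ioo_mem_nhdsGT one_pos] with t ht
    exact isOpen_lens.is_const_of_deriv_eq_zero isPreconnected_lens
      (fun z hz => (hd z hz).differentiableAt.differentiableWithinAt) (fun z hz => (hd z hz).deriv)
      hz (one_sub_ofReal_mem_lens ht)

end

section

/-! ### Bounds for the double series -/

theorem exists_norm_le_of_isBigO {f : ℕ → ℂ} {g : ℕ → ℝ} (hg : ∀ n, 0 < g n) {θ : ℝ}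
    (h : f =O[atTop] fun n : ℕ => g n * (n : ℝ) ^ θ) :
    ∃ C, 0 ≤ C ∧ ∀ n : ℕ, ‖f n‖ ≤ C * (g n * ((n : ℝ) + 1) ^ θ) := by
  have h1 : (fun n => f n * ((g n)⁻¹ : ℝ)) =O[atTop] fun n : ℕ => (n : ℝ) ^ θ := by
    have h2 : (fun n => (((g n)⁻¹ : ℝ) : ℂ)) =O[atTop] fun n => (g n)⁻¹ :=
      IsBigO.of_bound 1 (by simp)
    refine (h.mul h2).congr_right fun n => ?_
    have := (hg n).ne'
    field_simp
  obtain ⟨C, hC0, hC⟩ := isBigO_rpow_iff.1 h1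
  refine ⟨C, hC0, fun n => ?_⟩
  have h3 := hC n
  rw [norm_mul, Complex.norm_real, Real.norm_of_nonneg (inv_nonneg.2 (hg n).le), ← div_eq_mul_inv,
    div_le_iff₀ (hg n)] at h3
  linarith

theorem exists_norm_Gamma_le (s : ℂ) :
    ∃ C, 0 ≤ C ∧ ∀ n : ℕ, ‖Complex.Gamma (s + n)‖ ≤ C * ((n ! : ℝ) * ((n : ℝ) + 1) ^ (s.re - 1)) :=
  exists_norm_le_of_isBigO (fun n => by positivity) (isTheta_Gamma s).1

theorem exists_norm_inv_Gamma_le (s : ℂ) :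
    ∃ C, 0 ≤ C ∧ ∀ n : ℕ, ‖(Complex.Gamma (s + n))⁻¹‖ ≤
      C * ((n ! : ℝ)⁻¹ * ((n : ℝ) + 1) ^ (1 - s.re)) := by
  refine exists_norm_le_of_isBigO (fun n => by positivity) ((isTheta_Gamma s).inv.1.congr_right ?_)
  intro n
  rw [mul_inv, ← Real.rpow_neg (Nat.cast_nonneg n), neg_sub]

theorem exists_norm_poch_le (x : ℂ) :
    ∃ C, 0 ≤ C ∧ ∀ n : ℕ, ‖poch x n‖ ≤ C * ((n ! : ℝ) * ((n : ℝ) + 1) ^ (x.re - 1)) :=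
  exists_norm_le_of_isBigO (fun n => by positivity) (isBigO_poch x)

theorem exists_norm_inv_poch_le {x : ℂ} (hx : ∀ m : ℕ, x ≠ -(m : ℂ)) :
    ∃ C, 0 ≤ C ∧ ∀ n : ℕ, ‖(poch x n)⁻¹‖ ≤ C * ((n ! : ℝ)⁻¹ * ((n : ℝ) + 1) ^ (1 - x.re)) := by
  refine exists_norm_le_of_isBigO (fun n => by positivity) ((isTheta_poch hx).inv.1.congr_right ?_)
  intro n
  rw [mul_inv, ← Real.rpow_neg (Nat.cast_nonneg n), neg_sub]

theorem exists_norm_digamma_le {c : ℂ} (hc : ∀ m : ℕ, c ≠ -(m : ℂ)) :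
    ∃ C, 0 ≤ C ∧ ∀ n : ℕ, ‖Complex.digamma (c + n)‖ ≤ C * ((n : ℝ) + 1) := by
  have h := (isBigO_digamma hc).norm_right
  simp only [Complex.norm_natCast] at h
  simpa using exists_norm_le_of_isBigO (g := fun _ => 1) (θ := 1) (fun _ => one_pos) (by simpa using h)

/-- With `n = m + N` this says `k! n!/(n+k)! ≤ ((n+1)/(k+1))^N`: indices `n ≥ N` gain `N` powers of
`k`, at polynomial cost in `n`. -/
theorem factorial_mul_le (k m N : ℕ) :
    k ! * (m + N)! * (k + 1) ^ N ≤ (m + N + 1) ^ N * (m + N + k)! := by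
  have h1 : (m + N)! ≤ m ! * (m + N + 1) ^ N := by
    have h := Nat.factorial_mul_descFactorial (Nat.le_add_left N m)
    rw [Nat.add_sub_cancel] at h
    rw [← h]
    exact Nat.mul_le_mul_left _ ((Nat.descFactorial_le_pow _ _).trans
      (Nat.pow_le_pow_left (Nat.le_succ _) _))
  have h2 : k ! * (k + 1) ^ N ≤ (k + N)! := Nat.factorial_mul_pow_le_factorial
  have h3 : (k + N)! * m ! ≤ (m + N + k)! := by
    rw [show m + N + k = k + N + m by ring]
    exact Nat.le_of_dvd (Nat.factorial_pos _) (Nat.factorial_mul_factorial_dvd_factorial_add _ _)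
  calc k ! * (m + N)! * (k + 1) ^ N ≤ k ! * (m ! * (m + N + 1) ^ N) * (k + 1) ^ N := by gcongr
    _ = (m + N + 1) ^ N * (k ! * (k + 1) ^ N * m !) := by ring
    _ ≤ (m + N + 1) ^ N * ((k + N)! * m !) := by gcongr
    _ ≤ _ := by gcongr

theorem rpow_add_le {x y : ℝ} (hx : 1 ≤ x) (hy : 1 ≤ y) {z : ℝ} (h1 : x ≤ z) (h2 : z ≤ x * y)
    (θ : ℝ) : z ^ θ ≤ x ^ θ * y ^ |θ| := by
  have hx0 : 0 < x := by linarith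
  have hy0 : 0 < y := by linarith
  rcases le_total 0 θ with h | h
  · rw [abs_of_nonneg h, ← Real.mul_rpow hx0.le hy0.le]
    exact Real.rpow_le_rpow (by linarith) h2 h
  · exact (Real.rpow_le_rpow_of_nonpos hx0 h1 h).trans
      (le_mul_of_one_le_right (by positivity) (Real.one_le_rpow hy (abs_nonneg θ)))

variable {a b : ℂ} {A : ℕ → ℂ} {α : ℝ} {N : ℕ}

/-- The growth of the coefficients `A_k`. -/
def CoeffBound (a b : ℂ) (α : ℝ) (A : ℕ → ℂ) : Prop :=
  ∃ C, 0 ≤ C ∧ ∀ k : ℕ, ‖A k‖ ≤ C * ((k ! : ℝ) * ((k : ℝ) + 1) ^ ((a + b).re - 2 - α))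

/-- The bound separates the variables `k` and `n`, and its `k`-part is summable as soon as `α + N >
0`. -/
theorem exists_norm_mul_gaussCoeff_le (hA : CoeffBound a b α A) (N : ℕ) :
    ∃ C μ : ℝ, 0 ≤ C ∧ ∀ k m : ℕ, ‖A k * gaussCoeff a b k (m + N)‖ ≤
      ((k : ℝ) + 1) ^ (-1 - α - N) * (C * ((m + N : ℕ) + 1 : ℝ) ^ μ) := by
  obtain ⟨CA, hCA0, hCA⟩ := hA
  obtain ⟨Ca, hCa0, hCa⟩ := exists_norm_Gamma_le a
  obtain ⟨Cb, hCb0, hCb⟩ := exists_norm_Gamma_le b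
  obtain ⟨Cs, hCs0, hCs⟩ := exists_norm_inv_Gamma_le (a + b)
  refine ⟨CA * Ca * Cb * Cs, (a + b).re - 2 + |1 - (a + b).re| + N, by positivity, fun k m => ?_⟩
  set n := m + N with hn
  set κ : ℝ := (k : ℝ) + 1 with hκ
  set ν : ℝ := (n : ℝ) + 1 with hν
  set σ := (a + b).re with hσ
  have hκ1 : 1 ≤ κ := by rw [hκ]; linarith [(Nat.cast_nonneg k : (0 : ℝ) ≤ k)]
  have hν1 : 1 ≤ ν := by rw [hν]; linarith [(Nat.cast_nonneg n : (0 : ℝ) ≤ n)]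
  have hκ0 : 0 < κ := by linarith
  have hν0 : 0 < ν := by linarith
  have hf : (k ! : ℝ) * (n ! : ℝ) * ((n + k)! : ℝ)⁻¹ ≤ ν ^ (N : ℝ) * κ ^ (-N : ℝ) := by
    rw [Real.rpow_neg hκ0.le, Real.rpow_natCast, Real.rpow_natCast, ← div_eq_mul_inv, ← div_eq_mul_inv,
      div_le_div_iff₀ (by positivity) (by positivity)]
    have := factorial_mul_le k m N
    rw [← hn] at this
    rw [hκ, hν]
    exact_mod_cast this
  have hr : (((n + k : ℕ) : ℝ) + 1) ^ (1 - σ) ≤ κ ^ (1 - σ) * ν ^ |1 - σ| := by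
    refine rpow_add_le hκ1 hν1 ?_ ?_ _
    · push_cast
      linarith [(Nat.cast_nonneg n : (0 : ℝ) ≤ n)]
    · push_cast
      rw [hκ, hν]
      nlinarith [(Nat.cast_nonneg n : (0 : ℝ) ≤ n), (Nat.cast_nonneg k : (0 : ℝ) ≤ k)]
  have hnf : (n ! : ℝ) ≠ 0 := by positivity
  calc ‖A k * gaussCoeff a b k n‖ = ‖A k‖ * (‖Complex.Gamma (a + n)‖ * ‖Complex.Gamma (b + n)‖ *
        ((n ! : ℝ)⁻¹ * ‖(Complex.Gamma (a + b + (n + k : ℕ)))⁻¹‖)) := by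
        rw [gaussCoeff, norm_mul, norm_div, norm_mul, norm_mul, Complex.norm_natCast, norm_inv]
        push_cast
        rw [add_assoc (a + b), div_eq_mul_inv, mul_inv]
    _ ≤ CA * ((k ! : ℝ) * κ ^ (σ - 2 - α)) * (Ca * ((n ! : ℝ) * ν ^ (a.re - 1)) *
        (Cb * ((n ! : ℝ) * ν ^ (b.re - 1))) * ((n ! : ℝ)⁻¹ *
          (Cs * (((n + k)! : ℝ)⁻¹ * (((n + k : ℕ) : ℝ) + 1) ^ (1 - σ))))) := by
        gcongr
        · exact hCA k
        · exact hCa n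
        · exact hCb n
        · exact hCs (n + k)
    _ = CA * Ca * Cb * Cs * (κ ^ (σ - 2 - α) * (ν ^ (a.re - 1) * ν ^ (b.re - 1)) *
          (((k ! : ℝ) * (n ! : ℝ) * ((n + k)! : ℝ)⁻¹) * (((n + k : ℕ) : ℝ) + 1) ^ (1 - σ))) := by
        field_simp
    _ ≤ CA * Ca * Cb * Cs * (κ ^ (σ - 2 - α) * (ν ^ (a.re - 1) * ν ^ (b.re - 1)) *
          ((ν ^ (N : ℝ) * κ ^ (-N : ℝ)) * (κ ^ (1 - σ) * ν ^ |1 - σ|))) := by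
        gcongr
    _ = _ := by
        rw [show -1 - α - N = (σ - 2 - α) + (-N : ℝ) + (1 - σ) by ring,
          show σ - 2 + |1 - σ| + N = (a.re - 1) + (b.re - 1) + |1 - σ| + N by
            rw [hσ, Complex.add_re]; ring, Real.rpow_add hκ0, Real.rpow_add hκ0, Real.rpow_add hν0,
          Real.rpow_add hν0, Real.rpow_add hν0]
        ring

theorem exists_norm_div_poch_le (ha : ∀ m : ℕ, a ≠ -(m : ℂ)) (hb : ∀ m : ℕ, b ≠ -(m : ℂ))
    (hA : CoeffBound a b α A) :
    ∃ C : ℝ, 0 ≤ C ∧ ∀ k n : ℕ, ‖A k * (poch a n * poch b n) * ((poch a k)⁻¹ * (poch b k)⁻¹)‖ ≤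
      C * (((k : ℝ) + 1) ^ (-α) * (k ! : ℝ)⁻¹ * ((n ! : ℝ) * (n ! : ℝ) *
        ((n : ℝ) + 1) ^ ((a + b).re - 2))) := by
  obtain ⟨CA, hCA0, hCA⟩ := hA
  obtain ⟨Ca, hCa0, hCa⟩ := exists_norm_poch_le a
  obtain ⟨Cb, hCb0, hCb⟩ := exists_norm_poch_le b
  obtain ⟨Da, hDa0, hDa⟩ := exists_norm_inv_poch_le ha
  obtain ⟨Db, hDb0, hDb⟩ := exists_norm_inv_poch_le hb
  refine ⟨CA * Ca * Cb * Da * Db, by positivity, fun k n => ?_⟩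
  have hκ0 : 0 < (k : ℝ) + 1 := by positivity
  have hν0 : 0 < (n : ℝ) + 1 := by positivity
  have hkf : (k ! : ℝ) ≠ 0 := by positivity
  simp only [norm_mul]
  calc ‖A k‖ * (‖poch a n‖ * ‖poch b n‖) * (‖(poch a k)⁻¹‖ * ‖(poch b k)⁻¹‖)
      ≤ CA * ((k ! : ℝ) * ((k : ℝ) + 1) ^ ((a + b).re - 2 - α)) *
        (Ca * ((n ! : ℝ) * ((n : ℝ) + 1) ^ (a.re - 1)) *
          (Cb * ((n ! : ℝ) * ((n : ℝ) + 1) ^ (b.re - 1)))) *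
        (Da * ((k ! : ℝ)⁻¹ * ((k : ℝ) + 1) ^ (1 - a.re)) *
          (Db * ((k ! : ℝ)⁻¹ * ((k : ℝ) + 1) ^ (1 - b.re)))) := by
        gcongr
        · exact hCA k
        · exact hCa n
        · exact hCb n
        · exact hDa k
        · exact hDb k
    _ = _ := by
        rw [show -α = ((a + b).re - 2 - α) + (1 - a.re) + (1 - b.re) by rw [Complex.add_re]; ring,
          show (a + b).re - 2 = (a.re - 1) + (b.re - 1) by rw [Complex.add_re]; ring,
          Real.rpow_add hκ0, Real.rpow_add hκ0, Real.rpow_add hν0]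
        field_simp

/-- Nonzero terms have `k ≤ n`, so missing powers of `k` are paid for by powers of `n`. The binomial
coefficient is estimated by `2^n`, which is why the first expansion is obtained only for `|1-z| <
1/2`. -/
theorem norm_mul_gaussLead_le (ha : ∀ m : ℕ, a ≠ -(m : ℂ)) (hb : ∀ m : ℕ, b ≠ -(m : ℂ))
    (hA : CoeffBound a b α A) (N : ℕ) :
    ∃ C μ : ℝ, 0 ≤ C ∧ ∀ k n : ℕ, ‖A k * gaussLead a b k n‖ ≤
      ((k : ℝ) + 1) ^ (-1 - α - N) * (C * (2 ^ n * ((n : ℝ) + 1) ^ μ)) := by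
  obtain ⟨C, hC0, hC⟩ := exists_norm_div_poch_le ha hb hA
  refine ⟨C, (a + b).re - 2 + (1 + N), hC0, fun k n => ?_⟩
  have hκ0 : 0 < (k : ℝ) + 1 := by positivity
  have hν0 : 0 < (n : ℝ) + 1 := by positivity
  by_cases h : n < k
  · simp only [gaussLead, h, if_true, mul_zero, norm_zero]
    positivity
  · rw [not_lt] at h
    have hn : (n ! : ℝ) ≠ 0 := by positivity
    have hnk : ((n - k)! : ℝ) ≠ 0 := by positivity
    have hk : (k ! : ℝ) ≠ 0 := by positivity
    have e : ‖A k * gaussLead a b k n‖ =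
        ‖A k * (poch a n * poch b n) * ((poch a k)⁻¹ * (poch b k)⁻¹)‖ *
          ((n ! : ℝ)⁻¹ * ((n - k)! : ℝ)⁻¹) := by
      simp only [gaussLead, not_lt.2 h, if_false, norm_mul, norm_pow, norm_neg, norm_one,
        one_pow, norm_inv, Complex.norm_natCast, one_mul, div_eq_mul_inv, mul_inv]
      ring
    have hch : (n ! : ℝ) * (k ! : ℝ)⁻¹ * ((n - k)! : ℝ)⁻¹ ≤ 2 ^ n := by
      have h1 : ((n.choose k : ℕ) : ℝ) ≤ 2 ^ n := by exact_mod_cast Nat.choose_le_two_pow n k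
      refine le_trans (le_of_eq ?_) h1
      rw [Nat.cast_choose ℝ h]
      field_simp
    have hr : ((k : ℝ) + 1) ^ (-α) ≤ ((k : ℝ) + 1) ^ (-1 - α - N) * ((n : ℝ) + 1) ^ (1 + N : ℝ) := by
      rw [show -α = (-1 - α - N) + (1 + N : ℝ) by ring, Real.rpow_add hκ0]
      gcongr
    rw [e]
    calc _ ≤ C * (((k : ℝ) + 1) ^ (-α) * (k ! : ℝ)⁻¹ * ((n ! : ℝ) * (n ! : ℝ) *
        ((n : ℝ) + 1) ^ ((a + b).re - 2))) * ((n ! : ℝ)⁻¹ * ((n - k)! : ℝ)⁻¹) := by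
          gcongr
          exact hC k n
      _ = C * (((k : ℝ) + 1) ^ (-α) * ((n ! : ℝ) * (k ! : ℝ)⁻¹ * ((n - k)! : ℝ)⁻¹ *
        ((n : ℝ) + 1) ^ ((a + b).re - 2))) := by
          field_simp
      _ ≤ C * ((((k : ℝ) + 1) ^ (-1 - α - N) * ((n : ℝ) + 1) ^ (1 + N : ℝ)) * (2 ^ n *
        ((n : ℝ) + 1) ^ ((a + b).re - 2))) := by
          gcongr
      _ = _ := by
          rw [Real.rpow_add hν0 ((a + b).re - 2)]
          ring

theorem exists_norm_digammaSum_le (ha : ∀ m : ℕ, a ≠ -(m : ℂ)) (hb : ∀ m : ℕ, b ≠ -(m : ℂ)) :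
    ∃ C : ℝ, 0 ≤ C ∧ ∀ k n : ℕ, k ≤ n → ‖digammaSum a b k n‖ ≤ C * ((n : ℝ) + 1) := by
  obtain ⟨C, hC0, hC⟩ := exists_norm_digamma_le not_pole_one
  obtain ⟨Ca, hCa0, hCa⟩ := exists_norm_digamma_le ha
  obtain ⟨Cb, hCb0, hCb⟩ := exists_norm_digamma_le hb
  refine ⟨C + C + Ca + Cb, by positivity, fun k n h => ?_⟩
  have h1 : ‖Complex.digamma (1 + n - k)‖ ≤ C * ((n : ℝ) + 1) := by
    have h2 := hC (n - k)
    rw [Nat.cast_sub h, ← add_sub_assoc] at h2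
    refine h2.trans ?_
    have : ((n - k : ℕ) : ℝ) ≤ n := by exact_mod_cast Nat.sub_le n k
    gcongr
  calc _ ≤ ‖Complex.digamma (1 + n - k)‖ + ‖Complex.digamma (1 + n)‖ + ‖Complex.digamma (a + n)‖ +
        ‖Complex.digamma (b + n)‖ :=
        (norm_sub_le _ _).trans (add_le_add ((norm_sub_le _ _).trans
          (add_le_add (norm_add_le _ _) le_rfl)) le_rfl)
    _ ≤ C * ((n : ℝ) + 1) + C * ((n : ℝ) + 1) + Ca * ((n : ℝ) + 1) + Cb * ((n : ℝ) + 1) :=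
        add_le_add (add_le_add (add_le_add h1 (hC n)) (hCa n)) (hCb n)
    _ = _ := by ring

theorem norm_mul_gaussLog_le (ha : ∀ m : ℕ, a ≠ -(m : ℂ)) (hb : ∀ m : ℕ, b ≠ -(m : ℂ))
    (hA : CoeffBound a b α A) (N : ℕ) :
    ∃ C μ : ℝ, 0 ≤ C ∧ ∀ k m : ℕ, ‖A k * (gaussLog a b k).1 (m + N)‖ ≤
      ((k : ℝ) + 1) ^ (-1 - α - N) * (C * (2 ^ (m + N) * ((m + N : ℕ) + 1 : ℝ) ^ μ)) := by
  obtain ⟨C₀, hC₀0, hC₀⟩ := exists_norm_div_poch_le ha hb hA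
  obtain ⟨C₁, μ₁, hC₁0, hC₁⟩ := norm_mul_gaussLead_le ha hb hA N
  obtain ⟨C₂, hC₂0, hC₂⟩ := exists_norm_digammaSum_le ha hb
  set μ₀ : ℝ := (a + b).re - 2 + (2 * N + 1) with hμ₀
  refine ⟨C₀ * 2 ^ (N + 1) + C₁ * C₂, max μ₀ (μ₁ + 1), by positivity, fun k m => ?_⟩
  set n := m + N with hn
  set κ : ℝ := (k : ℝ) + 1 with hκ
  set ν : ℝ := (n : ℝ) + 1 with hν
  have hν1 : 1 ≤ ν := by rw [hν]; linarith [(Nat.cast_nonneg n : (0 : ℝ) ≤ n)]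
  have hκ0 : 0 < κ := by positivity
  have hν0 : 0 < ν := by linarith
  have hmax0 : ν ^ μ₀ ≤ ν ^ max μ₀ (μ₁ + 1) := Real.rpow_le_rpow_of_exponent_le hν1 (le_max_left _ _)
  have hmax1 : ν ^ (μ₁ + 1) ≤ ν ^ max μ₀ (μ₁ + 1) :=
    Real.rpow_le_rpow_of_exponent_le hν1 (le_max_right _ _)
  have h2n : (1 : ℝ) ≤ 2 ^ n := one_le_pow₀ (by norm_num)
  by_cases h : n < k
  · obtain ⟨i, hi⟩ := Nat.exists_eq_add_of_lt h
    have hki : k - n - 1 = i := by omega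
    have hn' : (n ! : ℝ) ≠ 0 := by positivity
    have e : ‖A k * (gaussLog a b k).1 n‖ =
        ‖A k * (poch a n * poch b n) * ((poch a k)⁻¹ * (poch b k)⁻¹)‖ *
          ((n ! : ℝ)⁻¹ * (i ! : ℝ)) := by
      simp only [gaussLog, h, if_true, norm_mul, norm_pow, norm_neg, norm_one,
        one_pow, norm_inv, Complex.norm_natCast, one_mul, div_eq_mul_inv, mul_inv, hki]
      ring
    -- Here `k = n + 1 + i`. The extra factor `n + 1 + i` of `k!` raises the exponent of the gain to
    -- `N + 1`, and `k + 1 ≤ 2 (i+1)(n+1)` converts powers of `i + 1` into powers of `k + 1`.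
    have hf : (n ! : ℝ) * (i ! : ℝ) * (k ! : ℝ)⁻¹ ≤
        2 ^ (N + 1) * ν ^ (2 * N + 1 : ℝ) * κ ^ (-1 - N : ℝ) := by
      have h1 := factorial_mul_le i m N
      have h2 : k ! = (n + 1 + i) * (n + i)! := by
        rw [hi, show n + i + 1 = (n + i) + 1 by ring, Nat.factorial_succ]
        ring
      have h3 : κ ≤ (i + 1) * (2 * ν) := by
        rw [hκ, hν, hi]
        push_cast
        nlinarith [(Nat.cast_nonneg n : (0 : ℝ) ≤ n), (Nat.cast_nonneg i : (0 : ℝ) ≤ i)]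
      have h4 : (i : ℝ) + 1 ≤ n + 1 + i := by linarith [(Nat.cast_nonneg n : (0 : ℝ) ≤ n)]
      have h5 : (n ! : ℝ) * (i ! : ℝ) * (i + 1) ^ (N + 1) ≤ ν ^ N * (k ! : ℝ) := by
        have h1' : (i ! : ℝ) * (n ! : ℝ) * (i + 1) ^ N ≤ ν ^ N * ((n + i)! : ℝ) := by
          rw [← hn] at h1
          rw [hν]
          exact_mod_cast h1
        rw [h2, pow_succ]
        push_cast
        calc (n ! : ℝ) * (i ! : ℝ) * ((i + 1) ^ N * (i + 1)) =
            ((i ! : ℝ) * (n ! : ℝ) * (i + 1) ^ N) * (i + 1) := by ring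
          _ ≤ (ν ^ N * ((n + i)! : ℝ)) * (n + 1 + i) := by gcongr
          _ = _ := by ring
      rw [show (-1 - N : ℝ) = -((N + 1 : ℕ) : ℝ) by push_cast; ring, Real.rpow_neg hκ0.le,
        Real.rpow_natCast, show (2 * N + 1 : ℝ) = ((2 * N + 1 : ℕ) : ℝ) by push_cast; ring,
        Real.rpow_natCast, ← div_eq_mul_inv, ← div_eq_mul_inv,
        div_le_div_iff₀ (by positivity) (by positivity)]
      calc (n ! : ℝ) * (i ! : ℝ) * κ ^ (N + 1) ≤ (n ! : ℝ) * (i ! : ℝ) * ((i + 1) * (2 * ν)) ^ (N + 1) := by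
            gcongr
        _ = (n ! : ℝ) * (i ! : ℝ) * (i + 1) ^ (N + 1) * (2 * ν) ^ (N + 1) := by
            rw [mul_pow]; ring
        _ ≤ ν ^ N * (k ! : ℝ) * (2 * ν) ^ (N + 1) := by gcongr
        _ = _ := by ring_nf
    rw [e]
    calc _ ≤ C₀ * (κ ^ (-α) * (k ! : ℝ)⁻¹ * ((n ! : ℝ) * (n ! : ℝ) *
          ν ^ ((a + b).re - 2))) * ((n ! : ℝ)⁻¹ * (i ! : ℝ)) := by
          gcongr
          exact hC₀ k n
      _ = C₀ * (κ ^ (-α) * ν ^ ((a + b).re - 2) * ((n ! : ℝ) * (i ! : ℝ) * (k ! : ℝ)⁻¹)) := by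
          field_simp
      _ ≤ C₀ * (κ ^ (-α) * ν ^ ((a + b).re - 2) *
          (2 ^ (N + 1) * ν ^ (2 * N + 1 : ℝ) * κ ^ (-1 - N : ℝ))) := by
          gcongr
      _ = κ ^ (-1 - α - N) * ((C₀ * 2 ^ (N + 1)) * (1 * ν ^ μ₀)) := by
          rw [hμ₀, Real.rpow_add hν0 ((a + b).re - 2), show -1 - α - N = -α + (-1 - N) by ring, Real.rpow_add hκ0]
          ring
      _ ≤ _ := by
          gcongr
          have : 0 ≤ C₁ * C₂ := by positivity
          linarith
  · have e : (gaussLog a b k).1 n = gaussLead a b k n * digammaSum a b k n := by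
      simp [gaussLog, h]
    rw [e, ← mul_assoc, norm_mul]
    calc _ ≤ (κ ^ (-1 - α - N) * (C₁ * (2 ^ n * ν ^ μ₁))) * (C₂ * ν) := by
          gcongr
          · exact hC₁ k n
          · exact hC₂ k n (not_lt.1 h)
      _ = κ ^ (-1 - α - N) * ((C₁ * C₂) * (2 ^ n * ν ^ (μ₁ + 1))) := by
          rw [Real.rpow_add_one hν0.ne']
          ring
      _ ≤ _ := by
          gcongr
          have : 0 ≤ C₀ * 2 ^ (N + 1) := by positivity
          linarith

end

section

/-! ### Rearrangement of the double series -/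

theorem exists_hasSum_swap {f : ℕ → ℕ → ℂ} {U V : ℕ → ℝ} (hU : Summable U) (hV : Summable V)
    (hU0 : ∀ m, 0 ≤ U m) (hV0 : ∀ k, 0 ≤ V k) (h : ∀ k m, ‖f k m‖ ≤ V k * U m) {g e : ℕ → ℂ}
    (hg : ∀ k, HasSum (fun m => f k m) (g k)) (he : ∀ m, HasSum (fun k => f k m) (e m)) :
    ∃ S, HasSum g S ∧ HasSum e S := by
  have hs : Summable fun x : ℕ × ℕ => f x.1 x.2 :=
    Summable.of_norm_bounded (hV.mul_of_nonneg hU hV0 hU0) fun x => h x.1 x.2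
  refine ⟨∑' x : ℕ × ℕ, f x.1 x.2, hs.hasSum.prod_fiberwise hg, ?_⟩
  have h2 : HasSum (fun x : ℕ × ℕ => f x.2 x.1) (∑' x : ℕ × ℕ, f x.1 x.2) :=
    (Equiv.prodComm ℕ ℕ).hasSum_iff.2 hs.hasSum
  exact h2.prod_fiberwise he

/-- Lagrange interpolation at `N` nodes in `Ω` writes every value as a fixed linear combination of
the values at the nodes, and this passes to the sum of the series. -/
theorem exists_polynomial_of_hasSum {N : ℕ} {Ω : Set ℂ} (hΩ : Ω.Infinite) {Q : ℕ → Polynomial ℂ}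
    (hQ : ∀ k, Q k ∈ Polynomial.degreeLT ℂ N) {R : ℂ → ℂ}
    (h : ∀ w ∈ Ω, HasSum (fun k => (Q k).eval w) (R w)) :
    ∃ P ∈ Polynomial.degreeLT ℂ N, ∀ w ∈ Ω, R w = P.eval w := by
  obtain ⟨s, hs, hcard⟩ := hΩ.exists_subset_card_eq N
  refine ⟨Lagrange.interpolate s id R, ?_, fun w hw => ?_⟩
  · rw [Polynomial.mem_degreeLT, ← hcard]
    exact Lagrange.degree_interpolate_lt _ Function.injective_id.injOn
  · refine (h w hw).unique ?_
    have h1 : ∀ k, (Q k).eval w = ∑ i ∈ s, (Q k).eval i * (Lagrange.basis s id i).eval w := by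
      intro k
      have h2 := Lagrange.eq_interpolate (f := Q k) (s := s) (v := id)
        Function.injective_id.injOn (by rw [hcard]; exact Polynomial.mem_degreeLT.1 (hQ k))
      conv_lhs => rw [h2, Lagrange.interpolate_apply]
      simp [Polynomial.eval_finsetSum]
    simp only [h1, Lagrange.interpolate_apply, Polynomial.eval_finsetSum, Polynomial.eval_mul,
      Polynomial.eval_C]
    exact hasSum_sum fun i hi => (h i (hs hi)).mul_right _

theorem summable_succ_rpow {θ : ℝ} (h : θ < -1) : Summable fun k : ℕ => ((k : ℝ) + 1) ^ θ :=
  summable_of_isBigO_nat (Real.summable_nat_rpow.2 h) (isTheta_succ_rpow θ).1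

theorem summable_two_pow_mul {μ r : ℝ} (hr0 : 0 ≤ r) (hr : r < 1 / 2) :
    Summable fun n : ℕ => 2 ^ n * ((n : ℝ) + 1) ^ μ * r ^ n := by
  have h1 : (fun n : ℕ => (((((n : ℝ) + 1) ^ μ : ℝ)) : ℂ)) =O[atTop] fun n : ℕ => (n : ℝ) ^ μ := by
    refine IsBigO.trans (IsBigO.of_bound 1 ?_) (isTheta_succ_rpow μ).1
    simp
  have h2 := convBelow_one_of_isBigO h1 (2 * r) (by linarith) (by linarith)
  refine h2.congr fun n => ?_
  rw [Complex.norm_real, Real.norm_of_nonneg (by positivity), mul_pow]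
  ring

variable {a b : ℂ} {A h : ℕ → ℂ} {α : ℝ} {N : ℕ}

theorem hasSum_mul_gaussLead (a b : ℂ) (A : ℕ → ℂ) (n : ℕ) :
    HasSum (fun k => A k * gaussLead a b k n) (∑ k ∈ range (n + 1), A k * gaussLead a b k n) := by
  refine hasSum_sum_of_ne_finset_zero fun k hk => ?_
  rw [mem_range, not_lt] at hk
  simp [gaussLead, show n < k by omega]

theorem infinite_ball_inter : {w : ℂ | 1 - w ∈ lens ∧ ‖w‖ < 1 / 2}.Infinite := by
  refine Set.Infinite.mono (s := (fun t : ℝ => (t : ℂ)) '' Set.Ioo 0 (1 / 2)) ?_ ?_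
  · rintro _ ⟨t, ht, rfl⟩
    refine ⟨one_sub_ofReal_mem_lens ⟨ht.1, by linarith [ht.2]⟩, ?_⟩
    rw [Complex.norm_real, Real.norm_of_nonneg ht.1.le]
    exact ht.2
  · exact (Set.Ioo_infinite (by norm_num)).image Complex.ofReal_injective.injOn

theorem HasSum.tail {f : ℕ → ℂ} {s : ℂ} (hf : HasSum f s) (N : ℕ) :
    HasSum (fun m => f (m + N)) (s - ∑ n ∈ range N, f n) := (hasSum_nat_add_iff' N).2 hf

theorem hasSum_of_tail {f : ℕ → ℂ} {s : ℂ} (N : ℕ) (hf : HasSum (fun m => f (m + N)) s) :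
    HasSum f (s + ∑ n ∈ range N, f n) := (hasSum_nat_add_iff N).1 hf

theorem summable_rpow_mul_pow {μ r : ℝ} (hr0 : 0 ≤ r) (hr : r < 1) :
    Summable fun n : ℕ => ((n : ℝ) + 1) ^ μ * r ^ n := by
  have h1 : (fun n : ℕ => (((((n : ℝ) + 1) ^ μ : ℝ)) : ℂ)) =O[atTop] fun n : ℕ => (n : ℝ) ^ μ := by
    refine IsBigO.trans (IsBigO.of_bound 1 ?_) (isTheta_succ_rpow μ).1
    simp
  refine (convBelow_one_of_isBigO h1 r hr0 hr).congr fun n => ?_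
  rw [Complex.norm_real, Real.norm_of_nonneg (by positivity)]

/-- Both orders of summation of the double series over `k` and `n ≥ N`: by rows it gives Gauss
functions without their first `N` terms, by columns the tail of the given power series. -/
theorem exists_hasSum_gaussCoeff_tail (hA : CoeffBound a b α A) (hα : 0 < α + N)
    (hh : ∀ n, N ≤ n → HasSum (fun k => A k * gaussCoeff a b k n) (h n)) {z : ℂ} (hz : ‖z‖ < 1) :
    ∃ S : ℂ, HasSum (fun k => A k * (powSum (gaussCoeff a b k) z -
        ∑ n ∈ range N, gaussCoeff a b k n * z ^ n)) S ∧
      HasSum (fun m => h (m + N) * z ^ (m + N)) S := by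
  have hV : Summable fun k : ℕ => ((k : ℝ) + 1) ^ (-1 - α - N) := summable_succ_rpow (by linarith)
  obtain ⟨C, μ, hC0, hC⟩ := exists_norm_mul_gaussCoeff_le hA N
  have hU : Summable fun m : ℕ => C * (((m + N : ℕ) + 1 : ℝ) ^ μ * ‖z‖ ^ (m + N)) :=
    ((summable_nat_add_iff (f := fun n : ℕ => ((n : ℝ) + 1) ^ μ * ‖z‖ ^ n) N).2
      (summable_rpow_mul_pow (norm_nonneg z) hz)).mul_left C
  have hg : ∀ k, HasSum (fun m => A k * (gaussCoeff a b k (m + N) * z ^ (m + N)))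
      (A k * (powSum (gaussCoeff a b k) z - ∑ n ∈ range N, gaussCoeff a b k n * z ^ n)) := fun k =>
    (HasSum.tail ((convBelow_gaussCoeff a b k).hasSum hz) N).mul_left (A k)
  have he : ∀ m, HasSum (fun k => A k * (gaussCoeff a b k (m + N) * z ^ (m + N)))
      (h (m + N) * z ^ (m + N)) := fun m =>
    HasSum.congr_of_eq ((hh (m + N) (Nat.le_add_left N m)).mul_right (z ^ (m + N)))
      (fun k => (mul_assoc _ _ _).symm) rfl
  refine exists_hasSum_swap hU hV (fun m => by positivity) (fun k => by positivity) (fun k m => ?_)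
    hg he
  rw [← mul_assoc, norm_mul, norm_pow]
  calc _ ≤ (((k : ℝ) + 1) ^ (-1 - α - N) * (C * ((m + N : ℕ) + 1 : ℝ) ^ μ)) * ‖z‖ ^ (m + N) :=
        mul_le_mul_of_nonneg_right (hC k m) (by positivity)
    _ = _ := by ring

theorem exists_hasSum_gaussLog_tail (ha : ∀ m : ℕ, a ≠ -(m : ℂ)) (hb : ∀ m : ℕ, b ≠ -(m : ℂ))
    (hA : CoeffBound a b α A) (hα : 0 < α + N) {y : ℕ → ℂ}
    (hy : ∀ n, N ≤ n → HasSum (fun k => A k * (gaussLog a b k).1 n) (y n)) {w : ℂ}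
    (hw : ‖w‖ < 1 / 2) (ℓ : ℂ) :
    ∃ S : ℂ, HasSum (fun k => A k * (powSum (gaussLog a b k).1 w - ℓ * powSum (gaussLog a b k).2 w -
        ∑ n ∈ range N, ((gaussLog a b k).1 n - ℓ * gaussLead a b k n) * w ^ n)) S ∧
      HasSum (fun m => (y (m + N) - ℓ * ∑ k ∈ range (m + N + 1), A k * gaussLead a b k (m + N)) *
        w ^ (m + N)) S := by
  have hV : Summable fun k : ℕ => ((k : ℝ) + 1) ^ (-1 - α - N) := summable_succ_rpow (by linarith)
  obtain ⟨C₁, μ₁, hC₁0, hC₁⟩ := norm_mul_gaussLog_le ha hb hA N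
  obtain ⟨C₂, μ₂, hC₂0, hC₂⟩ := norm_mul_gaussLead_le ha hb hA N
  have hU' : ∀ μ : ℝ, Summable fun m : ℕ => 2 ^ (m + N) * ((m + N : ℕ) + 1 : ℝ) ^ μ * ‖w‖ ^ (m + N) :=
    fun μ => (summable_nat_add_iff (f := fun n : ℕ => 2 ^ n * ((n : ℝ) + 1) ^ μ * ‖w‖ ^ n) N).2
      (summable_two_pow_mul (norm_nonneg w) hw)
  have hU := ((hU' μ₁).mul_left C₁).add ((hU' μ₂).mul_left (‖ℓ‖ * C₂))
  have hw1 : ‖w‖ < 1 := hw.trans (by norm_num)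
  have hg : ∀ k, HasSum (fun m => A k * (((gaussLog a b k).1 (m + N) - ℓ * gaussLead a b k (m + N)) *
      w ^ (m + N))) (A k * (powSum (gaussLog a b k).1 w - ℓ * powSum (gaussLog a b k).2 w -
        ∑ n ∈ range N, ((gaussLog a b k).1 n - ℓ * gaussLead a b k n) * w ^ n)) := by
    intro k
    have hc := conv_gaussLog k ha hb
    have h5 : HasSum (fun n => ((gaussLog a b k).1 n - ℓ * gaussLead a b k n) * w ^ n)
        (powSum (gaussLog a b k).1 w - ℓ * powSum (gaussLog a b k).2 w) :=
      HasSum.congr_of_eq ((hc.1.hasSum hw1).sub ((hc.2.hasSum hw1).mul_left ℓ))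
        (fun n => by rw [sub_mul, mul_assoc]; rfl) rfl
    exact (HasSum.tail h5 N).mul_left (A k)
  have he : ∀ m, HasSum (fun k => A k * (((gaussLog a b k).1 (m + N) - ℓ * gaussLead a b k (m + N)) *
      w ^ (m + N))) ((y (m + N) - ℓ * ∑ k ∈ range (m + N + 1), A k * gaussLead a b k (m + N)) *
        w ^ (m + N)) := by
    intro m
    have h5 := ((hy (m + N) (Nat.le_add_left N m)).sub
      ((hasSum_mul_gaussLead a b A (m + N)).mul_left ℓ)).mul_right (w ^ (m + N))
    exact HasSum.congr_of_eq h5 (fun k => by ring) rfl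
  refine exists_hasSum_swap hU hV (fun m => by positivity) (fun k => by positivity) (fun k m => ?_)
    hg he
  rw [← mul_assoc, norm_mul, norm_pow, mul_sub, mul_left_comm]
  have hn : ‖ℓ * (A k * gaussLead a b k (m + N))‖ ≤
      ‖ℓ‖ * (((k : ℝ) + 1) ^ (-1 - α - N) * (C₂ * (2 ^ (m + N) * ((m + N : ℕ) + 1 : ℝ) ^ μ₂))) := by
    rw [norm_mul]
    exact mul_le_mul_of_nonneg_left (hC₂ k (m + N)) (norm_nonneg ℓ)
  calc _ ≤ ((((k : ℝ) + 1) ^ (-1 - α - N) * (C₁ * (2 ^ (m + N) * ((m + N : ℕ) + 1 : ℝ) ^ μ₁))) +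
      ‖ℓ‖ * (((k : ℝ) + 1) ^ (-1 - α - N) * (C₂ * (2 ^ (m + N) * ((m + N : ℕ) + 1 : ℝ) ^ μ₂)))) *
        ‖w‖ ^ (m + N) :=
        mul_le_mul_of_nonneg_right ((norm_sub_le _ _).trans (add_le_add (hC₁ k m) hn)) (by positivity)
    _ = _ := by ring

/-- The part of index `≥ N` of the double series, expanded at `0` and at `1`. -/
theorem exists_hasSum_tails (ha : ∀ m : ℕ, a ≠ -(m : ℂ)) (hb : ∀ m : ℕ, b ≠ -(m : ℂ))
    (hA : CoeffBound a b α A) (hα : 0 < α + N)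
    (hh : ∀ n, N ≤ n → HasSum (fun k => A k * gaussCoeff a b k n) (h n)) {y : ℕ → ℂ}
    (hy : ∀ n, N ≤ n → HasSum (fun k => A k * (gaussLog a b k).1 n) (y n))
    {z : ℂ} (hz : z ∈ lens) (hw : ‖1 - z‖ < 1 / 2) :
    ∃ S₀ S₁ : ℂ, HasSum (fun m => h (m + N) * z ^ (m + N)) S₀ ∧
      HasSum (fun m => (y (m + N) - Complex.log (1 - z) *
        ∑ k ∈ range (m + N + 1), A k * gaussLead a b k (m + N)) * (1 - z) ^ (m + N)) S₁ ∧
      HasSum (fun k => A k * (∑ n ∈ range N, ((gaussLog a b k).1 n - Complex.log (1 - z) *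
        gaussLead a b k n) * (1 - z) ^ n - ∑ n ∈ range N, gaussCoeff a b k n * z ^ n)) (S₀ - S₁) := by
  obtain ⟨S₀, h1, h2⟩ := exists_hasSum_gaussCoeff_tail hA hα hh (mem_lens.1 hz).1
  obtain ⟨S₁, h3, h4⟩ := exists_hasSum_gaussLog_tail ha hb hA hα hy hw (Complex.log (1 - z))
  refine ⟨S₀, S₁, h2, h4, HasSum.congr_of_eq (h1.sub h3) (fun k => ?_) rfl⟩
  rw [powSum_gaussCoeff_eq k ha hb hz, LogSeq.val]
  ring

theorem exists_hasSum_mul_gaussLog (ha : ∀ m : ℕ, a ≠ -(m : ℂ)) (hb : ∀ m : ℕ, b ≠ -(m : ℂ))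
    (hA : CoeffBound a b α A) (hα : 0 < α + N) :
    ∃ y : ℕ → ℂ, ConvBelow (1 / 2) y ∧
      ∀ n, N ≤ n → HasSum (fun k => A k * (gaussLog a b k).1 n) (y n) := by
  have hV : Summable fun k : ℕ => ((k : ℝ) + 1) ^ (-1 - α - N) := summable_succ_rpow (by linarith)
  obtain ⟨C, μ, hC0, hC⟩ := norm_mul_gaussLog_le ha hb hA N
  refine ⟨fun n => ∑' k, A k * (gaussLog a b k).1 n, fun r hr0 hr => ?_, fun n hn => ?_⟩
  · refine (summable_nat_add_iff N).1 ?_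
    have hs := ((summable_nat_add_iff N).2 (summable_two_pow_mul (μ := μ) hr0 hr)).mul_left
      ((∑' k : ℕ, ((k : ℝ) + 1) ^ (-1 - α - N)) * C)
    refine Summable.of_nonneg_of_le (fun m => by positivity) (fun m => ?_) hs
    have h1 := tsum_of_norm_bounded (hV.mul_right _).hasSum fun k => hC k m
    rw [tsum_mul_right] at h1
    calc _ ≤ ((∑' k : ℕ, ((k : ℝ) + 1) ^ (-1 - α - N)) *
          (C * (2 ^ (m + N) * ((m + N : ℕ) + 1 : ℝ) ^ μ))) * r ^ (m + N) := by gcongr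
      _ = _ := by ring
  · obtain ⟨m, rfl⟩ := Nat.exists_eq_add_of_le' hn
    exact (Summable.of_norm_bounded (hV.mul_right _) fun k => hC k m).hasSum

theorem convBelow_sum_gaussLead (ha : ∀ m : ℕ, a ≠ -(m : ℂ)) (hb : ∀ m : ℕ, b ≠ -(m : ℂ))
    (hA : CoeffBound a b α A) (hα : 0 < α + N) :
    ConvBelow (1 / 2) fun n => ∑ k ∈ range (n + 1), A k * gaussLead a b k n := by
  intro r hr0 hr
  have hV : Summable fun k : ℕ => ((k : ℝ) + 1) ^ (-1 - α - N) := summable_succ_rpow (by linarith)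
  obtain ⟨C, μ, hC0, hC⟩ := norm_mul_gaussLead_le ha hb hA N
  have hs := (summable_two_pow_mul (μ := μ) hr0 hr).mul_left
    ((∑' k : ℕ, ((k : ℝ) + 1) ^ (-1 - α - N)) * C)
  refine Summable.of_nonneg_of_le (fun m => by positivity) (fun m => ?_) hs
  have h1 := tsum_of_norm_bounded (hV.mul_right _).hasSum fun k => hC k m
  rw [tsum_mul_right, (hasSum_mul_gaussLead a b A m).tsum_eq] at h1
  calc _ ≤ ((∑' k : ℕ, ((k : ℝ) + 1) ^ (-1 - α - N)) *
        (C * (2 ^ m * ((m : ℝ) + 1) ^ μ))) * r ^ m := by gcongr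
    _ = _ := by ring

/-- The expansion at `1` near `1`. -/
theorem exists_expansion (ha : ∀ m : ℕ, a ≠ -(m : ℂ)) (hb : ∀ m : ℕ, b ≠ -(m : ℂ))
    (hA : CoeffBound a b α A) (hα : 0 < α + N)
    (hh : ∀ n, N ≤ n → HasSum (fun k => A k * gaussCoeff a b k n) (h n)) :
    ∃ y : LogSeq, (∀ n, N ≤ n → HasSum (fun k => A k * (gaussLog a b k).1 n) (y.1 n)) ∧
      (∀ n, y.2 n = ∑ k ∈ range (n + 1), A k * gaussLead a b k n) ∧ LogSeq.Conv (1 / 2) y ∧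
      ∀ z ∈ lens, ‖1 - z‖ < 1 / 2 → HasSum (fun n => h n * z ^ n) (LogSeq.val y z) := by
  obtain ⟨y₀, hy₀c, hy₀⟩ := exists_hasSum_mul_gaussLog ha hb hA hα
  have hq := convBelow_sum_gaussLead ha hb hA hα
  set q : ℕ → ℂ := fun n => ∑ k ∈ range (n + 1), A k * gaussLead a b k n with hqdef
  choose! S₀ S₁ hS₀ hS₁ hS using fun (z : ℂ) (hz : z ∈ lens ∧ ‖1 - z‖ < 1 / 2) =>
    exists_hasSum_tails ha hb hA hα hh hy₀ hz.1 hz.2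
  -- The first `N` terms at `z = 0`, written in `w = 1 - z`; they are prescribed and need not be
  -- sums over `k`.
  let H : Polynomial ℂ := ∑ n ∈ range N, Polynomial.C (h n) * (1 - Polynomial.X) ^ n
  have hX : ∀ n, n < N → (1 - Polynomial.X : Polynomial ℂ) ^ n ∈ Polynomial.degreeLT ℂ N := by
    intro n hn
    rw [Polynomial.mem_degreeLT]
    refine (Polynomial.degree_pow_le_of_le n (a := 1) ?_).trans_lt ?_
    · refine (Polynomial.degree_sub_le _ _).trans ?_
      simp
    · simpa using hn
  have hX' : ∀ n, n < N → (Polynomial.X : Polynomial ℂ) ^ n ∈ Polynomial.degreeLT ℂ N := by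
    intro n hn
    rw [Polynomial.mem_degreeLT]
    simpa using hn
  have hC : ∀ (c : ℂ) (P : Polynomial ℂ), P ∈ Polynomial.degreeLT ℂ N →
      Polynomial.C c * P ∈ Polynomial.degreeLT ℂ N := by
    intro c P hP
    rw [← Polynomial.smul_eq_C_mul]
    exact Submodule.smul_mem _ _ hP
  -- The logarithmic heads are finite sums over `k` and can be subtracted separately. What remains
  -- of `S₀ - S₁` is a convergent series of polynomials of degree below `N` in `w`.
  obtain ⟨P, hP, hPe⟩ := exists_polynomial_of_hasSum infinite_ball_inter (N := N)
    (Q := fun k => Polynomial.C (A k) *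
      (∑ n ∈ range N, Polynomial.C ((gaussLog a b k).1 n) * Polynomial.X ^ n -
        ∑ n ∈ range N, Polynomial.C (gaussCoeff a b k n) * (1 - Polynomial.X) ^ n))
    (R := fun w => S₀ (1 - w) - S₁ (1 - w) + Complex.log w * ∑ n ∈ range N, q n * w ^ n)
    (fun k => hC _ _ (Submodule.sub_mem _
      (Submodule.sum_mem _ fun n hn => hC _ _ (hX' n (mem_range.1 hn)))
      (Submodule.sum_mem _ fun n hn => hC _ _ (hX n (mem_range.1 hn))))) (by
      rintro w ⟨hw1, hw2⟩
      have hl := hS (1 - w) ⟨hw1, by simpa using hw2⟩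
      simp only [sub_sub_cancel] at hl
      have hlog : HasSum (fun k => Complex.log w * ∑ n ∈ range N, A k * gaussLead a b k n * w ^ n)
          (Complex.log w * ∑ n ∈ range N, q n * w ^ n) :=
        (hasSum_sum fun n _ => (hasSum_mul_gaussLead a b A n).mul_right (w ^ n)).mul_left _
      refine HasSum.congr_of_eq (hl.add hlog) (fun k => ?_) rfl
      simp only [Polynomial.eval_mul, Polynomial.eval_C, Polynomial.eval_sub, Polynomial.eval_one,
        Polynomial.eval_finsetSum, Polynomial.eval_pow, Polynomial.eval_X]
      simp only [sub_mul, sum_sub_distrib, mul_sub, mul_assoc, mul_sum]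
      rw [sum_congr rfl fun n _ => mul_left_comm (Complex.log w) (A k) _]
      ring)
  have hH : P + H ∈ Polynomial.degreeLT ℂ N := Submodule.add_mem _ hP
    (Submodule.sum_mem _ fun n hn => hC _ _ (hX n (mem_range.1 hn)))
  have heval : ∀ w, (P + H).eval w = ∑ n ∈ range N, (P + H).coeff n * w ^ n := by
    intro w
    rcases eq_or_ne (P + H) 0 with h0 | h0
    · simp [h0]
    · exact Polynomial.eval_eq_sum_range'
        ((Polynomial.natDegree_lt_iff_degree_lt h0).2 (Polynomial.mem_degreeLT.1 hH)) w
  -- The polynomial `P + H` supplies the logarithm-free coefficients whose defining series over `k`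
  -- may diverge.
  set y₁ : ℕ → ℂ := fun n => if n < N then (P + H).coeff n else y₀ n with hy₁
  have hy₁c : ConvBelow (1 / 2) y₁ := by
    refine convBelow_of_isBigO hy₀c (EventuallyEq.isBigO ?_)
    filter_upwards [eventually_ge_atTop N] with n hn
    simp [hy₁, not_lt.2 hn]
  refine ⟨(y₁, q), fun n hn => by simpa [hy₁, not_lt.2 hn] using hy₀ n hn, fun n => rfl, ⟨hy₁c, hq⟩,
    fun z hz hw => ?_⟩
  have e1 := hasSum_of_tail (f := fun n => h n * z ^ n) N (hS₀ z ⟨hz, hw⟩)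
  have e2 : HasSum (fun n => (y₁ n - Complex.log (1 - z) * q n) * (1 - z) ^ n)
      (LogSeq.val (y₁, q) z) := by
    refine HasSum.congr_of_eq ((hy₁c.hasSum hw).sub ((hq.hasSum hw).mul_left (Complex.log (1 - z))))
      (fun n => by ring) rfl
  have e3 : HasSum (fun m => (y₁ (m + N) - Complex.log (1 - z) * q (m + N)) * (1 - z) ^ (m + N))
      (S₁ z) := by
    refine HasSum.congr_of_eq (hS₁ z ⟨hz, hw⟩) (fun m => ?_) rfl
    simp [hy₁, hqdef]
  have e4 := e2.unique (hasSum_of_tail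
    (f := fun n => (y₁ n - Complex.log (1 - z) * q n) * (1 - z) ^ n) N e3)
  have e5 := hPe (1 - z) ⟨by simpa using hz, hw⟩
  simp only [sub_sub_cancel] at e5
  have e6 := heval (1 - z)
  rw [Polynomial.eval_add, ← e5] at e6
  refine HasSum.congr_of_eq e1 (fun n => rfl) ?_
  rw [e4]
  have e7 : ∑ n ∈ range N, (y₁ n - Complex.log (1 - z) * q n) * (1 - z) ^ n =
      ∑ n ∈ range N, (P + H).coeff n * (1 - z) ^ n -
        Complex.log (1 - z) * ∑ n ∈ range N, q n * (1 - z) ^ n := by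
    rw [mul_sum, ← sum_sub_distrib]
    refine sum_congr rfl fun n hn => ?_
    simp only [hy₁, mem_range.1 hn, if_true]
    ring
  have e8 : H.eval (1 - z) = ∑ n ∈ range N, h n * z ^ n := by
    simp [H, Polynomial.eval_finsetSum]
  rw [e7, ← e6, e8]
  ring

end

/-! ### The expansion of the hypergeometric series near `z = 1` -/

/-- The Taylor coefficients of `_{q+2}F_{q+1}`, multiplied by `gammaFactor (q + 1) a b`. -/
noncomputable def taylorCoeff (q : ℕ) (a b : ℕ → ℂ) (n : ℕ) : ℂ :=
  (∏ j ∈ Icc 1 (q + 2), Complex.Gamma (a j + n)) / (∏ j ∈ Icc 1 (q + 1), Complex.Gamma (b j + n)) /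
    (n ! : ℂ)

theorem Icc_one_eq_insert (q : ℕ) : Icc 1 (q + 2) = insert 1 (insert 2 (Icc 3 (q + 2))) := by
  ext j
  simp only [mem_Icc, mem_insert]
  omega

theorem prod_Icc_one (q : ℕ) (f : ℕ → ℂ) :
    ∏ j ∈ Icc 1 (q + 2), f j = f 1 * (f 2 * ∏ j ∈ Icc 3 (q + 2), f j) := by
  rw [Icc_one_eq_insert, prod_insert (by simp), prod_insert (by simp)]

theorem sum_Icc_one (q : ℕ) (f : ℕ → ℂ) :
    ∑ j ∈ Icc 1 (q + 2), f j = f 1 + (f 2 + ∑ j ∈ Icc 3 (q + 2), f j) := by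
  rw [Icc_one_eq_insert, sum_insert (by simp), sum_insert (by simp)]

variable {q : ℕ} {a b : ℕ → ℂ}

theorem total_eq (hs : ∑ j ∈ Icc 1 (q + 1), b j - ∑ j ∈ Icc 1 (q + 2), a j = 0) :
    total q a b = a 1 + a 2 := by
  rw [sum_Icc_one] at hs
  rw [total]
  linear_combination hs

theorem gammaFactor_mul_hypTerm (ha : ∀ j ∈ Icc 1 (q + 2), ∀ m : ℕ, a j ≠ -(m : ℂ))
    (hb : ∀ j ∈ Icc 1 (q + 1), ∀ m : ℕ, b j ≠ -(m : ℂ)) (z : ℂ) (n : ℕ) :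
    gammaFactor (q + 1) a b * hypTerm (q + 1) a b z n = taylorCoeff q a b n * z ^ n := by
  have h1 : ∏ j ∈ Icc 1 (q + 2), Complex.Gamma (a j + n) =
      (∏ j ∈ Icc 1 (q + 2), Complex.Gamma (a j)) * ∏ j ∈ Icc 1 (q + 2), poch (a j) n := by
    rw [← prod_mul_distrib]
    exact prod_congr rfl fun j hj => (Gamma_mul_poch (ha j hj) n).symm
  have h2 : ∏ j ∈ Icc 1 (q + 1), Complex.Gamma (b j + n) =
      (∏ j ∈ Icc 1 (q + 1), Complex.Gamma (b j)) * ∏ j ∈ Icc 1 (q + 1), poch (b j) n := by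
    rw [← prod_mul_distrib]
    exact prod_congr rfl fun j hj => (Gamma_mul_poch (hb j hj) n).symm
  rw [gammaFactor, hypTerm, taylorCoeff, h1, h2]
  simp only [div_eq_mul_inv, mul_inv]
  ring

theorem coeffBound_levelCoeff (hs : total q a b = a 1 + a 2) {α : ℝ}
    (hα : ∀ j ∈ Icc 3 (q + 2), α < (a j).re) : CoeffBound (a 1) (a 2) α (levelCoeff q a b) := by
  have h1 := (symbolUpTo_levelCoeff q a b hα 0).isBigO
  rw [hs] at h1
  refine exists_norm_le_of_isBigO (g := fun k => (k ! : ℝ)) (fun k => by positivity) ?_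
  refine IsBigO.trans (EventuallyEq.isBigO ?_) ((h1.mul (isTheta_Gamma (a 1 + a 2)).1).trans
    (EventuallyEq.isBigO ?_))
  · filter_upwards [eventually_not_pole (a 1 + a 2)] with k hk
    rw [div_mul_cancel₀ _ (Complex.Gamma_ne_zero hk)]
  · filter_upwards [eventually_gt_atTop 0] with k hk
    have hk' : (0 : ℝ) < k := by exact_mod_cast hk
    rw [show (a 1 + a 2).re - 2 - α = (-1 - α) + ((a 1 + a 2).re - 1) by ring, Real.rpow_add hk']
    ring

/-- The inverse factorial expansion is used with all parameters shifted by `n`. Vanishing of the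
balance makes the sum of the remaining parameters equal to `a 1 + a 2`, so the terms are Gauss
coefficients. -/
theorem hasSum_taylorCoeff (hs : total q a b = a 1 + a 2) {n : ℕ}
    (hn : ∀ j ∈ Icc 3 (q + 2), 0 < (a j + n).re) :
    HasSum (fun k => levelCoeff q a b k * gaussCoeff (a 1) (a 2) k n) (taylorCoeff q a b n) := by
  have h := (hasSum_levelCoeff q (fun j => a j + n) (fun j => b j + n) hn).mul_left
    (Complex.Gamma (a 1 + n) * Complex.Gamma (a 2 + n) / (n ! : ℂ))
  rw [levelCoeff_add_nat, total_add_nat, hs] at h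
  refine HasSum.congr_of_eq h (fun k => ?_) ?_
  · rw [gaussCoeff]
    simp only [div_eq_mul_inv, mul_inv]
    ring
  · rw [taylorCoeff, prod_Icc_one]
    simp only [div_eq_mul_inv]
    ring

theorem levelCoeff_zero (q : ℕ) (a b : ℕ → ℂ) : levelCoeff q a b 0 = 1 := by
  induction q generalizing a b with
  | zero => simp [levelCoeff, unitSeq]
  | succ q ih => rw [levelCoeff, raise_zero, ih]

/-- The constants `T_n` for given logarithm-free coefficients `y`. -/
noncomputable def tailConst (a A y : ℕ → ℂ) (n : ℕ) : ℂ :=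
  (-1) ^ n * (n ! : ℂ) / (poch (a 1) n * poch (a 2) n) *
    (y n - ∑ k ∈ range (n + 1), A k * (gaussLog (a 1) (a 2) k).1 n)

/-- `tailConst` is obtained by solving this equation for `T`; it needs no convergence. -/
theorem expansionTerm_eq (ha1 : ∀ m : ℕ, a 1 ≠ -(m : ℂ)) (ha2 : ∀ m : ℕ, a 2 ≠ -(m : ℂ)) (A : ℕ → ℂ)
    (y : LogSeq) {n : ℕ} (hy : y.2 n = ∑ k ∈ range (n + 1), A k * gaussLead (a 1) (a 2) k n) (z : ℂ) :
    expansionTerm a A (tailConst a A y.1 n) z n =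
      (y.1 n - Complex.log (1 - z) * y.2 n) * (1 - z) ^ n := by
  have h1 := poch_ne_zero ha1 n
  have h2 := poch_ne_zero ha2 n
  have h3 := factorial_ne_zero' n
  have h4 : ((-1 : ℂ) ^ n) * (-1) ^ n = 1 := by rw [← mul_pow]; simp
  rw [expansionTerm]
  congr 1
  have e1 : poch (a 1) n * poch (a 2) n / ((n ! : ℂ) * (n ! : ℂ)) *
      ∑ k ∈ range (n + 1), poch (-(n : ℂ)) k / (poch (a 1) k * poch (a 2) k) * A k *
        (Complex.digamma (1 + n - k) + Complex.digamma (1 + n) - Complex.digamma (a 1 + n)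
          - Complex.digamma (a 2 + n) - Complex.log (1 - z)) =
      ∑ k ∈ range (n + 1), A k * (gaussLog (a 1) (a 2) k).1 n - Complex.log (1 - z) * y.2 n := by
    rw [hy, mul_sum, mul_sum, ← sum_sub_distrib]
    refine sum_congr rfl fun k hk => ?_
    have hk' : k ≤ n := by simpa [Nat.lt_succ_iff] using hk
    have hl : gaussLead (a 1) (a 2) k n = poch (a 1) n * poch (a 2) n / ((n ! : ℂ) * (n ! : ℂ)) *
        (poch (-(n : ℂ)) k / (poch (a 1) k * poch (a 2) k)) := by
      have h5 := poch_neg_div hk'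
      rw [div_eq_iff h3] at h5
      rw [h5]
      simp only [gaussLead, not_lt.2 hk', if_false]
      have h6 := factorial_ne_zero' (n - k)
      have h7 := poch_ne_zero ha1 k
      have h8 := poch_ne_zero ha2 k
      field_simp
    simp only [gaussLog, not_lt.2 hk', if_false, hl, digammaSum]
    ring
  rw [mul_add, e1, tailConst]
  field_simp
  linear_combination (y.1 n - ∑ k ∈ range (n + 1), A k * (gaussLog (a 1) (a 2) k).1 n) * h4

/-- The terms `k ≤ n` carry the digamma values; those with `k > n` are the finite parts of the Gauss
expansions, and up to the common factor they form the series for `T n`. -/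
theorem hasSum_tailTerm (ha1 : ∀ m : ℕ, a 1 ≠ -(m : ℂ)) (ha2 : ∀ m : ℕ, a 2 ≠ -(m : ℂ))
    {A y : ℕ → ℂ} {n : ℕ} (h : HasSum (fun k => A k * (gaussLog (a 1) (a 2) k).1 n) (y n)) :
    HasSum (tailTerm a A n) (tailConst a A y n) := by
  have h1 := (HasSum.tail h (n + 1)).mul_left ((-1) ^ n * (n ! : ℂ) / (poch (a 1) n * poch (a 2) n))
  refine HasSum.congr_of_eq h1 (fun i => ?_) rfl
  have h2 := poch_ne_zero ha1 n
  have h3 := poch_ne_zero ha2 n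
  have h4 := factorial_ne_zero' n
  have h5 : ((-1 : ℂ) ^ n) * (-1) ^ n = 1 := by rw [← mul_pow]; simp
  rw [add_comm i (n + 1)]
  simp only [tailTerm, gaussLog, show n < n + 1 + i by omega, if_true,
    show n + 1 + i - n - 1 = i by omega]
  have h6 := poch_ne_zero ha1 (n + 1 + i)
  have h7 := poch_ne_zero ha2 (n + 1 + i)
  field_simp
  linear_combination (-((i ! : ℂ) * A (n + 1 + i))) * h5

/-- The expansion near `z = 1`. -/
theorem exists_local_expansion (ha1 : ∀ m : ℕ, a 1 ≠ -(m : ℂ)) (ha2 : ∀ m : ℕ, a 2 ≠ -(m : ℂ))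
    (hs : total q a b = a 1 + a 2) :
    ∃ y : LogSeq, LogSeq.Conv (1 / 2) y ∧
      (∀ n : ℕ, (∀ j ∈ Icc 3 (q + 2), 0 < (a j + n).re) →
        HasSum (tailTerm a (levelCoeff q a b) n) (tailConst a (levelCoeff q a b) y.1 n)) ∧
      (∀ n, y.2 n = ∑ k ∈ range (n + 1), levelCoeff q a b k * gaussLead (a 1) (a 2) k n) ∧
      ∀ z ∈ lens, ‖1 - z‖ < 1 / 2 → HasSum (fun n => taylorCoeff q a b n * z ^ n) (LogSeq.val y z) := by
  classical
  have hex : ∃ N : ℕ, ∀ j ∈ Icc 3 (q + 2), 0 < (a j + N).re := by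
    obtain ⟨N, hN⟩ := exists_nat_gt (∑ j ∈ Icc 3 (q + 2), |(a j).re|)
    refine ⟨N, fun j hj => ?_⟩
    have := single_le_sum (f := fun j => |(a j).re|) (fun j _ => abs_nonneg _) hj
    simp only [Complex.add_re, Complex.natCast_re]
    linarith [neg_abs_le (a j).re]
  -- Minimality matters: every `n` satisfying the convergence condition is then at least `N`, so its
  -- `T n` is the sum of the series.
  have hN := Nat.find_spec hex
  set N := Nat.find hex with hNdef
  have hmono : ∀ n, N ≤ n → ∀ j ∈ Icc 3 (q + 2), 0 < (a j + n).re := by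
    intro n hn j hj
    have := hN j hj
    have hn' : (N : ℝ) ≤ n := by exact_mod_cast hn
    simp only [Complex.add_re, Complex.natCast_re] at this ⊢
    linarith
  obtain ⟨α, hα0, hα⟩ := exists_lt_of_forall_lt q a (x := -N) (fun j hj => by
    have := hN j hj
    simp only [Complex.add_re, Complex.natCast_re] at this
    linarith)
  obtain ⟨y, hy1, hy2, hyc, hy⟩ := exists_expansion ha1 ha2 (coeffBound_levelCoeff hs hα)
    (by linarith : 0 < α + N) (h := taylorCoeff q a b) fun n hn => hasSum_taylorCoeff hs (hmono n hn)
  exact ⟨y, hyc, fun n hn => hasSum_tailTerm ha1 ha2 (hy1 n (Nat.find_min' hex hn)), hy2, hy⟩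

/-! ### The radius of convergence of the expansion at `z = 1` -/

namespace LogSeq

variable {R : ℝ} {y : LogSeq} {z : ℂ} {B : ℕ → ℝ}

/-- The sequences of `w ^ (i + 1) ϑ ^ (i + 1) f` in terms of those of `w ^ i ϑ ^ i f`, where
`ϑ = z d/dz`. -/
noncomputable def step (i : ℕ) (y : LogSeq) : LogSeq :=
  ((i : ℂ) • y - euler y) - mulW ((i : ℂ) • y - euler y)

/-- The sequences of `w ^ i ϑ ^ i f`. -/
noncomputable def thetaIter (y : LogSeq) : ℕ → LogSeq
  | 0 => y
  | i + 1 => step i (thetaIter y i)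

theorem Conv.step (h : Conv R y) (i : ℕ) : Conv R (step i y) :=
  ((h.smul _).sub h.euler).sub ((h.smul _).sub h.euler).mulW

theorem Conv.thetaIter (h : Conv R y) (i : ℕ) : Conv R (thetaIter y i) := by
  induction i with
  | zero => exact h
  | succ i ih => exact ih.step i

theorem val_step (h : Conv R y) (i : ℕ) (hz : ‖1 - z‖ < R) :
    val (step i y) z = z * (i * val y z - val (euler y) z) := by
  have h1 := (h.smul (i : ℂ)).sub h.euler
  rw [LogSeq.step, val_sub h1 h1.mulW hz, val_mulW h1 hz, val_sub (h.smul _) h.euler hz, val_smul]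
  ring

end LogSeq

theorem ConvBelow.pow_mul {R : ℝ} {p : ℕ → ℂ} (hp : ConvBelow R p) (i : ℕ) :
    ConvBelow R fun n => (n : ℂ) ^ i * p n := by
  induction i with
  | zero => simpa using hp
  | succ i ih =>
    have := ih.natCast_mul
    refine this.of_le fun n => le_of_eq ?_
    rw [pow_succ]
    congr 1
    ring

theorem powSum_eval_mul {R : ℝ} {p : ℕ → ℂ} (hp : ConvBelow R p) (P : Polynomial ℂ) {z : ℂ}
    (hz : ‖z‖ < R) : HasSum (fun n : ℕ => P.eval (n : ℂ) * p n * z ^ n)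
      (∑ i ∈ range (P.natDegree + 1), P.coeff i * powSum (fun n => (n : ℂ) ^ i * p n) z) := by
  have h := hasSum_sum (s := range (P.natDegree + 1))
    fun i _ => ((hp.pow_mul i).hasSum hz).mul_left (P.coeff i)
  refine HasSum.congr_of_eq h (fun n => ?_) rfl
  rw [Polynomial.eval_eq_sum_range, sum_mul, sum_mul]
  exact sum_congr rfl fun i _ => by ring

/-- The hypergeometric differential equation. -/
theorem sum_coeff_mul_powSum {h : ℕ → ℂ} (hh : ConvBelow 1 h) {P Q : Polynomial ℂ}
    (h0 : Q.eval 0 = 0) (hrec : ∀ n : ℕ, Q.eval ((n : ℂ) + 1) * h (n + 1) = P.eval (n : ℂ) * h n) {z : ℂ}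
    (hz : ‖z‖ < 1) :
    ∑ i ∈ range (Q.natDegree + 1), Q.coeff i * powSum (fun n => (n : ℂ) ^ i * h n) z =
      z * ∑ i ∈ range (P.natDegree + 1), P.coeff i * powSum (fun n => (n : ℂ) ^ i * h n) z := by
  have h1 := HasSum.tail (powSum_eval_mul hh Q hz) 1
  have h2 := (powSum_eval_mul hh P hz).mul_left z
  simp only [range_one, sum_singleton, Nat.cast_zero, h0, zero_mul, sub_zero] at h1
  refine h1.unique (HasSum.congr_of_eq h2 (fun n => ?_) rfl)
  push_cast
  rw [hrec, pow_succ]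
  ring

/-- Differentiating `w^i ϑ^i f` gives `w^(i+1) ϑ^(i+1) f = z (i - w d/dw)(w^i ϑ^i f)`, which is
`step`. The powers of `w` cancel the denominators produced by `d/dz`. -/
theorem val_thetaIter {h : ℕ → ℂ} (hh : ConvBelow 1 h) {R : ℝ} {y : LogSeq} (hy : LogSeq.Conv R y)
    (hval : ∀ z ∈ lens, ‖1 - z‖ < R → LogSeq.val y z = powSum h z) (i : ℕ) {z : ℂ} (hz : z ∈ lens)
    (hR : ‖1 - z‖ < R) :
    LogSeq.val (LogSeq.thetaIter y i) z = (1 - z) ^ i * powSum (fun n => (n : ℂ) ^ i * h n) z := by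
  induction i generalizing z with
  | zero => simpa [LogSeq.thetaIter] using hval z hz hR
  | succ i ih =>
    obtain ⟨hz1, -⟩ := mem_lens.1 hz
    have hs := one_sub_mem_slitPlane hz1
    have hw := Complex.slitPlane_ne_zero hs
    have hc := hy.thetaIter i
    have hp := hh.pow_mul i
    have d1 := LogSeq.hasDerivAt_val hc hR hs
    have hw' : HasDerivAt (fun z : ℂ => 1 - z) (-1) z := by
      simpa using (hasDerivAt_id z).const_sub 1
    have d2 := (hw'.pow i).mul (hasDerivAt_powSum hp hz1)
    have hopen : {z | z ∈ lens ∧ ‖1 - z‖ < R} ∈ 𝓝 z := by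
      refine IsOpen.mem_nhds (isOpen_lens.inter ?_) ⟨hz, hR⟩
      exact isOpen_lt (f := fun x : ℂ => ‖1 - x‖) (by fun_prop) continuous_const
    have d3 := d1.unique (d2.congr_of_eventuallyEq (by
      filter_upwards [hopen] with x hx using ih hx.1 hx.2))
    have h4 := powSum_natCast_mul hp hz1
    have h5 : (fun n : ℕ => (n : ℂ) ^ (i + 1) * h n) = fun n : ℕ => (n : ℂ) * ((n : ℂ) ^ i * h n) := by
      funext n
      ring
    rw [LogSeq.thetaIter, LogSeq.val_step hc i hR, ih hz hR, h5, h4]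
    have h6 : LogSeq.val (LogSeq.euler (LogSeq.thetaIter y i)) z = -(1 - z) *
        (i * (1 - z) ^ (i - 1) * -1 * powSum (fun n => (n : ℂ) ^ i * h n) z +
          (1 - z) ^ i * powSum (fun n => ((n + 1 : ℕ) : ℂ) * (((n + 1 : ℕ) : ℂ) ^ i * h (n + 1))) z) := by
      simp only [Pi.pow_apply] at d3
      rw [← d3]
      field_simp
    rw [h6]
    cases i with
    | zero =>
      simp
      ring
    | succ i =>
      rw [Nat.add_sub_cancel]
      push_cast
      ring

/-- The equation `Q(ϑ) f = z P(ϑ) f` is multiplied by `w^m`. Both polynomials are monic of degree `m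
+ 1`, so the leading coefficient is `1 - z = w`, while `q_i - z p_i = (q_i - p_i) + p_i w`.
Uniqueness of coefficients turns the identity of functions into one of sequences. -/
theorem thetaIter_eq {h : ℕ → ℂ} (hh : ConvBelow 1 h) {P Q : Polynomial ℂ} {m : ℕ}
    (hP : P.Monic) (hPd : P.natDegree = m + 1) (hQ : Q.Monic) (hQd : Q.natDegree = m + 1)
    (h0 : Q.eval 0 = 0) (hrec : ∀ n : ℕ, Q.eval ((n : ℂ) + 1) * h (n + 1) = P.eval (n : ℂ) * h n)
    {R : ℝ} (hR0 : 0 < R) {y : LogSeq} (hy : LogSeq.Conv R y)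
    (hval : ∀ z ∈ lens, ‖1 - z‖ < R → LogSeq.val y z = powSum h z) :
    LogSeq.thetaIter y (m + 1) + ∑ i ∈ range (m + 1), LogSeq.mulW^[m - i]
      ((Q.coeff i - P.coeff i) • LogSeq.thetaIter y i +
        P.coeff i • LogSeq.mulW (LogSeq.thetaIter y i)) = 0 := by
  have hc : ∀ i, LogSeq.Conv R ((Q.coeff i - P.coeff i) • LogSeq.thetaIter y i +
        P.coeff i • LogSeq.mulW (LogSeq.thetaIter y i)) := fun i =>
    ((hy.thetaIter i).smul _).add ((hy.thetaIter i).mulW.smul _)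
  have hc' : ∀ i ∈ range (m + 1), LogSeq.Conv R (LogSeq.mulW^[m - i]
      ((Q.coeff i - P.coeff i) • LogSeq.thetaIter y i +
        P.coeff i • LogSeq.mulW (LogSeq.thetaIter y i))) := fun i _ =>
    LogSeq.conv_iterate_mulW (hc i) _
  refine LogSeq.eq_zero_of_val_eq_zero hR0 ((hy.thetaIter _).add (LogSeq.Conv.sum hc')) ?_
  filter_upwards [Ioo_mem_nhdsGT one_pos, LogSeq.eventually_norm_ofReal_lt hR0] with t ht htR
  have hl := one_sub_ofReal_mem_lens ht
  set z : ℂ := 1 - (t : ℂ) with hz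
  have hzR : ‖1 - z‖ < R := by simpa [hz] using htR
  rw [LogSeq.val_add (hy.thetaIter _) (LogSeq.Conv.sum hc') hzR, LogSeq.val_sum hc' hzR,
    val_thetaIter hh hy hval _ hl hzR]
  have h1 : ∀ i ∈ range (m + 1), LogSeq.val (LogSeq.mulW^[m - i]
      ((Q.coeff i - P.coeff i) • LogSeq.thetaIter y i +
        P.coeff i • LogSeq.mulW (LogSeq.thetaIter y i))) z =
      (1 - z) ^ m * (Q.coeff i * powSum (fun n => (n : ℂ) ^ i * h n) z -
        z * (P.coeff i * powSum (fun n => (n : ℂ) ^ i * h n) z)) := by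
    intro i hi
    have hi' : i ≤ m := by simpa [Nat.lt_succ_iff] using hi
    rw [LogSeq.val_iterate_mulW (hc i) hzR, LogSeq.val_add ((hy.thetaIter i).smul _)
      ((hy.thetaIter i).mulW.smul _) hzR, LogSeq.val_smul, LogSeq.val_smul,
      LogSeq.val_mulW (hy.thetaIter i) hzR, val_thetaIter hh hy hval _ hl hzR]
    have e : (1 - z) ^ m = (1 - z) ^ (m - i) * (1 - z) ^ i := by
      rw [← pow_add, Nat.sub_add_cancel hi']
    rw [e]
    ring
  rw [sum_congr rfl h1, ← mul_sum, sum_sub_distrib, ← mul_sum]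
  have h2 := sum_coeff_mul_powSum hh h0 hrec (mem_lens.1 hl).1
  rw [hPd, hQd, sum_range_succ, sum_range_succ (n := m + 1), ← hPd, hP.coeff_natDegree, hPd, ← hQd,
    hQ.coeff_natDegree, hQd] at h2
  rw [pow_succ]
  linear_combination (1 - z) ^ m * h2

/-- Both sequences are dominated by `B`. -/
def LogSeq.Dom (B : ℕ → ℝ) (y : LogSeq) : Prop := y.1 =O[atTop] B ∧ y.2 =O[atTop] B

/-! ### Majorants for the coefficient sequences. -/

namespace LogSeq

variable {y x : LogSeq} {B : ℕ → ℝ}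

theorem Dom.add (h : Dom B y) (h' : Dom B x) : Dom B (y + x) := ⟨h.1.add h'.1, h.2.add h'.2⟩

theorem Dom.smul (h : Dom B y) (c : ℂ) : Dom B (c • y) :=
  ⟨h.1.const_mul_left c, h.2.const_mul_left c⟩

theorem Dom.sum {ι : Type*} {s : Finset ι} {f : ι → LogSeq} (h : ∀ i ∈ s, Dom B (f i)) :
    Dom B (∑ i ∈ s, f i) := by
  classical
  induction s using Finset.induction_on with
  | empty => exact ⟨isBigO_zero _ _, isBigO_zero _ _⟩
  | insert i s hi ih =>
    rw [sum_insert hi]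
    exact (h i (by simp)).add (ih fun j hj => h j (by simp [hj]))

theorem isBigO_delay (hB : Monotone B) (hB0 : ∀ n, 0 < B n) {p : ℕ → ℂ} (h : p =O[atTop] B) :
    delay p =O[atTop] B := by
  obtain ⟨C, hC⟩ := (isBigO_nat_atTop_iff fun n hn => absurd hn (hB0 n).ne').1 h
  refine IsBigO.of_bound C ?_
  filter_upwards [eventually_ge_atTop 1] with n hn
  obtain ⟨n, rfl⟩ := Nat.exists_eq_add_of_le' hn
  have hC0 : 0 ≤ C := by
    by_contra hneg
    have h1 := (norm_nonneg _).trans (hC 0)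
    rw [Real.norm_of_nonneg (hB0 0).le] at h1
    nlinarith [hB0 0]
  refine (hC n).trans ?_
  rw [Real.norm_of_nonneg (hB0 n).le, Real.norm_of_nonneg (hB0 _).le]
  gcongr
  exact hB n.le_succ

theorem Dom.mulW (hB : Monotone B) (hB0 : ∀ n, 0 < B n) (h : Dom B y) : Dom B (mulW y) :=
  ⟨isBigO_delay hB hB0 h.1, isBigO_delay hB hB0 h.2⟩

theorem Dom.iterate_mulW (hB : Monotone B) (hB0 : ∀ n, 0 < B n) (h : Dom B y) (n : ℕ) :
    Dom B (LogSeq.mulW^[n] y) := by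
  induction n with
  | zero => exact h
  | succ n ih =>
    rw [Function.iterate_succ_apply']
    exact ih.mulW hB hB0

theorem isBigO_of_sub_delay (hB : Monotone B) (hB0 : ∀ n, 0 < B n) {u : ℕ → ℂ}
    (h : (fun n => u n - delay u n) =O[atTop] B) : u =O[atTop] fun n => ((n : ℝ) + 1) * B n := by
  obtain ⟨C, hC⟩ := (isBigO_nat_atTop_iff fun n hn => absurd hn (hB0 n).ne').1 h
  have hC0 : 0 ≤ C := by
    by_contra hneg
    have h1 := (norm_nonneg _).trans (hC 0)
    rw [Real.norm_of_nonneg (hB0 0).le] at h1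
    nlinarith [hB0 0]
  have key : ∀ n, ‖u n‖ ≤ C * (((n : ℝ) + 1) * B n) := by
    intro n
    have hn := hC n
    rw [Real.norm_of_nonneg (hB0 n).le] at hn
    induction n with
    | zero => simpa [delay] using hn
    | succ n ih =>
      have ih' := ih (by simpa [Real.norm_of_nonneg (hB0 n).le] using hC n)
      simp only [delay] at hn
      have h1 : ‖u (n + 1)‖ ≤ ‖u (n + 1) - u n‖ + ‖u n‖ := by
        simpa using norm_add_le (u (n + 1) - u n) (u n)
      have h2 : C * (((n : ℝ) + 1) * B n) ≤ C * (((n : ℝ) + 1) * B (n + 1)) := by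
        gcongr
        exact hB n.le_succ
      push_cast
      linarith
  refine IsBigO.of_bound C (Eventually.of_forall fun n => (key n).trans_eq ?_)
  rw [Real.norm_of_nonneg (by have := (hB0 n).le; positivity)]

theorem isBigO_of_natCast_sub_mul (hB0 : ∀ n, 0 < B n) {p : ℕ → ℂ} (i : ℕ)
    (h : (fun n : ℕ => ((i : ℂ) - n) * p n) =O[atTop] fun n => ((n : ℝ) + 1) * B n) :
    p =O[atTop] B := by
  obtain ⟨C, hC⟩ := h.bound
  refine IsBigO.of_bound (2 * C) ?_
  filter_upwards [hC, eventually_ge_atTop (2 * i + 1)] with n hn hni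
  have hni' : (2 * i + 1 : ℝ) ≤ n := by exact_mod_cast hni
  rw [Real.norm_of_nonneg (by have := (hB0 n).le; positivity), norm_mul] at hn
  rw [Real.norm_of_nonneg (hB0 n).le]
  have h1 : ((n : ℝ) + 1) / 2 ≤ ‖(i : ℂ) - n‖ := by
    rw [norm_sub_rev]
    have := norm_sub_norm_le (n : ℂ) i
    rw [Complex.norm_natCast, Complex.norm_natCast] at this
    linarith
  have h2 := mul_le_mul_of_nonneg_right h1 (norm_nonneg (p n))
  have h3 : ((n : ℝ) + 1) * ‖p n‖ ≤ ((n : ℝ) + 1) * (2 * C * B n) := by linarith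
  exact le_of_mul_le_mul_left h3 (by positivity)

/-- `step i` is multiplication by `1 - w` after `i - w d/dw`. Undoing the first costs a factor `n +
1`, undoing the second divides by `i - n` and regains it. The logarithmic component is treated
before the other, whose equation contains it. -/
theorem Dom.of_step (hB : Monotone B) (hB0 : ∀ n, 0 < B n) {i : ℕ} (h : Dom B (step i y)) :
    Dom B y := by
  have e2 := isBigO_of_sub_delay hB hB0 (u := ((i : ℂ) • y - euler y).2) h.2
  have e1 := isBigO_of_sub_delay hB hB0 (u := ((i : ℂ) • y - euler y).1) h.1
  have h2 : y.2 =O[atTop] B := by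
    refine isBigO_of_natCast_sub_mul hB0 i (e2.congr_left fun n => ?_)
    simp [euler]
    ring
  refine ⟨isBigO_of_natCast_sub_mul hB0 i ?_, h2⟩
  have h3 : y.2 =O[atTop] fun n => ((n : ℝ) + 1) * B n := by
    refine h2.trans (IsBigO.of_bound 1 (Eventually.of_forall fun n => ?_))
    have := (hB0 n).le
    rw [Real.norm_of_nonneg this, Real.norm_of_nonneg (by positivity)]
    nlinarith [(Nat.cast_nonneg n : (0 : ℝ) ≤ n)]
  refine (e1.sub h3).congr_left fun n => ?_
  simp [euler]
  ring

theorem Dom.of_thetaIter (hB : Monotone B) (hB0 : ∀ n, 0 < B n) {m : ℕ} (h : Dom B (thetaIter y m))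
    {i : ℕ} (hi : i ≤ m) : Dom B (thetaIter y i) := by
  obtain ⟨j, rfl⟩ := Nat.exists_eq_add_of_le hi
  clear hi
  induction j with
  | zero => exact h
  | succ j ih => exact ih (Dom.of_step hB hB0 h)

theorem Dom.conv {R : ℝ} (h : Dom B y) (hB : ∀ r : ℝ, 0 ≤ r → r < R → Summable fun n => B n * r ^ n)
    (hB0 : ∀ n, 0 < B n) : Conv R y := by
  have h0 : ConvBelow R fun n => (B n : ℂ) := by
    intro r h0 h1
    refine (hB r h0 h1).congr fun n => ?_
    rw [Complex.norm_real, Real.norm_of_nonneg (hB0 n).le]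
  have h1 : B =O[atTop] fun n => (B n : ℂ) := IsBigO.of_bound 1 (by simp)
  exact ⟨convBelow_of_isBigO h0 (h.1.trans h1), convBelow_of_isBigO h0 (h.2.trans h1)⟩

/-- A sequence pair whose `step` is dominated by its running maximum has radius of convergence `1`. -/
theorem exists_dom_of_step (x : LogSeq) (i : ℕ)
    (h : ∀ B : ℕ → ℝ, Monotone B → (∀ n, 0 < B n) → Dom B x → Dom B (step i x)) :
    ∃ B : ℕ → ℝ, Monotone B ∧ (∀ n, 0 < B n) ∧ Dom B x ∧
      ∀ r : ℝ, 0 ≤ r → r < 1 → Summable fun n => B n * r ^ n := by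
  set s : ℕ → ℝ := fun n => max ‖x.1 n‖ ‖x.2 n‖ with hs
  -- The running maximum of the coefficients themselves serves as the majorant, so the hypothesis
  -- bounds `step i x` by the size of `x`.
  set B : ℕ → ℝ := fun n => 1 + partialSups s n with hBdef
  have hs0 : ∀ n, 0 ≤ s n := fun n => (norm_nonneg _).trans (le_max_left _ _)
  have hsB : ∀ n, s n ≤ partialSups s n := fun n => le_partialSups s n
  have hB : Monotone B := fun m n hmn => by
    have := (partialSups s).monotone hmn
    simp only [hBdef]
    linarith
  have hB1 : ∀ n, 1 + s n ≤ B n := fun n => by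
    simp only [hBdef]
    linarith [hsB n]
  have hB0 : ∀ n, 0 < B n := fun n => by linarith [hB1 n, hs0 n]
  have hx1 : ∀ n, ‖x.1 n‖ ≤ B n := fun n => by linarith [hB1 n, le_max_left ‖x.1 n‖ ‖x.2 n‖]
  have hx2 : ∀ n, ‖x.2 n‖ ≤ B n := fun n => by linarith [hB1 n, le_max_right ‖x.1 n‖ ‖x.2 n‖]
  have hdom : Dom B x := by
    constructor <;> refine IsBigO.of_bound 1 (Eventually.of_forall fun n => ?_)
    · rw [Real.norm_of_nonneg (hB0 n).le, one_mul]
      exact hx1 n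
    · rw [Real.norm_of_nonneg (hB0 n).le, one_mul]
      exact hx2 n
  refine ⟨B, hB, hB0, hdom, fun r hr0 hr => ?_⟩
  obtain ⟨h1, h2⟩ := h B hB hB0 hdom
  obtain ⟨C₁, hC₁⟩ := (isBigO_nat_atTop_iff fun n hn => absurd hn (hB0 n).ne').1 h1
  obtain ⟨C₂, hC₂⟩ := (isBigO_nat_atTop_iff fun n hn => absurd hn (hB0 n).ne').1 h2
  set K := max C₁ C₂ with hK
  -- Solving the definition of `step` for `(n+1) x_{n+1} - n x_n` leaves two terms with factor `i`,
  -- at most two from the logarithmic part, and one of size `K B (n+1)`.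
  refine summable_of_quasi_monotone (M := B) (C := 2 * i + 2 + K) (fun n => (hB0 n).le)
    (fun n => ?_) hr0 hr
  have hBn := hB n.le_succ
  have hBp := hB0 n
  have g1 : ‖(step i x).1 (n + 1)‖ ≤ K * B (n + 1) := by
    refine (hC₁ (n + 1)).trans ?_
    rw [Real.norm_of_nonneg (hB0 _).le]
    exact mul_le_mul_of_nonneg_right (le_max_left _ _) (hB0 _).le
  have g2 : ‖(step i x).2 (n + 1)‖ ≤ K * B (n + 1) := by
    refine (hC₂ (n + 1)).trans ?_
    rw [Real.norm_of_nonneg (hB0 _).le]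
    exact mul_le_mul_of_nonneg_right (le_max_right _ _) (hB0 _).le
  have e1 : (step i x).1 (n + 1) = (i * x.1 (n + 1) - ((n + 1 : ℕ) * x.1 (n + 1) - x.2 (n + 1))) -
      (i * x.1 n - (n * x.1 n - x.2 n)) := by
    simp [step, euler, LogSeq.mulW, delay]
  have e2 : (step i x).2 (n + 1) = (i * x.2 (n + 1) - (n + 1 : ℕ) * x.2 (n + 1)) -
      (i * x.2 n - n * x.2 n) := by
    simp [step, euler, LogSeq.mulW, delay]
  have hn1 : ∀ (c : ℕ) (v : ℂ), ‖(c : ℂ) * v‖ = c * ‖v‖ := fun c v => by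
    rw [norm_mul, Complex.norm_natCast]
  have hi0 : (0 : ℝ) ≤ i := Nat.cast_nonneg i
  have hn0 : (0 : ℝ) ≤ n := Nat.cast_nonneg n
  have b1 := mul_le_mul_of_nonneg_left (hx1 (n + 1)) hi0
  have b2 := mul_le_mul_of_nonneg_left (hx2 (n + 1)) hi0
  have b3 := mul_le_mul_of_nonneg_left ((hx1 n).trans hBn) hi0
  have b4 := mul_le_mul_of_nonneg_left ((hx2 n).trans hBn) hi0
  have k1 : ((n : ℝ) + 1) * ‖x.1 (n + 1)‖ ≤ n * ‖x.1 n‖ + (2 * i + 2 + K) * B (n + 1) := by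
    have : ((n + 1 : ℕ) : ℂ) * x.1 (n + 1) = n * x.1 n + i * x.1 (n + 1) + x.2 (n + 1) -
        i * x.1 n - x.2 n - (step i x).1 (n + 1) := by
      rw [e1]
      ring
    have h5 := congrArg norm this
    rw [hn1] at h5
    have h6 : ‖(n : ℂ) * x.1 n + i * x.1 (n + 1) + x.2 (n + 1) - i * x.1 n - x.2 n -
        (step i x).1 (n + 1)‖ ≤ n * ‖x.1 n‖ + i * ‖x.1 (n + 1)‖ + ‖x.2 (n + 1)‖ + i * ‖x.1 n‖ +
          ‖x.2 n‖ + ‖(step i x).1 (n + 1)‖ := by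
      simp only [← hn1]
      refine (norm_sub_le _ _).trans (add_le_add ((norm_sub_le _ _).trans
        (add_le_add ((norm_sub_le _ _).trans (add_le_add (norm_add₃_le) le_rfl)) le_rfl)) le_rfl)
    push_cast at h5
    linarith [hx2 (n + 1), hx2 n]
  have k2 : ((n : ℝ) + 1) * ‖x.2 (n + 1)‖ ≤ n * ‖x.2 n‖ + (2 * i + 2 + K) * B (n + 1) := by
    have : ((n + 1 : ℕ) : ℂ) * x.2 (n + 1) = n * x.2 n + i * x.2 (n + 1) - i * x.2 n -
        (step i x).2 (n + 1) := by
      rw [e2]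
      ring
    have h5 := congrArg norm this
    rw [hn1] at h5
    have h6 : ‖(n : ℂ) * x.2 n + i * x.2 (n + 1) - i * x.2 n - (step i x).2 (n + 1)‖ ≤
        n * ‖x.2 n‖ + i * ‖x.2 (n + 1)‖ + i * ‖x.2 n‖ + ‖(step i x).2 (n + 1)‖ := by
      simp only [← hn1]
      refine (norm_sub_le _ _).trans (add_le_add ((norm_sub_le _ _).trans
        (add_le_add (norm_add_le _ _) le_rfl)) le_rfl)
    push_cast at h5
    linarith [hB0 (n + 1)]
  have k3 : ((n : ℝ) + 1) * s (n + 1) ≤ n * s n + (2 * i + 2 + K) * B (n + 1) := by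
    have m1 := mul_le_mul_of_nonneg_left (le_max_left ‖x.1 n‖ ‖x.2 n‖) hn0
    have m2 := mul_le_mul_of_nonneg_left (le_max_right ‖x.1 n‖ ‖x.2 n‖) hn0
    simp only [hs]
    rcases max_choice ‖x.1 (n + 1)‖ ‖x.2 (n + 1)‖ with h7 | h7 <;> rw [h7] <;> linarith
  have k4 := mul_le_mul_of_nonneg_left (hB1 n) hn0
  have hB1' : 1 ≤ B n := by linarith [hB1 n, hs0 n]
  -- If the maximum does not change, the recurrence inequality is trivial; otherwise the new entry
  -- attains it and `k3` applies.
  have hcase : B (n + 1) = B n ∨ B (n + 1) = 1 + s (n + 1) := by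
    simp only [hBdef]
    rw [← Order.succ_eq_add_one, partialSups_succ, Order.succ_eq_add_one]
    rcases max_choice (partialSups s n) (s (n + 1)) with h7 | h7
    · left
      rw [h7]
    · right
      rw [h7]
  have hK0 : 0 ≤ K := by
    by_contra hneg
    have := (norm_nonneg _).trans g1
    nlinarith [hB0 (n + 1)]
  rcases hcase with h7 | h7
  · rw [h7]
    have : 0 ≤ (2 * i + 2 + K) * B n := by positivity
    linarith
  · have h8 : ((n : ℝ) + 1) * B (n + 1) = (n + 1) + (n + 1) * s (n + 1) := by
      rw [h7]
      ring
    linarith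

end LogSeq

/-- The expansion at `1` of a solution of the hypergeometric equation converges up to the next
singularity. -/
theorem conv_one_of_recurrence {h : ℕ → ℂ} (hh : ConvBelow 1 h) {P Q : Polynomial ℂ} {m : ℕ}
    (hP : P.Monic) (hPd : P.natDegree = m + 1) (hQ : Q.Monic) (hQd : Q.natDegree = m + 1)
    (h0 : Q.eval 0 = 0) (hrec : ∀ n : ℕ, Q.eval ((n : ℂ) + 1) * h (n + 1) = P.eval (n : ℂ) * h n)
    {R : ℝ} (hR0 : 0 < R) {y : LogSeq} (hy : LogSeq.Conv R y)
    (hval : ∀ z ∈ lens, ‖1 - z‖ < R → LogSeq.val y z = powSum h z) : LogSeq.Conv 1 y := by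
  have hrel := thetaIter_eq hh hP hPd hQ hQd h0 hrec hR0 hy hval
  obtain ⟨B, hB, hB0, hdom, hsum⟩ := LogSeq.exists_dom_of_step (LogSeq.thetaIter y m) m
    (fun B hB hB0 hdom => by
      -- The equation expresses the highest iterate through lower ones, all of which are dominated
      -- by any monotone positive majorant of the `m`-th.
      have h1 : LogSeq.step m (LogSeq.thetaIter y m) = (-1 : ℂ) • ∑ i ∈ range (m + 1),
          LogSeq.mulW^[m - i] ((Q.coeff i - P.coeff i) • LogSeq.thetaIter y i +
            P.coeff i • LogSeq.mulW (LogSeq.thetaIter y i)) := by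
        rw [neg_one_smul]
        exact eq_neg_of_add_eq_zero_left hrel
      rw [h1]
      refine (LogSeq.Dom.sum fun i hi => ?_).smul _
      have hi' := LogSeq.Dom.of_thetaIter hB hB0 hdom (i := i) (by simpa [Nat.lt_succ_iff] using hi)
      exact ((hi'.smul _).add ((hi'.mulW hB hB0).smul _)).iterate_mulW hB hB0 _)
  exact (LogSeq.Dom.of_thetaIter hB hB0 hdom (i := 0) (Nat.zero_le m)).conv hsum hB0

/-! ### The hypergeometric function on the union of the discs -/

theorem isTheta_prod_Gamma (s : Finset ℕ) (c : ℕ → ℂ) :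
    (fun n : ℕ => ∏ j ∈ s, Complex.Gamma (c j + n)) =Θ[atTop]
      fun n : ℕ => (n ! : ℝ) ^ s.card * (n : ℝ) ^ ∑ j ∈ s, ((c j).re - 1) := by
  refine (IsTheta.finsetProd fun j _ => isTheta_Gamma (c j)).trans_eventuallyEq ?_
  filter_upwards [eventually_gt_atTop 0] with n hn
  rw [prod_mul_distrib, prod_const, Real.rpow_sum_of_pos (by exact_mod_cast hn)]

theorem convBelow_taylorCoeff (q : ℕ) (a b : ℕ → ℂ) : ConvBelow 1 (taylorCoeff q a b) := by
  have h1 := isTheta_prod_Gamma (Icc 1 (q + 2)) a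
  have h2 := isTheta_prod_Gamma (Icc 1 (q + 1)) b
  have h3 : (fun n : ℕ => ((n ! : ℂ))⁻¹) =O[atTop] fun n : ℕ => ((n ! : ℝ))⁻¹ :=
    IsBigO.of_bound 1 (by simp)
  have h4 := (h1.div h2).1.mul h3
  refine convBelow_one_of_isBigO (θ := ∑ j ∈ Icc 1 (q + 2), ((a j).re - 1) -
    ∑ j ∈ Icc 1 (q + 1), ((b j).re - 1)) (IsBigO.trans (EventuallyEq.isBigO ?_)
      (h4.trans (EventuallyEq.isBigO ?_)))
  · exact Eventually.of_forall fun n => by rw [taylorCoeff, div_eq_mul_inv _ (n ! : ℂ)]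
  · filter_upwards [eventually_gt_atTop 0] with n hn
    have hn' : (0 : ℝ) < n := by exact_mod_cast hn
    have : (n ! : ℝ) ≠ 0 := by positivity
    simp only [Nat.card_Icc, Nat.add_sub_cancel]
    rw [Real.rpow_sub hn', pow_succ _ (q + 1)]
    field_simp

variable {q : ℕ} {a b : ℕ → ℂ}

theorem taylorCoeff_succ (ha : ∀ j ∈ Icc 1 (q + 2), ∀ m : ℕ, a j ≠ -(m : ℂ))
    (hb : ∀ j ∈ Icc 1 (q + 1), ∀ m : ℕ, b j ≠ -(m : ℂ)) (n : ℕ) :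
    ((n : ℂ) + 1) * (∏ j ∈ Icc 1 (q + 1), (b j + n)) * taylorCoeff q a b (n + 1) =
      (∏ j ∈ Icc 1 (q + 2), (a j + n)) * taylorCoeff q a b n := by
  have h1 : ∏ j ∈ Icc 1 (q + 2), Complex.Gamma (a j + (n + 1 : ℕ)) =
      (∏ j ∈ Icc 1 (q + 2), (a j + n)) * ∏ j ∈ Icc 1 (q + 2), Complex.Gamma (a j + n) := by
    rw [← prod_mul_distrib]
    refine prod_congr rfl fun j hj => ?_
    rw [← Complex.Gamma_add_one _ (add_nat_ne_zero (ha j hj) n)]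
    push_cast
    ring_nf
  have h2 : ∏ j ∈ Icc 1 (q + 1), Complex.Gamma (b j + (n + 1 : ℕ)) =
      (∏ j ∈ Icc 1 (q + 1), (b j + n)) * ∏ j ∈ Icc 1 (q + 1), Complex.Gamma (b j + n) := by
    rw [← prod_mul_distrib]
    refine prod_congr rfl fun j hj => ?_
    rw [← Complex.Gamma_add_one _ (add_nat_ne_zero (hb j hj) n)]
    push_cast
    ring_nf
  have h3 : ∏ j ∈ Icc 1 (q + 1), (b j + n) ≠ 0 :=
    prod_ne_zero_iff.2 fun j hj => add_nat_ne_zero (hb j hj) n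
  have h4 : ∏ j ∈ Icc 1 (q + 1), Complex.Gamma (b j + n) ≠ 0 :=
    prod_ne_zero_iff.2 fun j hj => Complex.Gamma_ne_zero (not_pole_add_nat (hb j hj) n)
  have h5 : (n : ℂ) + 1 ≠ 0 := by exact_mod_cast n.succ_ne_zero
  have h6 := factorial_ne_zero' n
  rw [taylorCoeff, taylorCoeff, h1, h2, Nat.factorial_succ]
  push_cast
  field_simp

theorem conv_one_of_taylorCoeff (ha : ∀ j ∈ Icc 1 (q + 2), ∀ m : ℕ, a j ≠ -(m : ℂ))
    (hb : ∀ j ∈ Icc 1 (q + 1), ∀ m : ℕ, b j ≠ -(m : ℂ)) {R : ℝ} (hR0 : 0 < R) {y : LogSeq}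
    (hy : LogSeq.Conv R y)
    (hval : ∀ z ∈ lens, ‖1 - z‖ < R → LogSeq.val y z = powSum (taylorCoeff q a b) z) :
    LogSeq.Conv 1 y := by
  have hm : ∀ c : ℂ, (Polynomial.X + Polynomial.C c).Monic := Polynomial.monic_X_add_C
  have hd : ∀ c : ℂ, (Polynomial.X + Polynomial.C c).natDegree = 1 := Polynomial.natDegree_X_add_C
  have hQ' : (∏ j ∈ Icc 1 (q + 1), (Polynomial.X + Polynomial.C (b j - 1))).Monic :=
    Polynomial.monic_prod_of_monic _ _ fun j _ => hm _
  refine conv_one_of_recurrence (convBelow_taylorCoeff q a b) (m := q + 1)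
    (P := ∏ j ∈ Icc 1 (q + 2), (Polynomial.X + Polynomial.C (a j)))
    (Q := Polynomial.X * ∏ j ∈ Icc 1 (q + 1), (Polynomial.X + Polynomial.C (b j - 1)))
    (Polynomial.monic_prod_of_monic _ _ fun j _ => hm _) ?_ (Polynomial.monic_X.mul hQ') ?_ (by simp)
    (fun n => ?_) hR0 hy hval
  · rw [Polynomial.natDegree_prod_of_monic _ _ fun j _ => hm _]
    simp [hd]
  · rw [Polynomial.monic_X.natDegree_mul hQ', Polynomial.natDegree_prod_of_monic _ _ fun j _ => hm _,
      sum_congr rfl fun j _ => hd _]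
    simp
    ring
  · have h := taylorCoeff_succ ha hb n
    simp only [Polynomial.eval_mul, Polynomial.eval_X, Polynomial.eval_prod, Polynomial.eval_add,
      Polynomial.eval_C]
    rw [prod_congr rfl fun j _ => add_comm (n : ℂ) (a j), ← h]
    congr 2
    exact prod_congr rfl fun j _ => by ring

theorem gammaFactor_ne_zero (ha : ∀ j ∈ Icc 1 (q + 2), ∀ m : ℕ, a j ≠ -(m : ℂ))
    (hb : ∀ j ∈ Icc 1 (q + 1), ∀ m : ℕ, b j ≠ -(m : ℂ)) : gammaFactor (q + 1) a b ≠ 0 :=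
  div_ne_zero (prod_ne_zero_iff.2 fun j hj => Complex.Gamma_ne_zero (ha j hj))
    (prod_ne_zero_iff.2 fun j hj => Complex.Gamma_ne_zero (hb j hj))

theorem isOpen_cutDisc : IsOpen cutDisc :=
  (isOpen_lt (f := fun z : ℂ => ‖1 - z‖) (by fun_prop) continuous_const).inter
    (Complex.isOpen_slitPlane.preimage (by fun_prop))

/-- In the variable `w = 1 - z` the set is star-shaped about the point `1/2`. -/
theorem isPreconnected_cutDisc : IsPreconnected cutDisc := by
  have hs : StarConvex ℝ (((1 / 2 : ℝ)) : ℂ) (Metric.ball 0 1 ∩ Complex.slitPlane) := by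
    refine StarConvex.inter ((convex_ball (0 : ℂ) 1).starConvex ?_)
      (Complex.starConvex_ofReal_slitPlane (by norm_num))
    rw [mem_ball_zero_iff, Complex.norm_real]
    norm_num
  have hc := (hs.isPathConnected ⟨by
    rw [mem_ball_zero_iff, Complex.norm_real]
    norm_num, by
    rw [Complex.ofReal_mem_slitPlane]
    norm_num⟩).isConnected.isPreconnected
  have e : cutDisc = (fun w : ℂ => 1 - w) '' (Metric.ball 0 1 ∩ Complex.slitPlane) := by
    ext z
    constructor
    · rintro ⟨h1, h2⟩
      exact ⟨1 - z, ⟨by simpa using h1, h2⟩, by simp⟩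
    · rintro ⟨w, ⟨h1, h2⟩, rfl⟩
      exact ⟨by simpa using h1, by simpa using h2⟩
  rw [e]
  exact hc.image _ (by fun_prop)

theorem one_sub_ofReal_mem_cutDisc {t : ℝ} (ht : t ∈ Set.Ioo 0 1) : 1 - (t : ℂ) ∈ cutDisc := by
  have h := mem_lens.1 (one_sub_ofReal_mem_lens ht)
  exact ⟨h.2, one_sub_mem_slitPlane h.1⟩

theorem differentiableOn_val_cutDisc {y : LogSeq} (hy : LogSeq.Conv 1 y) :
    DifferentiableOn ℂ (LogSeq.val y) cutDisc := fun _ hz =>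
  (LogSeq.hasDerivAt_val hy hz.1 hz.2).differentiableAt.differentiableWithinAt

/-- The two local formulas agree on the lens, which is the overlap of the two open sets, so they
glue. -/
theorem exists_isHypFunction (ha : ∀ j ∈ Icc 1 (q + 2), ∀ m : ℕ, a j ≠ -(m : ℂ))
    (hb : ∀ j ∈ Icc 1 (q + 1), ∀ m : ℕ, b j ≠ -(m : ℂ)) {y : LogSeq} (hy : LogSeq.Conv 1 y)
    (hval : Set.EqOn (powSum (taylorCoeff q a b)) (LogSeq.val y) lens) :
    ∃ F : ℂ → ℂ, IsHypFunction (q + 1) a b F := by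
  classical
  have hγ := gammaFactor_ne_zero ha hb
  have hc := convBelow_taylorCoeff q a b
  set γ := gammaFactor (q + 1) a b with hγdef
  set F : ℂ → ℂ := fun z => if ‖z‖ < 1 then powSum (taylorCoeff q a b) z / γ else LogSeq.val y z / γ
    with hF
  have hball : ∀ z, ‖z‖ < 1 → F z = powSum (taylorCoeff q a b) z / γ := fun z hz => by simp [hF, hz]
  have hcut : ∀ z ∈ cutDisc, F z = LogSeq.val y z / γ := by
    intro z hz
    by_cases h : ‖z‖ < 1
    · rw [hball z h, hval (mem_lens.2 ⟨h, hz.1⟩)]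
    · simp [hF, h]
  refine ⟨F, fun z hz => ?_, fun z hz => DifferentiableAt.differentiableWithinAt ?_⟩
  · rw [hball z hz]
    refine HasSum.congr_of_eq ((hc.hasSum hz).div_const γ) (fun n => ?_) rfl
    rw [← gammaFactor_mul_hypTerm ha hb, ← hγdef]
    field_simp
  · rcases hz with hz | hz
    · have hz' : ‖z‖ < 1 := by simpa using hz
      refine ((hasDerivAt_powSum hc hz').differentiableAt.div_const γ).congr_of_eventuallyEq ?_
      filter_upwards [Metric.isOpen_ball.mem_nhds hz] with x hx
      exact hball x (by simpa using hx)
    · refine ((LogSeq.hasDerivAt_val hy hz.1 hz.2).differentiableAt.div_const γ).congr_of_eventuallyEq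
        ?_
      filter_upwards [isOpen_cutDisc.mem_nhds hz] with x hx
      exact hcut x hx

theorem IsHypFunction.eqOn_cutDisc (ha : ∀ j ∈ Icc 1 (q + 2), ∀ m : ℕ, a j ≠ -(m : ℂ))
    (hb : ∀ j ∈ Icc 1 (q + 1), ∀ m : ℕ, b j ≠ -(m : ℂ)) {y : LogSeq} (hy : LogSeq.Conv 1 y)
    (hval : Set.EqOn (powSum (taylorCoeff q a b)) (LogSeq.val y) lens) {F : ℂ → ℂ}
    (hF : IsHypFunction (q + 1) a b F) :
    Set.EqOn (fun z => gammaFactor (q + 1) a b * F z) (LogSeq.val y) cutDisc := by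
  refine eqOn_of_eventually_eq_one_sub isOpen_cutDisc isPreconnected_cutDisc
    ((hF.2.mono Set.subset_union_right).const_mul _) (differentiableOn_val_cutDisc hy) ?_ ?_
  · filter_upwards [Ioo_mem_nhdsGT one_pos] with t ht using one_sub_ofReal_mem_cutDisc ht
  · filter_upwards [Ioo_mem_nhdsGT one_pos] with t ht
    have hl := one_sub_ofReal_mem_lens ht
    have h1 := (mem_lens.1 hl).1
    rw [← hval hl]
    refine ((hF.1 _ h1).mul_left _).unique (HasSum.congr_of_eq
      ((convBelow_taylorCoeff q a b).hasSum h1) (fun n => ?_) rfl)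
    exact gammaFactor_mul_hypTerm ha hb _ n

/-! ### Behaviour at `z = 1` -/

theorem tendsto_one_sub : Tendsto (fun z : ℂ => 1 - z) (𝓝[cutDisc] 1) (𝓝[≠] 0) := by
  refine tendsto_nhdsWithin_iff.2 ⟨?_, ?_⟩
  · have : Continuous fun z : ℂ => 1 - z := by fun_prop
    exact (this.tendsto' 1 0 (by simp)).mono_left nhdsWithin_le_nhds
  · filter_upwards [self_mem_nhdsWithin] with z hz
    exact Complex.slitPlane_ne_zero hz.2

theorem tendsto_norm_log_one_sub :
    Tendsto (fun z : ℂ => ‖Complex.log (1 - z)‖) (𝓝[cutDisc] 1) atTop := by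
  have h1 : Tendsto (fun z : ℂ => ‖1 - z‖) (𝓝[cutDisc] 1) (𝓝[≠] 0) := by
    refine tendsto_nhdsWithin_iff.2 ⟨?_, ?_⟩
    · have := (tendsto_one_sub.mono_right nhdsWithin_le_nhds).norm
      rwa [norm_zero] at this
    · filter_upwards [self_mem_nhdsWithin] with z hz
      exact norm_ne_zero_iff.2 (Complex.slitPlane_ne_zero hz.2)
  have h2 := tendsto_abs_atBot_atTop.comp (Real.tendsto_log_nhdsNE_zero.comp h1)
  refine tendsto_atTop_mono (fun z => ?_) h2
  rw [Function.comp_apply, Function.comp_apply, ← Complex.log_re]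
  exact Complex.abs_re_le_norm _

theorem LogSeq.isBigO_val {y : LogSeq} (hy : LogSeq.Conv 1 y) :
    LogSeq.val y =O[𝓝[cutDisc] 1] fun z => Complex.log (1 - z) := by
  have hlog : (fun _ : ℂ => (1 : ℂ)) =O[𝓝[cutDisc] 1] fun z => Complex.log (1 - z) := by
    refine IsBigO.of_bound 1 ?_
    filter_upwards [tendsto_norm_log_one_sub.eventually_ge_atTop 1] with z hz
    simpa using hz
  have h0 := tendsto_one_sub.mono_right nhdsWithin_le_nhds
  have hb : ∀ {p : ℕ → ℂ}, ConvBelow 1 p →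
      (fun z => powSum p (1 - z)) =O[𝓝[cutDisc] 1] fun _ : ℂ => (1 : ℂ) := fun hp =>
    ((continuousAt_powSum hp (w := 0) (by simp)).tendsto.comp h0).isBigO_one ℂ
  have h2 := (isBigO_refl (fun z : ℂ => Complex.log (1 - z)) (𝓝[cutDisc] 1)).mul (hb hy.2)
  simp only [mul_one] at h2
  exact ((hb hy.1).trans hlog).sub h2

/-- After removal of the constant terms, the remainder is `w` times a function of the same kind,
hence `O(w log w)`. -/
theorem LogSeq.isBigO_val_sub {y : LogSeq} (hy : LogSeq.Conv 1 y) (h0 : y.2 0 = 1) :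
    (fun z => LogSeq.val y z - (y.1 0 - Complex.log (1 - z))) =O[𝓝[cutDisc] 1]
      fun z => (1 - z) * Complex.log (1 - z) := by
  have h1 := (isBigO_refl (fun z : ℂ => 1 - z) (𝓝[cutDisc] 1)).mul
    (LogSeq.isBigO_val (y := (fun n => y.1 (n + 1), fun n => y.2 (n + 1))) ⟨hy.1.tail, hy.2.tail⟩)
  refine IsBigO.trans (EventuallyEq.isBigO ?_) h1
  filter_upwards [self_mem_nhdsWithin] with z hz
  rw [LogSeq.val_eq_zero_add hy hz.1, h0]
  ring

theorem exists_factors {f : ℂ → ℂ} {L : ℂ}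
    (h : (fun z => f z - (L - Complex.log (1 - z))) =O[𝓝[cutDisc] 1]
      fun z => (1 - z) * Complex.log (1 - z)) :
    ∃ u v : ℂ → ℂ, u =O[𝓝[cutDisc] 1] (fun z : ℂ => 1 - z) ∧
      v =O[𝓝[cutDisc] 1] (fun z : ℂ => 1 - z) ∧
      ∀ᶠ z in 𝓝[cutDisc] 1, f z = L * (1 + u z) - Complex.log (1 - z) * (1 + v z) := by
  have hne : ∀ᶠ z in 𝓝[cutDisc] 1, Complex.log (1 - z) ≠ 0 := by
    filter_upwards [tendsto_norm_log_one_sub.eventually_gt_atTop 0] with z hz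
    exact norm_pos_iff.1 hz
  -- The whole error is charged to the logarithm: `O(w log w)` divided by `log w` is `O(w)`, and
  -- `log w ≠ 0` near `w = 0`. This works also when `L = 0`.
  refine ⟨fun _ => 0, fun z => -(f z - (L - Complex.log (1 - z))) * (Complex.log (1 - z))⁻¹,
    isBigO_zero _ _, ?_, ?_⟩
  · refine (h.neg_left.mul (isBigO_refl (fun z : ℂ => (Complex.log (1 - z))⁻¹) _)).trans
      (EventuallyEq.isBigO ?_)
    filter_upwards [hne] with z hz
    field_simp
  · filter_upwards [hne] with z hz
    field_simp
    ring

/-! ### The complete expansion and the identification of its coefficients. -/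

theorem exists_logarithmic_expansion (ha : ∀ j ∈ Icc 1 (q + 2), ∀ m : ℕ, a j ≠ -(m : ℂ))
    (hb : ∀ j ∈ Icc 1 (q + 1), ∀ m : ℕ, b j ≠ -(m : ℂ))
    (hs : ∑ j ∈ Icc 1 (q + 1), b j - ∑ j ∈ Icc 1 (q + 2), a j = 0) :
    ∃ y : LogSeq, LogSeq.Conv 1 y ∧
      Set.EqOn (powSum (taylorCoeff q a b)) (LogSeq.val y) lens ∧ y.2 0 = 1 ∧
      (∀ n : ℕ, (∀ j ∈ Icc 3 (q + 2), 0 < (a j + n).re) →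
        HasSum (tailTerm a (levelCoeff q a b) n) (tailConst a (levelCoeff q a b) y.1 n)) ∧
      (∀ z n, expansionTerm a (levelCoeff q a b) (tailConst a (levelCoeff q a b) y.1 n) z n =
        (y.1 n - Complex.log (1 - z) * y.2 n) * (1 - z) ^ n) ∧
      y.1 0 = constL a (tailConst a (levelCoeff q a b) y.1 0) := by
  have ha1 := ha 1 (by simp)
  have ha2 := ha 2 (by simp)
  obtain ⟨y, hyc, hT, hy2, hval⟩ := exists_local_expansion ha1 ha2 (total_eq hs)
  have hc : LogSeq.Conv 1 y := conv_one_of_taylorCoeff ha hb (by norm_num) hyc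
    fun z hz hz' => (hval z hz hz').tsum_eq.symm
  refine ⟨y, hc, ?_, ?_, hT, fun z n => expansionTerm_eq ha1 ha2 _ y (hy2 n) z, ?_⟩
  · refine eqOn_of_eventually_eq_one_sub isOpen_lens isPreconnected_lens
      (differentiableOn_powSum_lens (convBelow_taylorCoeff q a b)) (differentiableOn_val_lens hc) ?_ ?_
    · filter_upwards [Ioo_mem_nhdsGT one_pos] with t ht using one_sub_ofReal_mem_lens ht
    · filter_upwards [Ioo_mem_nhdsGT one_pos,
        LogSeq.eventually_norm_ofReal_lt (R := 1 / 2) (by norm_num)] with t ht ht'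
      exact (hval _ (one_sub_ofReal_mem_lens ht) (by simpa using ht')).tsum_eq
  · rw [hy2 0]
    simp [levelCoeff_zero, gaussLead_zero, poch_zero]
  · simp [tailConst, constL, levelCoeff_zero, gaussLog, gaussLead_zero, poch_zero, digammaSum]
    ring

theorem IsCoeff.eq_levelCoeff {A : ℕ → ℂ} (hA : IsCoeff (q + 2) a b A) :
    A = levelCoeff (q + 1) a b := by
  rcases hA with h | ⟨h3, h⟩ | ⟨h4, h⟩
  · rw [h, coeff_eq_levelCoeff]
  · obtain rfl : q = 1 := by omega
    rw [h, coeffThree_eq_coeff, coeff_eq_levelCoeff]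
  · obtain rfl : q = 2 := by omega
    rw [h, coeffFour_eq_coeff, coeff_eq_levelCoeff]

end ZeroBalanced

theorem mainTheorem4 (p : ℕ) (hp : 2 ≤ p) (a b : ℕ → ℂ)
    (ha : ∀ j ∈ Finset.Icc 1 (p + 1), ∀ m : ℕ, a j ≠ -(m : ℂ))
    (hb : ∀ j ∈ Finset.Icc 1 p, ∀ m : ℕ, b j ≠ -(m : ℂ))
    (hs : ∑ j ∈ Finset.Icc 1 p, b j - ∑ j ∈ Finset.Icc 1 (p + 1), a j = 0)
    (A : ℕ → ℂ) (hA : ZeroBalanced.IsCoeff p a b A) :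
    (∃ F : ℂ → ℂ, ZeroBalanced.IsHypFunction p a b F) ∧
    ∀ F : ℂ → ℂ, ZeroBalanced.IsHypFunction p a b F →
      ∃ T : ℕ → ℂ,
        -- `T n` is the value of the infinite series with index `n`, under its convergence condition
        (∀ n : ℕ, (∀ j ∈ Finset.Icc 3 (p + 1), 0 < (a j + (n : ℂ)).re) →
          HasSum (ZeroBalanced.tailTerm a A n) (T n)) ∧
        -- the expansion in powers of `1 - z`
        (∀ z ∈ ZeroBalanced.cutDisc,
          HasSum (fun n : ℕ => ZeroBalanced.expansionTerm a A (T n) z n)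
            (ZeroBalanced.gammaFactor p a b * F z)) ∧
        -- the leading terms as `z → 1`, with `L(p) = ZeroBalanced.constL a (T 0)`
        ((∀ j ∈ Finset.Icc 3 (p + 1), 0 < (a j).re) →
          Summable (ZeroBalanced.tailTerm a A 0) ∧ T 0 = ZeroBalanced.constB a A) ∧
        (fun z : ℂ => ZeroBalanced.gammaFactor p a b * F z
            - (ZeroBalanced.constL a (T 0) - Complex.log (1 - z)))
          =O[𝓝[ZeroBalanced.cutDisc] 1] (fun z : ℂ => (1 - z) * Complex.log (1 - z)) ∧
        ∃ u v : ℂ → ℂ,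
          u =O[𝓝[ZeroBalanced.cutDisc] 1] (fun z : ℂ => 1 - z) ∧
          v =O[𝓝[ZeroBalanced.cutDisc] 1] (fun z : ℂ => 1 - z) ∧
          ∀ᶠ z in 𝓝[ZeroBalanced.cutDisc] 1,
            ZeroBalanced.gammaFactor p a b * F z =
              ZeroBalanced.constL a (T 0) * (1 + u z) - Complex.log (1 - z) * (1 + v z) := by
  obtain ⟨q, rfl⟩ := Nat.exists_eq_add_of_le' hp
  obtain rfl := hA.eq_levelCoeff
  -- The lemmas are indexed so that their `q` is `p - 1`; with `p = q + 2` this is `q + 1`.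
  obtain ⟨y, hc, hval, hy2, hT, hexp, hL⟩ := ZeroBalanced.exists_logarithmic_expansion (q := q + 1) ha hb hs
  refine ⟨ZeroBalanced.exists_isHypFunction ha hb hc hval, fun F hF => ?_⟩
  have hFy := hF.eqOn_cutDisc ha hb hc hval
  have hasymp : (fun z : ℂ => ZeroBalanced.gammaFactor (q + 2) a b * F z - (ZeroBalanced.constL a
      (ZeroBalanced.tailConst a (ZeroBalanced.levelCoeff (q + 1) a b) y.1 0) -
        Complex.log (1 - z))) =O[𝓝[ZeroBalanced.cutDisc] 1] fun z : ℂ => (1 - z) * Complex.log (1 - z) := by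
    rw [← hL]
    refine IsBigO.trans (EventuallyEq.isBigO ?_) (ZeroBalanced.LogSeq.isBigO_val_sub hc hy2)
    filter_upwards [self_mem_nhdsWithin] with z hz
    exact congrArg (fun x => x - _) (hFy hz)
  refine ⟨ZeroBalanced.tailConst a (ZeroBalanced.levelCoeff (q + 1) a b) y.1, hT,
    fun z hz => ?_, fun h0 => ?_, hasymp, ZeroBalanced.exists_factors hasymp⟩
  · have h1 := (hc.1.hasSum hz.1).sub ((hc.2.hasSum hz.1).mul_left (Complex.log (1 - z)))
    refine ZeroBalanced.HasSum.congr_of_eq h1 (fun n => ?_) (hFy hz)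
    rw [hexp]
    ring
  · have h1 := hT 0 (by simpa using h0)
    exact ⟨h1.summable, h1.tsum_eq.symm⟩
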